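/- Let $\beta>0$ and let $(\mu_n)_{n\ge 1}$ be a sequence of nonnegative real numbers such that $\mu_n/n\to c$ for some real constant $c$ (so $c\ge 0$). Put $\alpha_n=\mu_n/n$ and, for $\delta\ge 0$, $Q_\delta(t)=t^2+2\delta\log\frac1{|t|}$ (with $Q_0(t)=t^2$). For a probability measure $\nu$ on $\mathbb R$ let $$E_{\beta,c}(\nu)=\iint\Big(\tfrac{\beta}{2}\log\tfrac1{|s-t|}+\tfrac12Q_c(s)+\tfrac12Q_c(t)\Big)\,\nu(ds)\,\nu(dt)\in(-\infty,+\infty],$$ that is, $\frac\beta2\iint\log\frac1{|s-t|}\,\nu(ds)\nu(dt)+\int Q_c\,d\nu$ whenever this sum makes sense, and let $E^*_{\beta,c}=\inf_\nu E_{\beta,c}(\nu)$, the infimum being over all probability measures on $\mathbb R$. Let $\nu_{\beta,c}$ be the measure on $\mathbb R$ with density $$f_{\beta,c}(t)=\frac{2}{\pi\beta}\,\frac1{|t|}\sqrt{(t^2-a^2)(b^2-t^2)}\ \text{ for } t\in[-b,-a]\cup[a,b],\qquad f_{\beta,c}(t)=0\ \text{ otherwise},$$ where $a=\sqrt{\tfrac\beta2}\sqrt{1+\tfrac{2c}\beta-\sqrt{1+\tfrac{4c}\beta}}$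 and $b=\sqrt{\tfrac\beta2}\sqrt{1+\tfrac{2c}\beta+\sqrt{1+\tfrac{4c}\beta}}$. For $n\ge2$ and $x\in\mathbb R^n$ let $$K_n(x)=\frac\beta2\sum_{i\ne j}\log\frac1{|x_i-x_j|}+(n-1)\sum_{i=1}^nQ_{\alpha_n}(x_i)\in(-\infty,+\infty],\qquad \tau_n=\frac1{n(n-1)}\inf_{x\in\mathbb R^n}K_n(x),$$ $$A_n=\int_{\mathbb R^n}e^{-n\sum_{k=1}^n\lambda_k^2}\prod_{k=1}^n|\lambda_k|^{2\mu_n}\prod_{1\le i<j\le n}|\lambda_i-\lambda_j|^\beta\,d\lambda_1\cdots d\lambda_n .$$ Then $E^*_{\beta,c}$ is finite, $\nu_{\beta,c}$ is a probability measure with $E_{\beta,c}(\nu_{\beta,c})=E^*_{\beta,c}$, and: 1. $\displaystyle\lim_{n\to\infty}\tau_n=E^*_{\beta,c}$. 2. For every $n\ge2$ the function $K_n$ attains its infimum on $\mathbb R^n$; and if $\lambda^{(n)}=(\lambda^{(n)}_1,\dots,\lambda^{(n)}_n)$ is any minimizer of $K_n$ for each $n\ge 2$, then the measures $\rho_n=\frac1n\sum_{i=1}^n\delta_{\lambda^{(n)}_i}$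 converge weakly to $\nu_{\beta,c}$, that is, $\int f\,d\rho_n\to\int f\,d\nu_{\beta,c}$ for every bounded continuous $f:\mathbb R\to\mathbb R$. 3. $\displaystyle\lim_{n\to\infty}-\frac1{n^2}\log A_n=E^*_{\beta,c}$. -/

import Mathlib

open Filter Topology MeasureTheory
open scoped ENNReal BoundedContinuousFunction

noncomputable section

namespace LogGas

/-- The function `r ↦ log (1 / |r|)` on `ℝ`, with values in `(-∞, +∞]`; it is `+∞` at `0`. -/
def logInv (r : ℝ) : EReal :=
  if r = 0 then ⊤ else ((Real.log (1 / |r|) : ℝ) : EReal)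

/-- The potential `Q_δ(t) = t² + 2 δ log (1 / |t|)`, for `δ ≥ 0`, with values in `(-∞, +∞]`.
By the convention `0 * ⊤ = 0`, the potential `Q_0` is `t²` everywhere. -/
def potential (δ t : ℝ) : EReal :=
  ((t ^ 2 : ℝ) : EReal) + ((2 * δ : ℝ) : EReal) * logInv t

/-- The integral of an extended-real function: the integral of its positive part minus the
integral of its negative part. (It is used below only for functions bounded from below on
probability spaces, so that the second term is finite.) -/
def eintegral {X : Type*} [MeasurableSpace X] (m : Measure X) (f : X → EReal) : EReal :=
  ((∫⁻ x, (f x).toENNReal ∂m : ℝ≥0∞) : EReal) - ((∫⁻ x, (-f x).toENNReal ∂m : ℝ≥0∞) : EReal)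

/-- The kernel `(β/2) log (1 / |s - t|) + Q_δ(s) / 2 + Q_δ(t) / 2`. It is bounded from below on
`ℝ × ℝ` if `β > 0` and `δ ≥ 0`. -/
def energyKernel (β δ : ℝ) (p : ℝ × ℝ) : EReal :=
  ((β / 2 : ℝ) : EReal) * logInv (p.1 - p.2)
    + ((1 / 2 : ℝ) : EReal) * potential δ p.1 + ((1 / 2 : ℝ) : EReal) * potential δ p.2

/-- The energy
`E_{β,δ}(ν) = (β/2) ∬ log (1 / |s - t|) ν(ds) ν(dt) + ∫ Q_δ(t) ν(dt)`, in `(-∞, +∞]`,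
of a probability measure `ν` on `ℝ`. The two terms are put under one integral, whose integrand is
bounded from below: for `ν` with heavy tails the sum of the two separate integrals
can be of the form `-∞ + ∞`, while the energy is `+∞`. -/
def energy (β δ : ℝ) (ν : Measure ℝ) : EReal :=
  eintegral (ν.prod ν) (energyKernel β δ)

/-- `E*_{β,c}`, the infimum of the energy over all probability measures on `ℝ`. -/
def minEnergy (β c : ℝ) : EReal :=
  ⨅ ν : ProbabilityMeasure ℝ, energy β c (ν : Measure ℝ)

/-- The inner endpoint `a` of the support `[-b, -a] ∪ [a, b]`. -/
def innerEdge (β c : ℝ) : ℝ :=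
  √(β / 2) * √(1 + 2 * c / β - √(1 + 4 * c / β))

/-- The outer endpoint `b` of the support `[-b, -a] ∪ [a, b]`. -/
def outerEdge (β c : ℝ) : ℝ :=
  √(β / 2) * √(1 + 2 * c / β + √(1 + 4 * c / β))

open Classical in
/-- The density `f_{β,c}`, equal to `2 / (π β |t|) * √((t² - a²) (b² - t²))` on
`S = [-b, -a] ∪ [a, b]` and to `0` elsewhere. -/
def eqDensity (β c t : ℝ) : ℝ :=
  if t ∈ Set.Icc (-outerEdge β c) (-innerEdge β c) ∪ Set.Icc (innerEdge β c) (outerEdge β c) then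
    2 / (Real.pi * β) * (1 / |t|) *
      √((t ^ 2 - innerEdge β c ^ 2) * (outerEdge β c ^ 2 - t ^ 2))
  else 0

/-- The measure `ν_{β,c}` on `ℝ` with density `f_{β,c}`. -/
def eqMeasure (β c : ℝ) : Measure ℝ :=
  volume.withDensity fun t => ENNReal.ofReal (eqDensity β c t)

/-- The discrete energy
`K_n(x) = (β/2) ∑_{i ≠ j} log (1 / |x_i - x_j|) + (n - 1) ∑_i Q_α(x_i)` on `ℝⁿ`,
with `α = m / n`; it takes values in `(-∞, +∞]`. -/
def discreteEnergy (β m : ℝ) (n : ℕ) (x : Fin n → ℝ) : EReal :=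
  ((β / 2 : ℝ) : EReal) *
      ∑ p ∈ (Finset.univ : Finset (Fin n)).offDiag, logInv (x p.1 - x p.2)
    + (((n : ℝ) - 1 : ℝ) : EReal) * ∑ i, potential (m / n) (x i)

/-- `τ_n = (1 / (n (n - 1))) inf K_n`, the infimum being over all of `ℝⁿ`. -/
def tau (β m : ℝ) (n : ℕ) : EReal :=
  ((1 / ((n : ℝ) * ((n : ℝ) - 1)) : ℝ) : EReal) * ⨅ x : Fin n → ℝ, discreteEnergy β m n x

/-- `x` is a minimizer of `K_n` on `ℝⁿ`. -/
def IsFekete (β m : ℝ) (n : ℕ) (x : Fin n → ℝ) : Prop :=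
  discreteEnergy β m n x = ⨅ y : Fin n → ℝ, discreteEnergy β m n y

/-- The empirical measure `(1/n) ∑_i δ_{x_i}`. -/
def empirical (n : ℕ) (x : Fin n → ℝ) : Measure ℝ :=
  ENNReal.ofReal (1 / (n : ℝ)) • ∑ i, Measure.dirac (x i)

/-- The integral
`A_n = ∫_{ℝⁿ} exp (-n ∑ x_k²) ∏ |x_k|^(2m) ∏_{i < j} |x_i - x_j|^β dx₁ ⋯ dx_n`, in `[0, +∞]`. -/
def partitionFn (β m : ℝ) (n : ℕ) : ℝ≥0∞ :=
  ∫⁻ x : Fin n → ℝ, ENNReal.ofReal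
    (Real.exp (-(n : ℝ) * ∑ k, x k ^ 2) * (∏ k, |x k| ^ (2 * m)) *
      ∏ i, ∏ j ∈ Finset.Ioi i, |x i - x j| ^ β)

end LogGas

end

/-!
The logarithmic kernel is positive definite on signed measures of mass zero, so a probability
measure `ν` with compact support minimizes the energy as soon as it satisfies the Euler-Lagrange
conditions: `β U + Q_c` equals a constant on the support of `ν` and is at least that constant
elsewhere, where `U` is the logarithmic potential of `ν`. Everything in the theorem follows from a
quantitative and discrete version of this fact for `ν = ν_{β,c}`.

*The equilibrium measure.* With `κ = β / 4 + c` and `r = √(β / (β + 4 c))`, the law of `s²`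
under `ν_{β,c}` is the law of `κ |1 + r ζ|²`, where `ζ` has the probability density
`2 (Im ζ)² / |1 + r ζ|²` with respect to the uniform measure on the unit circle. This density is a
combination of `1`, `Re ζ` and the Poisson kernel at `-r`, so its logarithmic potential is known in
closed form from circle averages of `log |ζ - w|`, with `t² = κ (1 + r w) (1 + r / w)`. On the
support `|w| = 1`, and one reads off the Euler-Lagrange equation; off the support `w` is real and
the inequality follows from the sign of a derivative (`eulerLagrange_eq`, `eulerLagrange_le`).

*The lower bound.* The kernel `-½ log (x² + ε²)` is, up to constants, a positive mixture of
characters, so its energy on `ρ - ν` dominates a weighted squared `L²` distance of characteristic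
functions (`integral_charFun_sub_sq_le`). Let `ρ` be the empirical measure of `n` points. Replacing
`log |x|` by `½ log (x² + ε²)` costs `O(n log (1 / ε))` on the diagonal and `O(n² √ε)` in the
potential of `ν`, whose density is bounded. With the Euler-Lagrange inequality this gives
`K_n(x) ≥ n² (E - η + (β / 2) dist(ρ, ν)²) + κ' n ∑ x_i²` for all large `n`
(`eventually_le_realEnergy`); a small share of the external potential is set aside to absorb the
difference between `Q_{α_n}` and `Q_c` and to control the second moment.

*The upper bound.* The mean of `K_n` over independent points with law `ρ` is `n (n - 1)` times the
energy of `ρ`. Hence a lower bound for `K_n / (n (n - 1))` is one for the energy of every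
probability measure (`le_energy_of_le_realEnergy`), which proves that `ν` is a minimizer; and
`inf K_n` is at most `n (n - 1)` times the energy of `ν` in the potential `Q_{α_n}`, which converges
to `E*`. This gives the limit of `τ_n`.

*Minimizers.* They exist because `exp (-K_n)` is continuous and vanishes at infinity. For them the
two bounds force the distance of the characteristic functions to `0` and keep the second moments
bounded; so the characteristic functions are equi-Lipschitz and converge pointwise, and Lévy's
theorem applies.

*The partition function.* The integrand of `A_n` is `exp (-K_n - ∑ Q_{α_n}(x_i))`. It is at most
`exp (-inf K_n)` times an integrable product, which bounds `A_n` from above; Jensen's inequality for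
`n` independent points with law `ν`, whose density is bounded, bounds it from below.
-/

namespace LogGas

/-! ### Circle averages of `log ‖ζ - w‖` against a weight -/

section CircleAverages

open Complex Metric Real

/-- On the unit circle `‖ζ - w‖ = ‖1 - w̄ ζ‖`; the right-hand side has no zero in the closed disc
if `‖w‖ < 1`. -/
lemma norm_sub_eq_norm_one_sub {ζ : ℂ} (hζ : ‖ζ‖ = 1) (w : ℂ) :
    ‖ζ - w‖ = ‖1 - (starRingEnd ℂ) w * ζ‖ := by
  have h1 : ζ * (starRingEnd ℂ) ζ = 1 := by
    rw [Complex.mul_conj, Complex.normSq_eq_norm_sq, hζ]; simp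
  have h2 : 1 - (starRingEnd ℂ) w * ζ = ζ * (starRingEnd ℂ) (ζ - w) := by
    rw [map_sub, mul_sub, h1]; ring
  rw [h2, norm_mul, hζ, one_mul, RCLike.norm_conj]

lemma one_sub_conj_mul_mem_slitPlane {w ζ : ℂ} (hw : ‖w‖ < 1) (hζ : ‖ζ‖ ≤ 1) :
    1 - (starRingEnd ℂ) w * ζ ∈ Complex.slitPlane := by
  have h : ‖(starRingEnd ℂ) w * ζ‖ < 1 := by
    rw [norm_mul, RCLike.norm_conj]
    nlinarith [norm_nonneg w, norm_nonneg ζ]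
  left
  have := (Complex.abs_re_le_norm ((starRingEnd ℂ) w * ζ))
  have := le_abs_self ((starRingEnd ℂ) w * ζ).re
  simp only [Complex.sub_re, Complex.one_re]
  linarith

lemma circleAverage_re_mul_log_of_norm_lt {w : ℂ} (hw : ‖w‖ < 1) :
    circleAverage (fun ζ => ζ.re * Real.log ‖ζ - w‖) 0 1 = -w.re / 2 := by
  set F : ℂ → ℂ := fun ζ => Complex.log (1 - (starRingEnd ℂ) w * ζ) with hF
  have hFd : ∀ ζ : ℂ, ‖ζ‖ ≤ 1 → DifferentiableAt ℂ F ζ := fun ζ hζ =>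
    DifferentiableAt.clog (by fun_prop) (one_sub_conj_mul_mem_slitPlane hw hζ)
  have hmem : ∀ ζ ∈ closedBall (0 : ℂ) 1, ‖ζ‖ ≤ 1 := fun ζ hζ => by simpa using hζ
  have hmem' : ∀ ζ ∈ sphere (0 : ℂ) |1|, ‖ζ‖ = 1 := fun ζ hζ => by simpa using hζ
  have hFcont : ContinuousOn F (sphere 0 |1|) := fun ζ hζ =>
    ((hFd ζ (hmem' ζ hζ).le).continuousAt).continuousWithinAt
  have hinv : ContinuousOn (fun ζ : ℂ => ζ⁻¹) (sphere 0 |1|) :=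
    continuousOn_inv₀.mono fun ζ hζ h0 => by
      have := hmem' ζ hζ
      rw [h0] at this; simp at this
  have hi1 : CircleIntegrable (fun ζ => ζ * F ζ) 0 1 :=
    ContinuousOn.circleIntegrable' (continuousOn_id.mul hFcont)
  have hi2 : CircleIntegrable (fun ζ => ζ⁻¹ * F ζ) 0 1 :=
    ContinuousOn.circleIntegrable' (hinv.mul hFcont)
  have h1 : circleAverage (fun ζ => ζ * F ζ) 0 1 = 0 := by
    have := circleAverage_of_differentiable_on_off_countable (f := fun ζ => ζ * F ζ) (c := 0)
      (R := 1) (s := ∅) Set.countable_empty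
      (fun ζ hζ => by
        rw [abs_one] at hζ
        exact (differentiableAt_id.mul (hFd ζ (hmem ζ hζ))).continuousAt.continuousWithinAt)
      (fun ζ hζ => by
        have h := ball_subset_closedBall hζ.1
        rw [abs_one] at h
        exact differentiableAt_id.mul (hFd ζ (hmem ζ h)))
    simpa using this
  have hderiv : deriv F 0 = -(starRingEnd ℂ) w := by
    have h : HasDerivAt (fun ζ : ℂ => 1 - (starRingEnd ℂ) w * ζ) (-(starRingEnd ℂ) w) 0 := by
      simpa using ((hasDerivAt_id (0 : ℂ)).const_mul ((starRingEnd ℂ) w)).const_sub 1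
    have := (h.clog (one_sub_conj_mul_mem_slitPlane hw (by simp))).deriv
    simpa [hF] using this
  have h2 : circleAverage (fun ζ => ζ⁻¹ * F ζ) 0 1 = -(starRingEnd ℂ) w := by
    have hU : IsOpen {ζ : ℂ | 1 - (starRingEnd ℂ) w * ζ ∈ Complex.slitPlane} :=
      Complex.isOpen_slitPlane.preimage (by fun_prop)
    have := two_pi_I_inv_smul_circleIntegral_sub_sq_inv_smul_of_differentiable hU
      (c := (0 : ℂ)) (R := 1) (w₀ := 0) (f := F)
      (fun ζ hζ => one_sub_conj_mul_mem_slitPlane hw (hmem ζ hζ))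
      (fun ζ hζ => (DifferentiableAt.clog (f := fun ζ => 1 - (starRingEnd ℂ) w * ζ)
        (by fun_prop) hζ).differentiableWithinAt)
      (by simp)
    rw [circleAverage_eq_circleIntegral one_ne_zero, ← hderiv, ← this]
    congr 2
    ext ζ
    simp only [sub_zero, smul_eq_mul]
    rw [sq, mul_inv]; ring
  have h3 : circleAverage (fun ζ => (ζ * F ζ + ζ⁻¹ * F ζ)) 0 1 = -(starRingEnd ℂ) w := by
    rw [circleAverage_fun_add hi1 hi2, h1, h2, zero_add]
  have h4 := Complex.reCLM.circleAverage_comp_comm (hi1.add hi2)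
  have h5 : circleAverage (fun ζ => 2 * (ζ.re * Real.log ‖ζ - w‖)) 0 1 = -w.re := by
    have h6 : Complex.reCLM (circleAverage ((fun ζ => ζ * F ζ) + fun ζ => ζ⁻¹ * F ζ) 0 1)
        = -w.re := by
      have : circleAverage ((fun ζ => ζ * F ζ) + fun ζ => ζ⁻¹ * F ζ) 0 1 = -(starRingEnd ℂ) w := h3
      rw [this]; simp
    rw [← h6, ← h4]
    refine circleAverage_congr_sphere fun ζ hζ => ?_
    have hn := hmem' ζ hζ
    have hinv : ζ⁻¹ = (starRingEnd ℂ) ζ := by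
      rw [Complex.inv_def, Complex.normSq_eq_norm_sq, hn]; simp
    simp only [Function.comp_apply, Pi.add_apply, Complex.reCLM_apply]
    rw [hinv, ← add_mul, Complex.add_conj, norm_sub_eq_norm_one_sub hn, Complex.re_ofReal_mul,
      Complex.log_re]
    ring
  have h7 := circleAverage_fun_smul (f := fun ζ : ℂ => ζ.re * Real.log ‖ζ - w‖) (c := 0) (R := 1)
    (a := (2 : ℝ))
  simp only [smul_eq_mul] at h7
  rw [h5] at h7
  linarith

lemma circleAverage_poissonKernel_mul_log_of_norm_lt {w z : ℂ} (hw : ‖w‖ < 1) (hz : ‖z‖ < 1) :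
    circleAverage (fun ζ => poissonKernel 0 z ζ * Real.log ‖ζ - w‖) 0 1 =
      Real.log ‖1 - (starRingEnd ℂ) w * z‖ := by
  have hh : InnerProductSpace.HarmonicOnNhd
      (fun ζ : ℂ => Real.log ‖1 - (starRingEnd ℂ) w * ζ‖) (closedBall 0 1) := fun ζ hζ =>
    AnalyticAt.harmonicAt_log_norm (by fun_prop)
      (Complex.slitPlane_ne_zero (one_sub_conj_mul_mem_slitPlane hw (by simpa using hζ)))
  rw [← InnerProductSpace.HarmonicOnNhd.circleAverage_poissonKernel_smul hh
    (w := z) (by simpa using hz)]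
  refine circleAverage_congr_sphere fun ζ hζ => ?_
  have hn : ‖ζ‖ = 1 := by simpa using hζ
  simp only [Pi.smul_apply', smul_eq_mul, norm_sub_eq_norm_one_sub hn w]

/-- Weighted averages of `log ‖ζ - w‖` over the unit circle are radially continuous up to the
boundary point `w`. -/
lemma tendsto_circleAverage_mul_log {g : ℂ → ℝ} (hg : ContinuousOn g (sphere 0 1)) {w : ℂ}
    (hw : ‖w‖ = 1) :
    Tendsto (fun s : ℝ => circleAverage (fun ζ => g ζ * Real.log ‖ζ - s * w‖) 0 1) (𝓝[<] 1)
      (𝓝 (circleAverage (fun ζ => g ζ * Real.log ‖ζ - w‖) 0 1)) := by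
  obtain ⟨C, hC⟩ := (isCompact_sphere (0 : ℂ) 1).exists_bound_of_continuousOn hg
  have hC0 : 0 ≤ C := (norm_nonneg _).trans (hC 1 (by simp))
  have hcirc : ∀ θ : ℝ, ‖circleMap 0 1 θ‖ = 1 := fun θ => by simp
  have hgc : Continuous fun θ : ℝ => g (circleMap 0 1 θ) :=
    hg.comp_continuous (continuous_circleMap 0 1) fun θ => by simp
  have hlogm : ∀ u : ℂ, AEStronglyMeasurable (fun θ : ℝ => Real.log ‖circleMap 0 1 θ - u‖)
      (volume.restrict (Set.uIoc 0 (2 * π))) := fun u =>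
    ((Real.measurable_log.comp ((continuous_circleMap 0 1).sub
      continuous_const).norm.measurable)).aestronglyMeasurable
  have hne : ∀ᵐ θ : ℝ, θ ∈ Set.uIoc 0 (2 * π) → circleMap 0 1 θ ≠ w := by
    rw [Set.uIoc_of_le two_pi_pos.le]
    have hsub : ({θ : ℝ | θ ∈ Set.Ioc 0 (2 * π) ∧ circleMap 0 1 θ = w}).Subsingleton := by
      intro x hx y hy
      have := injOn_circleMap_of_abs_sub_le (c := 0) (R := 1) one_ne_zero (a := 0) (b := 2 * π)
        (by simp [abs_of_pos Real.pi_pos])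
      rw [Set.uIoc_of_le two_pi_pos.le] at this
      exact this hx.1 hy.1 (hx.2.trans hy.2.symm)
    have h0 : volume {θ : ℝ | θ ∈ Set.Ioc 0 (2 * π) ∧ circleMap 0 1 θ = w} = 0 :=
      hsub.measure_zero volume
    rw [ae_iff]
    convert h0 using 3
    ext θ
    simp only [ne_eq, Classical.not_imp, not_not]
  unfold circleAverage
  refine Tendsto.const_smul ?_ _
  have hs : ∀ᶠ s : ℝ in 𝓝[<] 1, s ∈ Set.Ioo (0 : ℝ) 1 := Ioo_mem_nhdsLT one_pos
  refine intervalIntegral.tendsto_integral_filter_of_dominated_convergence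
    (fun θ => C * (|Real.log ‖circleMap 0 1 θ - w‖| + Real.log 2)) ?_ ?_ ?_ ?_
  · exact Eventually.of_forall fun s => hgc.aestronglyMeasurable.mul (hlogm _)
  · filter_upwards [hs] with s hs
    filter_upwards [hne] with θ hθ hmem
    have hθ := hθ hmem
    have hsw : ‖(s : ℂ) * w‖ = s := by
      rw [norm_mul, hw, mul_one, Complex.norm_real, Real.norm_of_nonneg hs.1.le]
    have hpos : 0 < ‖circleMap 0 1 θ - w‖ := norm_pos_iff.2 (sub_ne_zero.2 hθ)
    have hlow : 1 - s ≤ ‖circleMap 0 1 θ - s * w‖ := by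
      have := norm_sub_norm_le (circleMap 0 1 θ) (s * w)
      rwa [hcirc, hsw] at this
    have hdist : ‖(s : ℂ) * w - w‖ = 1 - s := by
      have : (s : ℂ) * w - w = ((s - 1 : ℝ) : ℂ) * w := by push_cast; ring
      rw [this, norm_mul, hw, mul_one, Complex.norm_real, Real.norm_of_nonpos (by linarith [hs.2])]
      ring
    have htwo : ‖circleMap 0 1 θ - w‖ ≤ 2 * ‖circleMap 0 1 θ - s * w‖ := by
      have := norm_sub_le_norm_sub_add_norm_sub (circleMap 0 1 θ) (s * w) w
      rw [hdist] at this
      linarith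
    have hup : ‖circleMap 0 1 θ - s * w‖ ≤ 2 := by
      have := norm_sub_le (circleMap 0 1 θ) (s * w)
      rw [hcirc, hsw] at this
      linarith [hs.2]
    have hpos' : 0 < ‖circleMap 0 1 θ - s * w‖ := by linarith
    have h1 : Real.log ‖circleMap 0 1 θ - w‖ ≤ Real.log 2 + Real.log ‖circleMap 0 1 θ - s * w‖ := by
      rw [← Real.log_mul two_ne_zero hpos'.ne']
      exact Real.log_le_log hpos htwo
    have h2 : Real.log ‖circleMap 0 1 θ - s * w‖ ≤ Real.log 2 := Real.log_le_log hpos' hup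
    rw [norm_mul]
    refine mul_le_mul (hC _ (by simp)) ?_ (norm_nonneg _) hC0
    rw [Real.norm_eq_abs, abs_le]
    have := neg_abs_le (Real.log ‖circleMap 0 1 θ - w‖)
    have := abs_nonneg (Real.log ‖circleMap 0 1 θ - w‖)
    constructor <;> linarith
  · have := (circleIntegrable_log_norm_sub_const (a := w) (c := 0) 1)
    have h2 : IntervalIntegrable (fun θ : ℝ => |Real.log ‖circleMap 0 1 θ - w‖| + Real.log 2)
      volume 0 (2 * π) := (IntervalIntegrable.abs this).add intervalIntegrable_const
    exact h2.const_mul C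
  · filter_upwards [hne] with θ hθ hmem
    have hθ := hθ hmem
    refine Tendsto.const_mul _ ?_
    refine (Real.continuousAt_log (norm_ne_zero_iff.2 (sub_ne_zero.2 hθ))).tendsto.comp ?_
    have : Tendsto (fun s : ℝ => ‖circleMap 0 1 θ - s * w‖) (𝓝 1)
        (𝓝 ‖circleMap 0 1 θ - ((1 : ℝ) : ℂ) * w‖) := by
      refine Continuous.tendsto ?_ 1
      fun_prop
    simpa using this.mono_left nhdsWithin_le_nhds

lemma circleAverage_re_mul_log {w : ℂ} (hw : ‖w‖ ≤ 1) :
    circleAverage (fun ζ => ζ.re * Real.log ‖ζ - w‖) 0 1 = -w.re / 2 := by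
  rcases hw.lt_or_eq with hw | hw
  · exact circleAverage_re_mul_log_of_norm_lt hw
  refine tendsto_nhds_unique (tendsto_circleAverage_mul_log
    (Complex.continuous_re.continuousOn) hw) ?_
  have h : Tendsto (fun s : ℝ => -(s * w.re) / 2) (𝓝[<] 1) (𝓝 (-(1 * w.re) / 2)) :=
    (Continuous.tendsto (by fun_prop) 1).mono_left nhdsWithin_le_nhds
  rw [one_mul] at h
  refine h.congr' ?_
  filter_upwards [Ioo_mem_nhdsLT (zero_lt_one' ℝ)] with s hs
  rw [circleAverage_re_mul_log_of_norm_lt]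
  · simp
  · rw [norm_mul, hw, mul_one, Complex.norm_real, Real.norm_of_nonneg hs.1.le]; exact hs.2

lemma circleAverage_poissonKernel_mul_log {w z : ℂ} (hw : ‖w‖ ≤ 1) (hz : ‖z‖ < 1) :
    circleAverage (fun ζ => poissonKernel 0 z ζ * Real.log ‖ζ - w‖) 0 1 =
      Real.log ‖1 - (starRingEnd ℂ) w * z‖ := by
  rcases hw.lt_or_eq with hw | hw
  · exact circleAverage_poissonKernel_mul_log_of_norm_lt hw hz
  have hcont : ContinuousOn (poissonKernel 0 z) (sphere 0 1) := by
    unfold poissonKernel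
    refine ContinuousOn.div (by fun_prop) (by fun_prop) fun ζ hζ => ?_
    have hn : ‖ζ‖ = 1 := by simpa using hζ
    refine pow_ne_zero _ (norm_ne_zero_iff.2 fun h => ?_)
    rw [sub_zero, sub_zero, sub_eq_zero] at h
    rw [← h, hn] at hz
    exact lt_irrefl _ hz
  refine tendsto_nhds_unique (tendsto_circleAverage_mul_log hcont hw) ?_
  have hne : (1 : ℂ) - (starRingEnd ℂ) w * z ≠ 0 := by
    intro h
    have h1 : (starRingEnd ℂ) w * z = 1 := (sub_eq_zero.1 h).symm
    have h2 := congrArg norm h1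
    rw [norm_mul, RCLike.norm_conj, hw, one_mul, norm_one] at h2
    linarith
  have h : Tendsto (fun s : ℝ => Real.log ‖1 - (starRingEnd ℂ) (s * w) * z‖) (𝓝[<] 1)
      (𝓝 (Real.log ‖1 - (starRingEnd ℂ) w * z‖)) := by
    refine (Real.continuousAt_log (norm_ne_zero_iff.2 hne)).tendsto.comp ?_
    have : Tendsto (fun s : ℝ => ‖1 - (starRingEnd ℂ) (s * w) * z‖) (𝓝 1)
        (𝓝 ‖1 - (starRingEnd ℂ) (((1 : ℝ) : ℂ) * w) * z‖) := by
      refine Continuous.tendsto ?_ 1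
      have : Continuous fun x : ℝ => (starRingEnd ℂ) (x * w) :=
        Complex.continuous_conj.comp (by fun_prop)
      fun_prop
    simpa using this.mono_left nhdsWithin_le_nhds
  refine h.congr' ?_
  filter_upwards [Ioo_mem_nhdsLT (zero_lt_one' ℝ)] with s hs
  rw [circleAverage_poissonKernel_mul_log_of_norm_lt _ hz]
  rw [norm_mul, hw, mul_one, Complex.norm_real, Real.norm_of_nonneg hs.1.le]; exact hs.2

end CircleAverages

/-! ### The weight of the equilibrium measure on the unit circle -/

section CircleWeight

open Complex Metric Real

/-- The weight `2 (Im ζ)² / |1 + r ζ|²` on the unit circle. In the coordinate `ζ = e^{iθ}` with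
`t² = κ |1 + r ζ|²`, it is the density of the equilibrium measure with respect to `dθ / (2π)`. -/
noncomputable def circleWeight (r : ℝ) (ζ : ℂ) : ℝ := 2 * ζ.im ^ 2 / ‖1 + r * ζ‖ ^ 2

lemma sq_norm_one_add {r : ℝ} {ζ : ℂ} (hζ : ‖ζ‖ = 1) :
    ‖1 + r * ζ‖ ^ 2 = 1 + 2 * r * ζ.re + r ^ 2 := by
  have h : ζ.re ^ 2 + ζ.im ^ 2 = 1 := by
    have := Complex.sq_norm ζ
    rw [hζ, Complex.normSq_apply] at this
    nlinarith
  rw [Complex.sq_norm, Complex.normSq_apply]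
  simp
  nlinarith

/-- The weight is a trigonometric polynomial of degree one plus a multiple of the Poisson kernel
at `-r`. -/
lemma circleWeight_eq {r : ℝ} (hr : 0 < r) {ζ : ℂ} (hζ : ‖ζ‖ = 1) (hne : 1 + r * ζ ≠ 0) :
    circleWeight r ζ = (1 + r ^ 2) / (2 * r ^ 2) - ζ.re / r
      - (1 - r ^ 2) / (2 * r ^ 2) * poissonKernel 0 (-r : ℂ) ζ := by
  have hD : ‖1 + r * ζ‖ ^ 2 ≠ 0 := pow_ne_zero _ (norm_ne_zero_iff.2 hne)
  have h : ζ.re ^ 2 + ζ.im ^ 2 = 1 := by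
    have := Complex.sq_norm ζ
    rw [hζ, Complex.normSq_apply] at this
    nlinarith
  have h2 : ‖ζ - 0 - (-(r : ℂ) - 0)‖ ^ 2 = ‖1 + r * ζ‖ ^ 2 := by
    rw [sq_norm_one_add hζ, Complex.sq_norm, Complex.normSq_apply]
    simp
    nlinarith
  rw [circleWeight, poissonKernel, h2]
  have h3 : ‖-(r : ℂ) - 0‖ ^ 2 = r ^ 2 := by simp
  rw [h3, sub_zero, hζ]
  rw [sq_norm_one_add hζ] at hD ⊢
  have him : ζ.im ^ 2 = 1 - ζ.re ^ 2 := by linarith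
  rw [him]
  generalize hDe : 1 + 2 * r * ζ.re + r ^ 2 = D at hD ⊢
  field_simp
  rw [← hDe]
  ring

lemma ae_one_add_ne_zero {r : ℝ} : ∀ᶠ ζ in codiscreteWithin (sphere (0 : ℂ) |1|),
    (1 : ℂ) + r * ζ ≠ 0 := by
  by_cases hr : (r : ℂ) = 0
  · simp [hr]
  have : {-(r : ℂ)⁻¹}ᶜ ∈ codiscreteWithin (sphere (0 : ℂ) |1|) :=
    codiscreteWithin_mono (Set.subset_univ _)
      (Set.finite_singleton (-(r : ℂ)⁻¹)).compl_mem_codiscrete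
  filter_upwards [this] with ζ hζ h
  apply hζ
  rw [Set.mem_singleton_iff]
  field_simp
  linear_combination h

lemma continuousOn_poissonKernel_neg {r : ℝ} (hr : 0 < r) (hr1 : r < 1) :
    ContinuousOn (poissonKernel 0 (-r : ℂ)) (sphere 0 |1|) := by
  unfold poissonKernel
  refine ContinuousOn.div (by fun_prop) (by fun_prop) fun ζ hζ => ?_
  have hn : ‖ζ‖ = 1 := by simpa using hζ
  refine pow_ne_zero _ (norm_ne_zero_iff.2 fun h => ?_)
  rw [sub_zero, sub_zero, sub_eq_zero] at h
  rw [h, norm_neg, Complex.norm_real, Real.norm_of_nonneg hr.le] at hn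
  exact hr1.ne hn

/-- The average of a function against the weight, split along `circleWeight_eq`. -/
lemma circleAverage_circleWeight_mul {r : ℝ} (hr : 0 < r) (hr1 : r ≤ 1) {g : ℂ → ℝ}
    (hg : CircleIntegrable g 0 1) :
    circleAverage (fun ζ => circleWeight r ζ * g ζ) 0 1 =
      (1 + r ^ 2) / (2 * r ^ 2) * circleAverage g 0 1
        - 1 / r * circleAverage (fun ζ => ζ.re * g ζ) 0 1
        - (1 - r ^ 2) / (2 * r ^ 2)
          * circleAverage (fun ζ => poissonKernel 0 (-r : ℂ) ζ * g ζ) 0 1 := by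
  have hmul : ∀ k : ℂ → ℝ, ContinuousOn k (sphere 0 |1|) →
      CircleIntegrable (fun ζ => k ζ * g ζ) 0 1 := by
    intro k hk
    have hkc : Continuous fun θ : ℝ => k (circleMap 0 1 θ) :=
      hk.comp_continuous (continuous_circleMap 0 1) fun θ => by simp
    exact IntervalIntegrable.continuousOn_mul hg hkc.continuousOn
  have hP : CircleIntegrable
      (fun ζ => ((1 - r ^ 2) / (2 * r ^ 2)) • (poissonKernel 0 (-r : ℂ) ζ * g ζ)) 0 1 := by
    rcases hr1.lt_or_eq with h | h
    · exact (hmul _ (continuousOn_poissonKernel_neg hr h)).const_fun_smul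
    · subst h
      simp
  have hR : CircleIntegrable (fun ζ => (1 / r) • (ζ.re * g ζ)) 0 1 :=
    (hmul _ Complex.continuous_re.continuousOn).const_fun_smul
  have hC : CircleIntegrable (fun ζ => ((1 + r ^ 2) / (2 * r ^ 2)) • g ζ) 0 1 :=
    hg.const_fun_smul
  rw [← smul_eq_mul ((1 + r ^ 2) / (2 * r ^ 2)), ← smul_eq_mul (1 / r),
    ← smul_eq_mul ((1 - r ^ 2) / (2 * r ^ 2)), ← circleAverage_fun_smul, ← circleAverage_fun_smul,
    ← circleAverage_fun_smul, ← circleAverage_fun_sub hC hR,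
    ← circleAverage_fun_sub (f₁ := fun ζ =>
      ((1 + r ^ 2) / (2 * r ^ 2)) • g ζ - (1 / r) • (ζ.re * g ζ)) (hC.sub hR) hP]
  refine circleAverage_congr_codiscreteWithin ?_ one_ne_zero
  filter_upwards [ae_one_add_ne_zero (r := r), self_mem_codiscreteWithin (sphere (0 : ℂ) |1|)]
    with ζ hζ hmem
  rw [circleWeight_eq hr (by simpa using hmem) hζ]
  simp only [smul_eq_mul]
  ring

lemma circleAverage_re : circleAverage (fun ζ => ζ.re) 0 1 = 0 := by
  have h := Complex.reCLM.circleAverage_comp_comm (f := fun ζ : ℂ => ζ) (c := 0) (R := 1)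
    (ContinuousOn.circleIntegrable' continuousOn_id)
  have h2 := circleAverage_of_differentiable_on_off_countable (f := fun ζ : ℂ => ζ) (c := 0)
      (R := 1) (s := ∅) Set.countable_empty continuousOn_id (fun ζ _ => differentiableAt_id)
  rw [h2] at h
  simpa [Function.comp_def] using h

lemma circleAverage_circleWeight {r : ℝ} (hr : 0 < r) (hr1 : r ≤ 1) :
    circleAverage (circleWeight r) 0 1 = 1 := by
  have h := circleAverage_circleWeight_mul hr hr1 (g := fun _ => 1) (circleIntegrable_const 1 0 1)
  simp only [mul_one, circleAverage_re, circleAverage_const] at h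
  have h1 : circleAverage (circleWeight r) 0 1 = (1 + r ^ 2) / (2 * r ^ 2)
      - (1 - r ^ 2) / (2 * r ^ 2) * circleAverage (fun ζ => poissonKernel 0 (-r : ℂ) ζ) 0 1 := by
    rw [← sub_zero ((1 + r ^ 2) / (2 * r ^ 2)), ← mul_zero (1 / r)]; exact h
  rw [h1]
  rcases hr1.lt_or_eq with h2 | h2
  · have hP := InnerProductSpace.HarmonicOnNhd.circleAverage_poissonKernel_smul (c := 0) (R := 1)
      (w := (-r : ℂ)) (f := fun _ => (1 : ℝ))
      (fun _ _ => InnerProductSpace.harmonicAt_const 1)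
      (by simpa [abs_of_pos hr] using h2)
    have hP' : circleAverage (fun ζ => poissonKernel 0 (-r : ℂ) ζ) 0 1 = 1 := by
      rw [← hP]; congr 1; ext ζ; simp
    rw [hP']
    field_simp; ring
  · subst h2; norm_num

/-- The logarithmic potential of the weight, inside and on the unit circle. -/
lemma circleAverage_circleWeight_mul_log {r : ℝ} (hr : 0 < r) (hr1 : r ≤ 1) {w : ℂ}
    (hw : ‖w‖ ≤ 1) :
    circleAverage (fun ζ => circleWeight r ζ * Real.log ‖ζ - w‖) 0 1 =
      w.re / (2 * r) - (1 - r ^ 2) / (2 * r ^ 2) * Real.log ‖1 + r * w‖ := by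
  rw [circleAverage_circleWeight_mul hr hr1 (circleIntegrable_log_norm_sub_const 1),
    circleAverage_log_norm_sub_const_of_mem_closedBall (by simpa using hw),
    circleAverage_re_mul_log hw, Real.log_one]
  rcases hr1.lt_or_eq with h | h
  · rw [circleAverage_poissonKernel_mul_log hw (by simpa [abs_of_pos hr] using h)]
    have : ‖1 - (starRingEnd ℂ) w * -(r : ℂ)‖ = ‖1 + r * w‖ := by
      rw [← RCLike.norm_conj]
      simp [mul_comm]
    rw [this]
    field_simp; ring
  · subst h; norm_num; ring

lemma integral_zero_two_pi {h : ℝ → ℝ} (hh : IntervalIntegrable h volume 0 (2 * π)) :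
    ∫ θ in 0..2 * π, h θ = ∫ θ in 0..π, (h θ + h (2 * π - θ)) := by
  have h1 : IntervalIntegrable h volume 0 π := hh.mono_set (by
    rw [Set.uIcc_of_le pi_pos.le, Set.uIcc_of_le two_pi_pos.le]
    exact Set.Icc_subset_Icc_right (by linarith [pi_pos]))
  have h2 : IntervalIntegrable h volume π (2 * π) := hh.mono_set (by
    rw [Set.uIcc_of_le (by linarith [pi_pos]), Set.uIcc_of_le two_pi_pos.le]
    exact Set.Icc_subset_Icc_left pi_pos.le)
  have h3 : IntervalIntegrable (fun θ => h (2 * π - θ)) volume 0 π := by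
    have := (h2.comp_sub_left (2 * π)).symm
    convert this using 1 <;> ring
  rw [intervalIntegral.integral_add h1 h3, intervalIntegral.integral_comp_sub_left,
    ← intervalIntegral.integral_add_adjacent_intervals h1 h2]
  congr 2 <;> ring

/-- The weight in the angular coordinate. -/
noncomputable def angleWeight (r θ : ℝ) : ℝ := 2 * Real.sin θ ^ 2 / (1 + 2 * r * Real.cos θ + r ^ 2)

lemma circleMap_re (θ : ℝ) : (circleMap 0 1 θ).re = Real.cos θ := by
  simp [circleMap, Complex.exp_ofReal_mul_I_re]

lemma circleMap_im (θ : ℝ) : (circleMap 0 1 θ).im = Real.sin θ := by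
  simp [circleMap, Complex.exp_ofReal_mul_I_im]

lemma circleWeight_circleMap (r θ : ℝ) : circleWeight r (circleMap 0 1 θ) = angleWeight r θ := by
  rw [circleWeight, angleWeight, sq_norm_one_add (by simp), circleMap_re, circleMap_im]

lemma circleMap_two_pi_sub (θ : ℝ) :
    circleMap 0 1 (2 * π - θ) = (starRingEnd ℂ) (circleMap 0 1 θ) := by
  apply Complex.ext
  · rw [Complex.conj_re, circleMap_re, circleMap_re, Real.cos_two_pi_sub]
  · rw [Complex.conj_im, circleMap_im, circleMap_im, Real.sin_two_pi_sub]

lemma angleWeight_two_pi_sub (r θ : ℝ) : angleWeight r (2 * π - θ) = angleWeight r θ := by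
  simp [angleWeight, Real.cos_two_pi_sub, Real.sin_two_pi_sub]

lemma one_add_two_mul_cos_nonneg (r θ : ℝ) : 0 ≤ 1 + 2 * r * Real.cos θ + r ^ 2 := by
  nlinarith [sq_nonneg (r + Real.cos θ), Real.sin_sq_add_cos_sq θ, sq_nonneg (Real.sin θ)]

lemma angleWeight_nonneg (r θ : ℝ) : 0 ≤ angleWeight r θ :=
  div_nonneg (by positivity) (one_add_two_mul_cos_nonneg r θ)

lemma angleWeight_le (r θ : ℝ) : angleWeight r θ ≤ 2 := by
  unfold angleWeight
  rcases (one_add_two_mul_cos_nonneg r θ).eq_or_lt with h | h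
  · rw [← h]; simp
  · rw [div_le_iff₀ h]
    nlinarith [sq_nonneg (r + Real.cos θ), Real.sin_sq_add_cos_sq θ]

lemma measurable_angleWeight (r : ℝ) : Measurable (angleWeight r) := by
  unfold angleWeight; fun_prop

lemma intervalIntegrable_angleWeight_mul {r a b : ℝ} {h : ℝ → ℝ}
    (hh : IntervalIntegrable h volume a b) :
    IntervalIntegrable (fun θ => angleWeight r θ * h θ) volume a b := by
  rw [intervalIntegrable_iff] at hh ⊢
  refine hh.bdd_mul (c := 2) (measurable_angleWeight r).aestronglyMeasurable
    (Eventually.of_forall fun θ => ?_)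
  rw [Real.norm_of_nonneg (angleWeight_nonneg r θ)]
  exact angleWeight_le r θ

lemma intervalIntegrable_angleWeight (r a b : ℝ) :
    IntervalIntegrable (angleWeight r) volume a b := by
  simpa using intervalIntegrable_angleWeight_mul (r := r) (a := a) (b := b) (h := fun _ => 1)
    intervalIntegrable_const

lemma integral_angleWeight {r : ℝ} (hr : 0 < r) (hr1 : r ≤ 1) :
    ∫ θ in 0..π, angleWeight r θ = π := by
  have h := circleAverage_circleWeight hr hr1
  rw [circleAverage_def] at h
  simp only [circleWeight_circleMap, smul_eq_mul] at h
  rw [integral_zero_two_pi (intervalIntegrable_angleWeight r 0 (2 * π))] at h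
  simp only [angleWeight_two_pi_sub, ← two_mul, intervalIntegral.integral_const_mul] at h
  have := pi_pos
  field_simp at h
  linarith

lemma intervalIntegrable_log_norm_circleMap (w : ℂ) :
    IntervalIntegrable (fun θ => Real.log ‖circleMap 0 1 θ - w‖) volume 0 (2 * π) :=
  circleIntegrable_log_norm_sub_const (a := w) (c := 0) 1

lemma integral_angleWeight_mul_log {r : ℝ} (hr : 0 < r) (hr1 : r ≤ 1) {w : ℂ}
    (hw : ‖w‖ ≤ 1) :
    ∫ θ in 0..π, angleWeight r θ * (Real.log ‖circleMap 0 1 θ - w‖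
        + Real.log ‖(starRingEnd ℂ) (circleMap 0 1 θ) - w‖) =
      π * (w.re / r - (1 - r ^ 2) / r ^ 2 * Real.log ‖1 + r * w‖) := by
  have h := circleAverage_circleWeight_mul_log hr hr1 hw
  rw [circleAverage_def] at h
  simp only [circleWeight_circleMap, smul_eq_mul] at h
  rw [integral_zero_two_pi (intervalIntegrable_angleWeight_mul
    (intervalIntegrable_log_norm_circleMap w))] at h
  simp only [angleWeight_two_pi_sub, circleMap_two_pi_sub, ← mul_add] at h
  rw [inv_mul_eq_iff_eq_mul₀ two_pi_pos.ne'] at h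
  rw [h]
  field_simp

/-- The logarithmic potential of the law of `κ |1 + r e^{iθ}|²` at a real point `v`, parametrised by
`v = κ (1 + r w) (1 + r / w)` with `0 < |w| ≤ 1`. -/
lemma integral_angleWeight_mul_log_sub {κ r v : ℝ} (hκ : 0 < κ) (hr : 0 < r) (hr1 : r ≤ 1) {w : ℂ}
    (hw : ‖w‖ ≤ 1) (hw0 : w ≠ 0) (hv : (v : ℂ) = κ * (1 + r * w) * (1 + r / w)) :
    IntervalIntegrable (fun θ => angleWeight r θ *
        Real.log |κ * (1 + 2 * r * Real.cos θ + r ^ 2) - v|) volume 0 π ∧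
    ∫ θ in 0..π, angleWeight r θ * Real.log |κ * (1 + 2 * r * Real.cos θ + r ^ 2) - v| =
      π * (Real.log (κ * r) - Real.log ‖w‖ + w.re / r
        - (1 - r ^ 2) / r ^ 2 * Real.log ‖1 + r * w‖) := by
  have hfin : ∀ u : ℂ, ∀ᵐ θ : ℝ, θ ∈ Set.uIoc 0 π → circleMap 0 1 θ ≠ u := by
    intro u
    have hsub : ({θ : ℝ | θ ∈ Set.uIoc 0 π ∧ circleMap 0 1 θ = u}).Subsingleton := by
      intro x hx y hy
      have := injOn_circleMap_of_abs_sub_le (c := 0) (R := 1) one_ne_zero (a := 0) (b := π)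
        (by rw [zero_sub, abs_neg, abs_of_pos pi_pos]; linarith [pi_pos])
      exact this hx.1 hy.1 (hx.2.trans hy.2.symm)
    have h0 : volume {θ : ℝ | θ ∈ Set.uIoc 0 π ∧ circleMap 0 1 θ = u} = 0 :=
      hsub.measure_zero volume
    rw [ae_iff]
    convert h0 using 3
    ext θ
    simp only [ne_eq, Classical.not_imp, not_not]
  have hpt : ∀ᵐ θ : ℝ, θ ∈ Set.uIoc 0 π → angleWeight r θ *
      Real.log |κ * (1 + 2 * r * Real.cos θ + r ^ 2) - v| =
      angleWeight r θ * (Real.log ‖circleMap 0 1 θ - w‖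
        + Real.log ‖(starRingEnd ℂ) (circleMap 0 1 θ) - w‖) +
      (Real.log (κ * r) - Real.log ‖w‖) * angleWeight r θ := by
    filter_upwards [hfin w, hfin ((starRingEnd ℂ) w)] with θ h1 h2 hmem
    have h1 := sub_ne_zero.2 (h1 hmem)
    have h2 : (starRingEnd ℂ) (circleMap 0 1 θ) - w ≠ 0 := by
      intro h
      apply h2 hmem
      rw [← sub_eq_zero.1 h, Complex.conj_conj]
    have hn : circleMap 0 1 θ * (starRingEnd ℂ) (circleMap 0 1 θ) = 1 := by
      rw [Complex.mul_conj, Complex.normSq_eq_norm_sq]; simp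
    have hs : circleMap 0 1 θ + (starRingEnd ℂ) (circleMap 0 1 θ) = 2 * (Real.cos θ : ℂ) := by
      rw [Complex.add_conj, circleMap_re]; push_cast; ring
    have hfac : ((κ * (1 + 2 * r * Real.cos θ + r ^ 2) - v : ℝ) : ℂ) =
        -(((κ * r : ℝ) : ℂ) * ((circleMap 0 1 θ - w) * ((starRingEnd ℂ) (circleMap 0 1 θ) - w))
          / w) := by
      have h3 : (circleMap 0 1 θ - w) * ((starRingEnd ℂ) (circleMap 0 1 θ) - w) =
          1 - w * (2 * (Real.cos θ : ℂ)) + w ^ 2 := by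
        rw [← hs]; linear_combination hn
      rw [h3]
      push_cast
      rw [hv]
      field_simp
      ring
    have habs : |κ * (1 + 2 * r * Real.cos θ + r ^ 2) - v| =
        (κ * r) * (‖circleMap 0 1 θ - w‖ * ‖(starRingEnd ℂ) (circleMap 0 1 θ) - w‖) / ‖w‖ := by
      rw [← Real.norm_eq_abs, ← Complex.norm_real, hfac, norm_neg, norm_div, norm_mul, norm_mul,
        Complex.norm_real, Real.norm_of_nonneg (mul_pos hκ hr).le]
    have p1 := norm_pos_iff.2 h1
    have p2 := norm_pos_iff.2 h2
    have p3 := norm_pos_iff.2 hw0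
    rw [habs, Real.log_div (by positivity) p3.ne', Real.log_mul (by positivity) (by positivity),
      Real.log_mul p1.ne' p2.ne']
    ring
  have hi0 := intervalIntegrable_log_norm_circleMap w
  have hi : IntervalIntegrable (fun θ => angleWeight r θ * (Real.log ‖circleMap 0 1 θ - w‖
        + Real.log ‖(starRingEnd ℂ) (circleMap 0 1 θ) - w‖)) volume 0 π := by
    refine intervalIntegrable_angleWeight_mul (IntervalIntegrable.add ?_ ?_)
    · exact hi0.mono_set (by
        rw [Set.uIcc_of_le pi_pos.le, Set.uIcc_of_le two_pi_pos.le]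
        exact Set.Icc_subset_Icc_right (by linarith [pi_pos]))
    · have h2 := hi0.mono_set (c := π) (d := 2 * π) (by
        rw [Set.uIcc_of_le (by linarith [pi_pos]), Set.uIcc_of_le two_pi_pos.le]
        exact Set.Icc_subset_Icc_left pi_pos.le)
      have h3 := (h2.comp_sub_left (2 * π)).symm
      simp only [circleMap_two_pi_sub] at h3
      convert h3 using 1 <;> ring
  have hi2 : IntervalIntegrable (fun θ => (Real.log (κ * r) - Real.log ‖w‖) * angleWeight r θ)
      volume 0 π := (intervalIntegrable_angleWeight r 0 π).const_mul _
  constructor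
  · refine (hi.add hi2).congr_ae ?_
    rw [EventuallyEq, ae_restrict_iff' measurableSet_uIoc]
    filter_upwards [hpt] with θ h hmem
    exact (h hmem).symm
  · rw [intervalIntegral.integral_congr_ae hpt, intervalIntegral.integral_add hi hi2,
      integral_angleWeight_mul_log hr hr1 hw, intervalIntegral.integral_const_mul,
      integral_angleWeight hr hr1]
    ring

end CircleWeight

/-! ### Logarithmic potentials of measures with bounded density and compact support -/

/-- The measure `ν` has a density bounded by `M` with respect to the Lebesgue measure, and is
carried by `[-b, b]`. -/
structure HasBoundedDensity (ν : Measure ℝ) (M b : ℝ) : Prop where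
  le_smul_volume : ν ≤ ENNReal.ofReal M • volume
  ae_abs_le : ∀ᵐ s ∂ν, |s| ≤ b

/-- The (negative of the) logarithmic potential of `ν`. -/
noncomputable def logPot (ν : Measure ℝ) (t : ℝ) : ℝ := ∫ s, Real.log |s - t| ∂ν

lemma abs_log_abs_le (x : ℝ) : |Real.log (|x|)| ≤ 2 * |x| ^ (-(1 / 2) : ℝ) + |x| := by
  rcases eq_or_ne x 0 with rfl | hx
  · simp
  have hx' : 0 < |x| := abs_pos.2 hx
  have h1 : Real.log |x| ≤ |x| := (Real.log_le_sub_one_of_pos hx').trans (by linarith)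
  have h2 : -Real.log |x| ≤ 2 * |x| ^ (-(1 / 2) : ℝ) := by
    have h3 : Real.log (|x| ^ (-(1 / 2) : ℝ)) = -(1 / 2) * Real.log |x| := Real.log_rpow hx' _
    have h4 := Real.log_le_sub_one_of_pos (Real.rpow_pos_of_pos hx' (-(1 / 2) : ℝ))
    linarith
  have h5 := Real.rpow_nonneg hx'.le (-(1 / 2) : ℝ)
  rw [abs_le]
  constructor <;> linarith

/-- Replacing `|x|` by `√(x² + ε²)` changes the logarithm little, away from the origin. -/
lemma log_sq_add_sq_le {x ε : ℝ} (hx : x ≠ 0) (hε : 0 < ε) :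
    1 / 2 * Real.log (x ^ 2 + ε ^ 2) ≤
      Real.log |x| + 2 * √ε * |x| ^ (-(1 / 2) : ℝ) := by
  have hx' : 0 < |x| := abs_pos.2 hx
  have h1 : x ^ 2 + ε ^ 2 ≤ (|x| * (1 + √(ε / |x|)) ^ 2) ^ 2 := by
    have hs : √(ε / |x|) ^ 2 = ε / |x| := Real.sq_sqrt (by positivity)
    have h2 : |x| + ε ≤ |x| * (1 + √(ε / |x|)) ^ 2 := by
      have : |x| * (1 + √(ε / |x|)) ^ 2 = |x| + ε + 2 * |x| * √(ε / |x|) := by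
        rw [add_sq, hs]; field_simp; ring
      rw [this]
      have : 0 ≤ 2 * |x| * √(ε / |x|) := by positivity
      linarith
    calc x ^ 2 + ε ^ 2 ≤ (|x| + ε) ^ 2 := by rw [← sq_abs x]; nlinarith
      _ ≤ _ := pow_le_pow_left₀ (by positivity) h2 2
  have hs0 : 0 < 1 + √(ε / |x|) := by positivity
  have h3 := Real.log_le_log (by positivity) h1
  rw [Real.log_pow, Real.log_mul hx'.ne' (by positivity), Real.log_pow] at h3
  have h4 := Real.log_le_sub_one_of_pos hs0
  have h5 : √(ε / |x|) = √ε * |x| ^ (-(1 / 2) : ℝ) := by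
    rw [Real.sqrt_div hε.le, Real.rpow_neg hx'.le, Real.sqrt_eq_rpow |x|, div_eq_mul_inv]
  rw [h5] at h3 h4
  push_cast at h3
  linarith

lemma integrableOn_abs_rpow_neg_half :
    IntegrableOn (fun x : ℝ => |x| ^ (-(1 / 2) : ℝ)) (Set.Icc (-1) 1) := by
  have h1 : IntervalIntegrable (fun x : ℝ => |x| ^ (-(1 / 2) : ℝ)) volume 0 1 := by
    refine (intervalIntegral.intervalIntegrable_rpow' (a := 0) (b := 1) (r := -(1 / 2))
      (by norm_num)).congr ?_
    intro x hx
    rw [Set.uIoc_of_le zero_le_one] at hx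
    simp only [abs_of_pos hx.1]
  have h2 : IntervalIntegrable (fun x : ℝ => |x| ^ (-(1 / 2) : ℝ)) volume (-1) 0 := by
    have := (h1.comp_sub_left 0).symm
    simpa using this
  have h3 := h2.trans h1
  rwa [intervalIntegrable_iff_integrableOn_Icc_of_le (by norm_num)] at h3

lemma measurable_abs_sub_rpow (t : ℝ) :
    Measurable fun s : ℝ => |s - t| ^ (-(1 / 2) : ℝ) := by
  fun_prop

section Potential

variable {ν : Measure ℝ} {M b : ℝ}

lemma HasBoundedDensity.absolutelyContinuous (h : HasBoundedDensity ν M b) : ν ≪ volume :=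
  (Measure.absolutelyContinuous_of_le h.le_smul_volume).trans Measure.smul_absolutelyContinuous

lemma HasBoundedDensity.ae_ne (h : HasBoundedDensity ν M b) (t : ℝ) : ∀ᵐ s ∂ν, s ≠ t :=
  h.absolutelyContinuous.ae_le (Measure.ae_ne volume t)

variable [IsProbabilityMeasure ν]

/-- A bounded density has potentials of the integrable singularity `|x|^(-1/2)` that are bounded
uniformly in the pole. -/
lemma HasBoundedDensity.exists_rpow_bound (h : HasBoundedDensity ν M b) :
    ∃ C : ℝ, 0 ≤ C ∧ ∀ t : ℝ, ∫⁻ s, ENNReal.ofReal (|s - t| ^ (-(1 / 2) : ℝ)) ∂ν ≤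
      ENNReal.ofReal C := by
  set K : ℝ≥0∞ := ∫⁻ x in Set.Icc (-1 : ℝ) 1, ENNReal.ofReal (|x| ^ (-(1 / 2) : ℝ)) with hK
  have hKfin : K ≠ ⊤ := by
    have := integrableOn_abs_rpow_neg_half
    rw [hK, ← ofReal_integral_eq_lintegral_ofReal this
      (Eventually.of_forall fun x => Real.rpow_nonneg (abs_nonneg x) _)]
    exact ENNReal.ofReal_ne_top
  have hfin : 1 + ENNReal.ofReal M * K ≠ ⊤ :=
    ENNReal.add_ne_top.2 ⟨ENNReal.one_ne_top, ENNReal.mul_ne_top ENNReal.ofReal_ne_top hKfin⟩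
  refine ⟨(1 + ENNReal.ofReal M * K).toReal, ENNReal.toReal_nonneg, fun t => ?_⟩
  rw [ENNReal.ofReal_toReal hfin]
  set k : ℝ → ℝ≥0∞ := fun x =>
    (Set.Icc (-1 : ℝ) 1).indicator (fun x => ENNReal.ofReal (|x| ^ (-(1 / 2) : ℝ))) x with hk
  have hkm : Measurable k :=
    (by fun_prop : Measurable fun x : ℝ =>
      ENNReal.ofReal (|x| ^ (-(1 / 2) : ℝ))).indicator measurableSet_Icc
  have hpt : ∀ x : ℝ, ENNReal.ofReal (|x| ^ (-(1 / 2) : ℝ)) ≤ 1 + k x := by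
    intro x
    by_cases hx : x ∈ Set.Icc (-1 : ℝ) 1
    · simp only [hk, Set.indicator_of_mem hx]
      exact le_add_self
    · have hx1 : 1 ≤ |x| := by
        by_contra hlt
        exact hx (abs_le.1 (not_le.1 hlt).le)
      refine le_add_right ?_
      rw [← ENNReal.ofReal_one]
      exact ENNReal.ofReal_le_ofReal (Real.rpow_le_one_of_one_le_of_nonpos hx1 (by norm_num))
  calc ∫⁻ s, ENNReal.ofReal (|s - t| ^ (-(1 / 2) : ℝ)) ∂ν
      ≤ ∫⁻ s, (1 + k (s - t)) ∂ν := lintegral_mono fun s => hpt (s - t)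
    _ = 1 + ∫⁻ s, k (s - t) ∂ν := by
        rw [lintegral_add_left measurable_const]; simp
    _ ≤ 1 + ∫⁻ s, k (s - t) ∂(ENNReal.ofReal M • (volume : Measure ℝ)) := by
        gcongr
        exact h.le_smul_volume
    _ = 1 + ENNReal.ofReal M * K := by
        rw [lintegral_smul_measure, lintegral_sub_right_eq_self k t, hk,
          lintegral_indicator measurableSet_Icc, smul_eq_mul]

lemma HasBoundedDensity.integrable_rpow (h : HasBoundedDensity ν M b) (t : ℝ) :
    Integrable (fun s => |s - t| ^ (-(1 / 2) : ℝ)) ν := by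
  obtain ⟨C, -, hC⟩ := h.exists_rpow_bound
  refine ⟨(measurable_abs_sub_rpow t).aestronglyMeasurable, ?_⟩
  rw [hasFiniteIntegral_iff_ofReal (Eventually.of_forall fun s =>
    Real.rpow_nonneg (abs_nonneg _) _)]
  exact (hC t).trans_lt ENNReal.ofReal_lt_top

lemma HasBoundedDensity.exists_integral_rpow_le (h : HasBoundedDensity ν M b) :
    ∃ C : ℝ, 0 ≤ C ∧ ∀ t : ℝ, ∫ s, |s - t| ^ (-(1 / 2) : ℝ) ∂ν ≤ C := by
  obtain ⟨C, hC0, hC⟩ := h.exists_rpow_bound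
  refine ⟨C, hC0, fun t => ?_⟩
  rw [integral_eq_lintegral_of_nonneg_ae (Eventually.of_forall fun s =>
    Real.rpow_nonneg (abs_nonneg _) _) (measurable_abs_sub_rpow t).aestronglyMeasurable]
  exact ENNReal.toReal_le_of_le_ofReal hC0 (hC t)

lemma HasBoundedDensity.integrable_of_continuous (h : HasBoundedDensity ν M b) {f : ℝ → ℝ}
    (hf : Continuous f) : Integrable f ν := by
  obtain ⟨C, hC⟩ := (isCompact_Icc (a := -b) (b := b)).exists_bound_of_continuousOn
    hf.continuousOn
  refine Integrable.of_bound hf.aestronglyMeasurable C ?_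
  filter_upwards [h.ae_abs_le] with s hs
  exact hC s (abs_le.1 hs)

lemma HasBoundedDensity.integrable_log_sub (h : HasBoundedDensity ν M b) (t : ℝ) :
    Integrable (fun s => Real.log |s - t|) ν := by
  have h1 : Integrable (fun s : ℝ => 2 * |s - t| ^ (-(1 / 2) : ℝ) + |s - t|) ν :=
    ((h.integrable_rpow t).const_mul 2).add (h.integrable_of_continuous (by fun_prop))
  exact h1.mono' (Real.measurable_log.comp (by fun_prop)).aestronglyMeasurable
    (Eventually.of_forall fun s => abs_log_abs_le (s - t))

lemma HasBoundedDensity.integrable_log_abs (h : HasBoundedDensity ν M b) :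
    Integrable (fun s => Real.log |s|) ν := by
  simpa using h.integrable_log_sub 0

lemma HasBoundedDensity.logPot_le (h : HasBoundedDensity ν M b) (t : ℝ) :
    logPot ν t ≤ |t| + b := by
  have : ∫ s, Real.log |s - t| ∂ν ≤ ∫ s, (|t| + b) ∂ν := by
    refine integral_mono_ae (h.integrable_log_sub t) (integrable_const _) ?_
    filter_upwards [h.ae_abs_le, h.ae_ne t] with s hs hst
    have h1 := Real.log_le_sub_one_of_pos (abs_pos.2 (sub_ne_zero.2 hst))
    have h2 := abs_sub s t
    linarith
  simpa [logPot] using this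

lemma HasBoundedDensity.integrable_log_sub_prod (h : HasBoundedDensity ν M b) :
    Integrable (fun p : ℝ × ℝ => Real.log |p.1 - p.2|) (ν.prod ν) := by
  obtain ⟨C, hC0, hC⟩ := h.exists_integral_rpow_le
  have hm : Measurable fun p : ℝ × ℝ => Real.log |p.1 - p.2| :=
    Real.measurable_log.comp (by fun_prop)
  rw [integrable_prod_iff' hm.aestronglyMeasurable]
  refine ⟨Eventually.of_forall fun t => h.integrable_log_sub t, ?_⟩
  refine Integrable.of_bound (C := 2 * C + (b + b)) ?_ ?_
  · exact (hm.norm.stronglyMeasurable.integral_prod_left (μ := ν)).aestronglyMeasurable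
  · filter_upwards [h.ae_abs_le] with t ht
    rw [Real.norm_of_nonneg (integral_nonneg fun _ => norm_nonneg _)]
    have h1 : Integrable (fun s : ℝ => 2 * |s - t| ^ (-(1 / 2) : ℝ) + (b + b)) ν :=
      ((h.integrable_rpow t).const_mul 2).add (integrable_const _)
    calc ∫ s, ‖Real.log |s - t|‖ ∂ν ≤ ∫ s, (2 * |s - t| ^ (-(1 / 2) : ℝ) + (b + b)) ∂ν := by
          refine integral_mono_ae (h.integrable_log_sub t).norm h1 ?_
          filter_upwards [h.ae_abs_le] with s hs
          have := abs_log_abs_le (s - t)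
          have := abs_sub s t
          rw [Real.norm_eq_abs]
          linarith
      _ = 2 * (∫ s, |s - t| ^ (-(1 / 2) : ℝ) ∂ν) + (b + b) := by
          rw [integral_add ((h.integrable_rpow t).const_mul 2) (integrable_const _),
            integral_const_mul]
          simp
      _ ≤ _ := by linarith [hC t]

lemma HasBoundedDensity.integral_logPot (h : HasBoundedDensity ν M b) :
    Integrable (logPot ν) ν ∧
      ∫ t, logPot ν t ∂ν = ∫ p : ℝ × ℝ, Real.log |p.1 - p.2| ∂(ν.prod ν) := by
  have hi := h.integrable_log_sub_prod
  exact ⟨hi.integral_prod_right, (integral_prod_symm _ hi).symm⟩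

/-- The potential of the regularised kernel `½ log (x² + ε²)` exceeds the logarithmic potential by
`O(√ε)`, uniformly in the pole. -/
lemma HasBoundedDensity.exists_regularized_le (h : HasBoundedDensity ν M b) :
    ∃ C : ℝ, 0 ≤ C ∧ ∀ ε : ℝ, 0 < ε → ∀ t : ℝ,
      ∫ s, 1 / 2 * Real.log ((s - t) ^ 2 + ε ^ 2) ∂ν ≤ logPot ν t + C * √ε := by
  obtain ⟨C, hC0, hC⟩ := h.exists_integral_rpow_le
  refine ⟨2 * C, by linarith, fun ε hε t => ?_⟩
  have hcont : Continuous fun s : ℝ => 1 / 2 * Real.log ((s - t) ^ 2 + ε ^ 2) :=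
    continuous_const.mul (Continuous.log (by fun_prop) fun s => by positivity)
  have h1 : ∫ s, 1 / 2 * Real.log ((s - t) ^ 2 + ε ^ 2) ∂ν ≤
      ∫ s, (Real.log |s - t| + 2 * √ε * |s - t| ^ (-(1 / 2) : ℝ)) ∂ν := by
    refine integral_mono_ae (h.integrable_of_continuous hcont)
      ((h.integrable_log_sub t).add ((h.integrable_rpow t).const_mul _)) ?_
    filter_upwards [h.ae_ne t] with s hs
    exact log_sq_add_sq_le (sub_ne_zero.2 hs) hε
  rw [integral_add (h.integrable_log_sub t) ((h.integrable_rpow t).const_mul _),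
    integral_const_mul (2 * √ε)] at h1
  refine h1.trans ?_
  have := mul_le_mul_of_nonneg_left (hC t) (by positivity : 0 ≤ 2 * √ε)
  unfold logPot
  linarith

end Potential

/-! ### The equilibrium measure in the angular coordinate -/

section Parameters

/-- The scale `κ = β / 4 + c` of the coordinate `t² = κ |1 + r e^{iθ}|²`. -/
noncomputable def scaleParam (β c : ℝ) : ℝ := β / 4 + c

/-- The ratio `r = √(β / (β + 4 c)) ∈ (0, 1]` of the coordinate `t² = κ |1 + r e^{iθ}|²`. -/
noncomputable def ratioParam (β c : ℝ) : ℝ := √(β / (4 * scaleParam β c))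

variable {β c : ℝ}

lemma scaleParam_pos (hβ : 0 < β) (hc : 0 ≤ c) : 0 < scaleParam β c := by
  unfold scaleParam; positivity

lemma ratioParam_pos (hβ : 0 < β) (hc : 0 ≤ c) : 0 < ratioParam β c := by
  have := scaleParam_pos hβ hc
  unfold ratioParam; positivity

lemma scaleParam_mul_ratioParam_sq (hβ : 0 < β) (hc : 0 ≤ c) :
    scaleParam β c * ratioParam β c ^ 2 = β / 4 := by
  have := scaleParam_pos hβ hc
  rw [ratioParam, Real.sq_sqrt (by positivity)]
  field_simp

lemma scaleParam_mul_one_sub (hβ : 0 < β) (hc : 0 ≤ c) :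
    scaleParam β c * (1 - ratioParam β c ^ 2) = c := by
  have := scaleParam_mul_ratioParam_sq hβ hc
  rw [mul_sub, this, scaleParam]; ring

lemma ratioParam_le_one (hβ : 0 < β) (hc : 0 ≤ c) : ratioParam β c ≤ 1 := by
  have h1 := scaleParam_pos hβ hc
  refine Real.sqrt_le_one.2 ?_
  rw [div_le_one (by positivity), scaleParam]
  linarith

lemma sqrt_one_add_div (hβ : 0 < β) (hc : 0 ≤ c) :
    β / 2 * √(1 + 4 * c / β) = 2 * scaleParam β c * ratioParam β c := by
  have h1 := scaleParam_pos hβ hc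
  have h2 := ratioParam_pos hβ hc
  have h3 := scaleParam_mul_ratioParam_sq hβ hc
  have h4 : 1 + 4 * c / β = (4 * scaleParam β c * ratioParam β c / β) ^ 2 := by
    rw [div_pow, mul_pow, mul_pow]
    have : scaleParam β c ^ 2 * ratioParam β c ^ 2 = scaleParam β c * (β / 4) := by
      rw [← h3]; ring
    rw [mul_assoc, this, scaleParam]
    field_simp
  rw [h4, Real.sqrt_sq (by positivity)]
  field_simp
  norm_num

lemma innerEdge_eq (hβ : 0 < β) (hc : 0 ≤ c) :
    innerEdge β c = √(scaleParam β c) * (1 - ratioParam β c) := by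
  have h1 := scaleParam_pos hβ hc
  have h2 := ratioParam_le_one hβ hc
  have h3 := scaleParam_mul_ratioParam_sq hβ hc
  have h4 := sqrt_one_add_div hβ hc
  rw [innerEdge, ← Real.sqrt_mul (by positivity)]
  have : β / 2 * (1 + 2 * c / β - √(1 + 4 * c / β)) =
      scaleParam β c * (1 - ratioParam β c) ^ 2 := by
    rw [mul_sub, h4]
    have : scaleParam β c * (1 - ratioParam β c) ^ 2 = scaleParam β c
      - 2 * scaleParam β c * ratioParam β c + scaleParam β c * ratioParam β c ^ 2 := by ring
    rw [this, h3]
    have : β / 2 * (1 + 2 * c / β) = scaleParam β c + β / 4 := by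
      rw [scaleParam]; field_simp; ring
    linarith
  rw [this, Real.sqrt_mul h1.le, Real.sqrt_sq (by linarith)]

lemma outerEdge_eq (hβ : 0 < β) (hc : 0 ≤ c) :
    outerEdge β c = √(scaleParam β c) * (1 + ratioParam β c) := by
  have h1 := scaleParam_pos hβ hc
  have h2 := ratioParam_pos hβ hc
  have h3 := scaleParam_mul_ratioParam_sq hβ hc
  have h4 := sqrt_one_add_div hβ hc
  rw [outerEdge, ← Real.sqrt_mul (by positivity)]
  have : β / 2 * (1 + 2 * c / β + √(1 + 4 * c / β)) =
      scaleParam β c * (1 + ratioParam β c) ^ 2 := by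
    rw [mul_add, h4]
    have : scaleParam β c * (1 + ratioParam β c) ^ 2 = scaleParam β c
      + 2 * scaleParam β c * ratioParam β c + scaleParam β c * ratioParam β c ^ 2 := by ring
    rw [this, h3]
    have : β / 2 * (1 + 2 * c / β) = scaleParam β c + β / 4 := by
      rw [scaleParam]; field_simp; ring
    linarith
  rw [this, Real.sqrt_mul h1.le, Real.sqrt_sq (by linarith)]

lemma innerEdge_nonneg (β c : ℝ) : 0 ≤ innerEdge β c := by
  unfold innerEdge; positivity

lemma innerEdge_lt_outerEdge (hβ : 0 < β) (hc : 0 ≤ c) : innerEdge β c < outerEdge β c := by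
  rw [innerEdge_eq hβ hc, outerEdge_eq hβ hc]
  have := ratioParam_pos hβ hc
  have := Real.sqrt_pos.2 (scaleParam_pos hβ hc)
  gcongr
  linarith

lemma outerEdge_pos (hβ : 0 < β) (hc : 0 ≤ c) : 0 < outerEdge β c :=
  (innerEdge_nonneg β c).trans_lt (innerEdge_lt_outerEdge hβ hc)

/-! #### Elementary properties of the density -/

lemma eqDensity_neg (t : ℝ) : eqDensity β c (-t) = eqDensity β c t := by
  unfold eqDensity
  have : (-t ∈ Set.Icc (-outerEdge β c) (-innerEdge β c) ∪ Set.Icc (innerEdge β c) (outerEdge β c))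
      ↔ (t ∈ Set.Icc (-outerEdge β c) (-innerEdge β c) ∪
        Set.Icc (innerEdge β c) (outerEdge β c)) := by
    simp only [Set.mem_union, Set.mem_Icc]
    constructor <;> rintro (⟨h1, h2⟩ | ⟨h1, h2⟩)
    · right; constructor <;> linarith
    · left; constructor <;> linarith
    · right; constructor <;> linarith
    · left; constructor <;> linarith
  simp only [this, abs_neg, neg_sq]

lemma measurable_eqDensity : Measurable (eqDensity β c) := by
  unfold eqDensity
  exact Measurable.ite (measurableSet_Icc.union measurableSet_Icc) (by fun_prop) measurable_const

lemma eqDensity_le (hβ : 0 < β) (hc : 0 ≤ c) (t : ℝ) :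
    eqDensity β c t ≤ 2 / (Real.pi * β) * outerEdge β c := by
  have hb := outerEdge_pos hβ hc
  have hpi := Real.pi_pos
  unfold eqDensity
  split_ifs with h
  · rw [mul_assoc]
    refine mul_le_mul_of_nonneg_left ?_ (by positivity)
    rcases eq_or_ne t 0 with rfl | ht
    · simpa using hb.le
    have ht' : 0 < |t| := abs_pos.2 ht
    have h1 : √((t ^ 2 - innerEdge β c ^ 2) * (outerEdge β c ^ 2 - t ^ 2)) ≤
        |t| * outerEdge β c := by
      refine Real.sqrt_le_iff.2 ⟨by positivity, ?_⟩
      rw [mul_pow, sq_abs]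
      have hbt : 0 ≤ outerEdge β c ^ 2 - t ^ 2 := by
        have ha := innerEdge_nonneg β c
        rcases h with ⟨h1, h2⟩ | ⟨h1, h2⟩ <;> nlinarith
      nlinarith [sq_nonneg (innerEdge β c), sq_nonneg t, mul_nonneg (sq_nonneg t) hbt,
        mul_nonneg (sq_nonneg (innerEdge β c)) hbt, mul_nonneg (sq_nonneg t) (sq_nonneg t)]
    rw [one_div, inv_mul_le_iff₀ ht']
    exact h1
  · positivity

lemma eqDensity_eq_zero {t : ℝ}
    (h : |t| ∉ Set.Icc (innerEdge β c) (outerEdge β c)) : eqDensity β c t = 0 := by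
  unfold eqDensity
  rw [if_neg]
  rintro (⟨h1, h2⟩ | ⟨h1, h2⟩)
  · apply h
    have ha := innerEdge_nonneg β c
    rw [abs_of_nonpos (by linarith)]
    constructor <;> linarith
  · apply h
    have ha := innerEdge_nonneg β c
    rw [abs_of_nonneg (by linarith)]
    exact ⟨h1, h2⟩

lemma ae_abs_mem_eqMeasure :
    ∀ᵐ t ∂(eqMeasure β c), |t| ∈ Set.Icc (innerEdge β c) (outerEdge β c) := by
  unfold eqMeasure
  rw [ae_withDensity_iff (by exact measurable_eqDensity.ennreal_ofReal)]
  refine Eventually.of_forall fun t ht => ?_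
  by_contra hcon
  apply ht
  rw [eqDensity_eq_zero hcon, ENNReal.ofReal_zero]

lemma hasBoundedDensity_eqMeasure (hβ : 0 < β) (hc : 0 ≤ c) :
    HasBoundedDensity (eqMeasure β c) (2 / (Real.pi * β) * outerEdge β c) (outerEdge β c) where
  le_smul_volume := by
    unfold eqMeasure
    rw [← withDensity_const]
    exact withDensity_mono (Eventually.of_forall fun t =>
      ENNReal.ofReal_le_ofReal (eqDensity_le hβ hc t))
  ae_abs_le := ae_abs_mem_eqMeasure.mono fun t ht => ht.2

/-! #### Change of variables -/

lemma lintegral_eqMeasure {g : ℝ → ℝ≥0∞} (hg : Measurable g) :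
    ∫⁻ s, g s ∂(eqMeasure β c) = ∫⁻ s, ENNReal.ofReal (eqDensity β c s) * g s := by
  unfold eqMeasure
  rw [lintegral_withDensity_eq_lintegral_mul _ measurable_eqDensity.ennreal_ofReal hg]
  rfl

lemma eqMeasure_map_neg : (eqMeasure β c).map (fun s => -s) = eqMeasure β c := by
  refine Measure.ext_of_lintegral _ fun g hg => ?_
  rw [lintegral_map hg measurable_neg,
    lintegral_eqMeasure (g := fun s => g (-s)) (hg.comp measurable_neg),
    lintegral_eqMeasure hg, ← lintegral_neg_eq_self]
  simp only [neg_neg, eqDensity_neg]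

lemma setLIntegral_even {h : ℝ → ℝ≥0∞} (hh : ∀ s, h (-s) = h s) :
    ∫⁻ s, h s = 2 * ∫⁻ s in Set.Ioi 0, h s := by
  have h1 : ∫⁻ s in Set.Iic 0, h s = ∫⁻ s in Set.Ioi 0, h s := by
    rw [setLIntegral_congr (Iio_ae_eq_Iic (a := (0 : ℝ))).symm]
    have := (Measure.measurePreserving_neg (volume : Measure ℝ)).setLIntegral_comp_preimage_emb
      (MeasurableEquiv.neg ℝ).measurableEmbedding h (Set.Ioi 0)
    rw [← this]
    simp [hh]
  rw [← lintegral_add_compl h (measurableSet_Ioi (a := (0 : ℝ))), Set.compl_Ioi, h1, two_mul]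

lemma one_add_two_mul_cos_pos (r : ℝ) {θ : ℝ} (hθ : θ ∈ Set.Ioo 0 Real.pi) :
    0 < 1 + 2 * r * Real.cos θ + r ^ 2 := by
  have h1 := Real.sin_pos_of_mem_Ioo hθ
  nlinarith [sq_nonneg (r + Real.cos θ), Real.sin_sq_add_cos_sq θ, mul_pos h1 h1]

/-- The points `√κ |1 + r e^{iθ}|`, `0 < θ < π`, fill the interval `(a, b)`. -/
lemma image_sqrt_eq (hβ : 0 < β) (hc : 0 ≤ c) :
    (fun θ => √(scaleParam β c * (1 + 2 * ratioParam β c * Real.cos θ + ratioParam β c ^ 2))) ''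
      Set.Ioo 0 Real.pi = Set.Ioo (innerEdge β c) (outerEdge β c) := by
  have hκ := scaleParam_pos hβ hc
  have hr := ratioParam_pos hβ hc
  have hr1 := ratioParam_le_one hβ hc
  rw [innerEdge_eq hβ hc, outerEdge_eq hβ hc]
  set κ := scaleParam β c
  set r := ratioParam β c
  have hsq := Real.sqrt_pos.2 hκ
  ext s
  constructor
  · rintro ⟨θ, hθ, rfl⟩
    have h1 : Real.cos θ < 1 := by
      have := Real.cos_lt_cos_of_nonneg_of_le_pi le_rfl hθ.2.le hθ.1
      rwa [Real.cos_zero] at this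
    have h2 : -1 < Real.cos θ := by
      have := Real.cos_lt_cos_of_nonneg_of_le_pi hθ.1.le le_rfl hθ.2
      rwa [Real.cos_pi] at this
    change √(κ * (1 + 2 * r * Real.cos θ + r ^ 2)) ∈ Set.Ioo (√κ * (1 - r)) (√κ * (1 + r))
    rw [Real.sqrt_mul hκ.le]
    constructor
    · refine mul_lt_mul_of_pos_left (Real.lt_sqrt_of_sq_lt ?_) hsq
      nlinarith
    · refine mul_lt_mul_of_pos_left ((Real.sqrt_lt' (by linarith)).2 ?_) hsq
      nlinarith
  · rintro ⟨h1, h2⟩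
    have hs : 0 ≤ s := (mul_nonneg hsq.le (by linarith)).trans h1.le
    have hss : √κ ^ 2 = κ := Real.sq_sqrt hκ.le
    have h3 : κ * (1 - r) ^ 2 < s ^ 2 := by
      rw [← hss, ← mul_pow]
      exact pow_lt_pow_left₀ h1 (mul_nonneg hsq.le (by linarith)) two_ne_zero
    have h4 : s ^ 2 < κ * (1 + r) ^ 2 := by
      rw [← hss, ← mul_pow]
      exact pow_lt_pow_left₀ h2 hs two_ne_zero
    have h5 : -1 < (s ^ 2 / κ - 1 - r ^ 2) / (2 * r) := by
      rw [lt_div_iff₀ (by positivity)]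
      have : (1 - r) ^ 2 < s ^ 2 / κ := by rw [lt_div_iff₀ hκ]; linarith
      nlinarith
    have h6 : (s ^ 2 / κ - 1 - r ^ 2) / (2 * r) < 1 := by
      rw [div_lt_iff₀ (by positivity)]
      have : s ^ 2 / κ < (1 + r) ^ 2 := by rw [div_lt_iff₀ hκ]; linarith
      nlinarith
    refine ⟨Real.arccos ((s ^ 2 / κ - 1 - r ^ 2) / (2 * r)), ⟨Real.arccos_pos.2 h6, ?_⟩, ?_⟩
    · refine lt_of_le_of_ne (Real.arccos_le_pi _) fun h => ?_
      rw [Real.arccos_eq_pi] at h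
      linarith
    · have hD : κ * (1 + 2 * r * ((s ^ 2 / κ - 1 - r ^ 2) / (2 * r)) + r ^ 2) = s ^ 2 := by
        field_simp; ring
      simp only [Real.cos_arccos h5.le h6.le, hD, Real.sqrt_sq hs]

lemma hasDerivAt_sqrt_scale {κ r θ : ℝ} (hκ : 0 < κ) (hθ : θ ∈ Set.Ioo 0 Real.pi) :
    HasDerivAt (fun θ => √(κ * (1 + 2 * r * Real.cos θ + r ^ 2)))
      (-(κ * r * Real.sin θ / √(κ * (1 + 2 * r * Real.cos θ + r ^ 2)))) θ := by
  have hD := mul_pos hκ (one_add_two_mul_cos_pos r hθ)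
  have h1 : HasDerivAt (fun θ => κ * (1 + 2 * r * Real.cos θ + r ^ 2))
      (κ * (2 * r * (-Real.sin θ))) θ :=
    ((((Real.hasDerivAt_cos θ).const_mul (2 * r)).const_add 1).add_const (r ^ 2)).const_mul κ
  convert h1.sqrt hD.ne' using 1
  field_simp

lemma injOn_sqrt_scale {κ r : ℝ} (hκ : 0 < κ) (hr : 0 < r) :
    Set.InjOn (fun θ => √(κ * (1 + 2 * r * Real.cos θ + r ^ 2))) (Set.Ioo 0 Real.pi) := by
  intro x hx y hy hxy
  have h1 := mul_pos hκ (one_add_two_mul_cos_pos r hx)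
  have h2 := mul_pos hκ (one_add_two_mul_cos_pos r hy)
  have h3 := (Real.sqrt_inj h1.le h2.le).1 hxy
  have h4 : Real.cos x = Real.cos y := by
    have h5 := mul_left_cancel₀ hκ.ne' h3
    have h6 : 2 * r * Real.cos x = 2 * r * Real.cos y := by linarith
    exact mul_left_cancel₀ (by positivity) h6
  exact Real.injOn_cos ⟨hx.1.le, hx.2.le⟩ ⟨hy.1.le, hy.2.le⟩ h4

lemma eqDensity_sqrt_scale (hβ : 0 < β) (hc : 0 ≤ c) {θ : ℝ} (hθ : θ ∈ Set.Ioo 0 Real.pi) :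
    2 * (|-(scaleParam β c * ratioParam β c * Real.sin θ /
        √(scaleParam β c * (1 + 2 * ratioParam β c * Real.cos θ + ratioParam β c ^ 2)))| *
      eqDensity β c (√(scaleParam β c * (1 + 2 * ratioParam β c * Real.cos θ +
        ratioParam β c ^ 2)))) = angleWeight (ratioParam β c) θ / Real.pi := by
  have hmem : √(scaleParam β c * (1 + 2 * ratioParam β c * Real.cos θ + ratioParam β c ^ 2)) ∈
      Set.Ioo (innerEdge β c) (outerEdge β c) := by
    rw [← image_sqrt_eq hβ hc]; exact Set.mem_image_of_mem _ hθ
  have hκ := scaleParam_pos hβ hc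
  have hr := ratioParam_pos hβ hc
  have hr1 := ratioParam_le_one hβ hc
  have hκr := scaleParam_mul_ratioParam_sq hβ hc
  have hD := one_add_two_mul_cos_pos (ratioParam β c) hθ
  have hD' := mul_pos hκ hD
  have hs := Real.sin_pos_of_mem_Ioo hθ
  have hsq := Real.sq_sqrt hD'.le
  have hsp := Real.sqrt_pos.2 hD'
  rw [eqDensity, if_pos (Set.mem_union_right _ (Set.Ioo_subset_Icc_self hmem)),
    innerEdge_eq hβ hc, outerEdge_eq hβ hc,
    hsq, mul_pow, mul_pow, Real.sq_sqrt hκ.le, abs_of_pos hsp, abs_neg, angleWeight]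
  set κ := scaleParam β c
  set r := ratioParam β c
  set T := √(κ * (1 + 2 * r * Real.cos θ + r ^ 2))
  have h1 : (κ * (1 + 2 * r * Real.cos θ + r ^ 2) - κ * (1 - r) ^ 2) *
      (κ * (1 + r) ^ 2 - κ * (1 + 2 * r * Real.cos θ + r ^ 2)) = (2 * κ * r * Real.sin θ) ^ 2 := by
    rw [mul_pow _ (Real.sin θ), Real.sin_sq]; ring
  rw [h1, Real.sqrt_sq (by positivity), abs_of_nonneg (by positivity)]
  have hpi := Real.pi_pos
  have h2 : 2 * (κ * r * Real.sin θ / T * (2 / (Real.pi * β) * (1 / T) *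
      (2 * κ * r * Real.sin θ))) =
      8 * κ * (κ * r ^ 2) * Real.sin θ ^ 2 / (Real.pi * β * T ^ 2) := by
    field_simp; ring
  rw [h2, hκr, hsq]
  field_simp
  ring

lemma lintegral_eqMeasure_comp_sq (hβ : 0 < β) (hc : 0 ≤ c) {g : ℝ → ℝ≥0∞} (hg : Measurable g) :
    ∫⁻ s, g (s ^ 2) ∂(eqMeasure β c) = ∫⁻ θ in Set.Ioo 0 Real.pi,
      ENNReal.ofReal (angleWeight (ratioParam β c) θ / Real.pi) *
        g (scaleParam β c * (1 + 2 * ratioParam β c * Real.cos θ + ratioParam β c ^ 2)) := by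
  have hκ := scaleParam_pos hβ hc
  have ha := innerEdge_nonneg β c
  rw [lintegral_eqMeasure (g := fun s => g (s ^ 2)) (by fun_prop),
    setLIntegral_even (fun s => by simp only [eqDensity_neg, neg_sq])]
  have h1 : ∫⁻ s in Set.Ioi 0, ENNReal.ofReal (eqDensity β c s) * g (s ^ 2) =
      ∫⁻ s in Set.Ioo (innerEdge β c) (outerEdge β c),
        ENNReal.ofReal (eqDensity β c s) * g (s ^ 2) := by
    rw [← lintegral_indicator measurableSet_Ioi, ← lintegral_indicator measurableSet_Ioo]
    refine lintegral_congr_ae ?_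
    filter_upwards [Measure.ae_ne volume (innerEdge β c), Measure.ae_ne volume (outerEdge β c)]
      with s hsa hsb
    by_cases hs : s ∈ Set.Ioo (innerEdge β c) (outerEdge β c)
    · rw [Set.indicator_of_mem hs, Set.indicator_of_mem (show s ∈ Set.Ioi 0 from ha.trans_lt hs.1)]
    · rw [Set.indicator_of_notMem hs]
      by_cases hs0 : s ∈ Set.Ioi (0 : ℝ)
      · rw [Set.indicator_of_mem hs0, eqDensity_eq_zero]
        · simp
        · rw [abs_of_pos hs0]
          exact fun h => hs ⟨lt_of_le_of_ne h.1 (Ne.symm hsa), lt_of_le_of_ne h.2 hsb⟩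
      · rw [Set.indicator_of_notMem hs0]
  rw [h1, ← image_sqrt_eq hβ hc, lintegral_image_eq_lintegral_abs_deriv_mul measurableSet_Ioo
    (fun θ hθ => (hasDerivAt_sqrt_scale hκ hθ).hasDerivWithinAt)
    (injOn_sqrt_scale hκ (ratioParam_pos hβ hc)), ← lintegral_const_mul' _ _ (by simp)]
  refine setLIntegral_congr_fun measurableSet_Ioo fun θ hθ => ?_
  have hD' := mul_pos hκ (one_add_two_mul_cos_pos (ratioParam β c) hθ)
  rw [Real.sq_sqrt hD'.le, ← eqDensity_sqrt_scale hβ hc hθ, ENNReal.ofReal_mul zero_le_two,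
    ENNReal.ofReal_mul (abs_nonneg _)]
  simp only [ENNReal.ofReal_ofNat]
  ring

lemma isProbabilityMeasure_eqMeasure (hβ : 0 < β) (hc : 0 ≤ c) :
    IsProbabilityMeasure (eqMeasure β c) := by
  constructor
  have h := lintegral_eqMeasure_comp_sq hβ hc (g := fun _ => 1) measurable_const
  simp only [lintegral_const, one_mul, mul_one] at h
  rw [h]
  have hpi := Real.pi_pos
  have h2 := integral_angleWeight (ratioParam_pos hβ hc) (ratioParam_le_one hβ hc)
  have h3 : Integrable (fun θ => angleWeight (ratioParam β c) θ / Real.pi)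
      (volume.restrict (Set.Ioo 0 Real.pi)) := by
    have := intervalIntegrable_angleWeight (ratioParam β c) 0 Real.pi
    rw [intervalIntegrable_iff_integrableOn_Ioo_of_le hpi.le] at this
    exact Integrable.div_const this _
  rw [← ofReal_integral_eq_lintegral_ofReal h3 (Eventually.of_forall fun θ =>
    div_nonneg (angleWeight_nonneg _ θ) hpi.le), integral_div, ← integral_Ioc_eq_integral_Ioo,
    ← intervalIntegral.integral_of_le hpi.le, h2, div_self hpi.ne', ENNReal.ofReal_one]

/-- Integrals of even functions against the equilibrium measure, in the angular coordinate. -/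
lemma integral_eqMeasure_comp_sq (hβ : 0 < β) (hc : 0 ≤ c) {g : ℝ → ℝ} (hg : Measurable g) :
    ∫ s, g (s ^ 2) ∂(eqMeasure β c) = (1 / Real.pi) * ∫ θ in 0..Real.pi,
      angleWeight (ratioParam β c) θ *
        g (scaleParam β c * (1 + 2 * ratioParam β c * Real.cos θ + ratioParam β c ^ 2)) := by
  have hpi := Real.pi_pos
  set κ := scaleParam β c with hκd
  set r := ratioParam β c with hrd
  have hwm : Measurable fun θ => ENNReal.ofReal (angleWeight r θ / Real.pi) :=
    ((measurable_angleWeight r).div_const _).ennreal_ofReal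
  have hDm : Measurable fun θ => κ * (1 + 2 * r * Real.cos θ + r ^ 2) := by fun_prop
  have hmap : (eqMeasure β c).map (fun s => s ^ 2) =
      ((volume.restrict (Set.Ioo 0 Real.pi)).withDensity
        fun θ => ENNReal.ofReal (angleWeight r θ / Real.pi)).map
        fun θ => κ * (1 + 2 * r * Real.cos θ + r ^ 2) := by
    refine Measure.ext_of_lintegral _ fun k hk => ?_
    rw [lintegral_map hk (by fun_prop), lintegral_map hk hDm,
      lintegral_eqMeasure_comp_sq hβ hc hk,
      lintegral_withDensity_eq_lintegral_mul
        (g := fun θ => k (κ * (1 + 2 * r * Real.cos θ + r ^ 2)))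
        _ hwm (hk.comp hDm)]
    rfl
  rw [← integral_map (φ := fun s : ℝ => s ^ 2) (f := g) (by fun_prop) hg.aestronglyMeasurable,
    hmap, integral_map hDm.aemeasurable hg.aestronglyMeasurable,
    integral_withDensity_eq_integral_toReal_smul hwm (by simp),
    intervalIntegral.integral_of_le hpi.le, integral_Ioc_eq_integral_Ioo, ← integral_const_mul]
  refine integral_congr_ae (Eventually.of_forall fun θ => ?_)
  simp only [smul_eq_mul]
  rw [ENNReal.toReal_ofReal (div_nonneg (angleWeight_nonneg r θ) hpi.le)]
  ring

/-- By symmetry, the logarithmic potential at `t` is half the one of the law of `s²` at `t²`. -/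
lemma logPot_eqMeasure_eq (hβ : 0 < β) (hc : 0 ≤ c) (t : ℝ) :
    logPot (eqMeasure β c) t = 1 / 2 * ∫ s, Real.log |s ^ 2 - t ^ 2| ∂(eqMeasure β c) := by
  have := isProbabilityMeasure_eqMeasure hβ hc
  have hB := hasBoundedDensity_eqMeasure hβ hc
  have h1 : logPot (eqMeasure β c) t = ∫ s, Real.log |s - -t| ∂(eqMeasure β c) := by
    rw [logPot]
    nth_rw 1 [← eqMeasure_map_neg]
    rw [integral_map (f := fun s => Real.log |s - t|) measurable_neg.aemeasurable
      (Real.measurable_log.comp (by fun_prop :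
        Measurable fun s : ℝ => |s - t|)).aestronglyMeasurable]
    refine integral_congr_ae (Eventually.of_forall fun s => ?_)
    simp only
    rw [← abs_neg]
    congr 2; ring
  have h2 : ∫ s, Real.log |s ^ 2 - t ^ 2| ∂(eqMeasure β c) =
      ∫ s, (Real.log |s - t| + Real.log |s - -t|) ∂(eqMeasure β c) := by
    refine integral_congr_ae ?_
    filter_upwards [hB.ae_ne t, hB.ae_ne (-t)] with s h3 h4
    rw [← Real.log_mul (abs_ne_zero.2 (sub_ne_zero.2 h3)) (abs_ne_zero.2 (sub_ne_zero.2 h4)),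
      ← abs_mul]
    congr 2; ring
  rw [h2, integral_add (hB.integrable_log_sub t) (hB.integrable_log_sub (-t)), ← h1]
  unfold logPot
  ring

end Parameters

/-! ### The Euler-Lagrange inequality for the equilibrium measure -/

section EulerLagrange

variable {β c : ℝ}

/-- The constant of the Euler-Lagrange equation: the value of `β U + Q_c` on the support, where `U`
is the logarithmic potential of the equilibrium measure. -/
noncomputable def robinConst (β c : ℝ) : ℝ :=
  scaleParam β c * (1 + ratioParam β c ^ 2) - c * Real.log (scaleParam β c)
    - β / 2 * Real.log (scaleParam β c * ratioParam β c)

lemma beta_mul_logPot (hβ : 0 < β) (hc : 0 ≤ c) {t : ℝ} {w : ℂ} (hw : ‖w‖ ≤ 1) (hw0 : w ≠ 0)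
    (hv : ((t ^ 2 : ℝ) : ℂ) = scaleParam β c * (1 + ratioParam β c * w) *
      (1 + ratioParam β c / w)) :
    β * logPot (eqMeasure β c) t =
      β / 2 * (Real.log (scaleParam β c * ratioParam β c) - Real.log ‖w‖)
        + 2 * scaleParam β c * ratioParam β c * w.re
        - 2 * c * Real.log ‖1 + ratioParam β c * w‖ := by
  have hr := ratioParam_pos hβ hc
  have hm : Measurable fun x : ℝ => Real.log |x - t ^ 2| := Real.measurable_log.comp (by fun_prop)
  rw [logPot_eqMeasure_eq hβ hc, integral_eqMeasure_comp_sq hβ hc hm,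
    (integral_angleWeight_mul_log_sub (scaleParam_pos hβ hc) hr (ratioParam_le_one hβ hc) hw hw0
      hv).2]
  have h1 := scaleParam_mul_ratioParam_sq hβ hc
  have h2 := scaleParam_mul_one_sub hβ hc
  have h3 : β = 4 * (scaleParam β c * ratioParam β c ^ 2) := by linarith
  generalize scaleParam β c = κ at *
  generalize ratioParam β c = r at *
  rw [h3, ← h2]
  have hpi := Real.pi_pos
  field_simp
  ring

/-- The difference between the two sides of the Euler-Lagrange inequality off the support, up to
the factor `κ`. Its derivative in `y` is `-q² (1 - y²)² / (y² (1 + q y) (y + q))`. -/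
lemma eulerLagrange_aux {q y : ℝ} (hy : 0 < y) (hy1 : y ≤ 1) (hqy : 0 < y + q) :
    0 ≤ (1 + q ^ 2) * Real.log y + q * (1 / y - y)
      + (1 - q ^ 2) * (Real.log (1 + q * y) - Real.log (y + q)) := by
  set J : ℝ → ℝ := fun y => (1 + q ^ 2) * Real.log y + q * (1 / y - y)
      + (1 - q ^ 2) * (Real.log (1 + q * y) - Real.log (y + q)) with hJ
  have hder : ∀ x ∈ Set.Icc y 1,
      HasDerivAt J (-(q ^ 2 * (1 - x ^ 2) ^ 2 / (x ^ 2 * (1 + q * x) * (x + q)))) x ∧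
        0 < 1 + q * x ∧ 0 < x + q := by
    intro x hx
    have hx0 : 0 < x := hy.trans_le hx.1
    have h1 : 0 < x + q := by linarith [hx.1]
    have h2 : 0 < 1 + q * x := by nlinarith [hx.2]
    refine ⟨?_, h2, h1⟩
    have d1 := (Real.hasDerivAt_log hx0.ne').const_mul (1 + q ^ 2)
    have d2 := ((hasDerivAt_inv hx0.ne').sub (hasDerivAt_id x)).const_mul q
    have d3 : HasDerivAt (fun x => Real.log (1 + q * x)) (q * 1 / (1 + q * x)) x :=
      (((hasDerivAt_id x).const_mul q).const_add 1).log h2.ne'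
    have d4 : HasDerivAt (fun x => Real.log (x + q)) (1 / (x + q)) x :=
      ((hasDerivAt_id x).add_const q).log h1.ne'
    have d5 := (d1.add d2).add ((d3.sub d4).const_mul (1 - q ^ 2))
    have hfun : J = ((fun y => (1 + q ^ 2) * Real.log y)
          + fun y => q * ((fun z : ℝ => z⁻¹) - (id : ℝ → ℝ)) y)
        + fun y => (1 - q ^ 2) *
          ((fun x => Real.log (1 + q * x)) - fun x => Real.log (x + q)) y := by
      ext z; simp [hJ]
    rw [hfun]
    refine d5.congr_deriv ?_
    field_simp
    ring
  have hanti : AntitoneOn J (Set.Icc y 1) := by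
    refine antitoneOn_of_deriv_nonpos (convex_Icc y 1)
      (fun x hx => (hder x hx).1.continuousAt.continuousWithinAt)
      (fun x hx => (hder x (interior_subset hx)).1.differentiableAt.differentiableWithinAt)
      fun x hx => ?_
    obtain ⟨h1, h2, h3⟩ := hder x (interior_subset hx)
    have hx0 : 0 < x := hy.trans_le (interior_subset hx).1
    rw [h1.deriv, neg_nonpos]
    positivity
  have h := hanti ⟨le_rfl, hy1⟩ ⟨hy1, le_rfl⟩ hy1
  have h1 : J 1 = 0 := by
    simp only [hJ, Real.log_one, mul_one]
    rw [add_comm 1 q]; ring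
  rw [h1] at h
  exact h

/-- The Euler-Lagrange inequality off the support. There `t² = κ (1 + r w) (1 + r / w)` has a real
solution `w = σ y` with `0 < y ≤ 1` and `σ = ± 1`, so that `eulerLagrange_aux` applies with
`q = σ r`. -/
lemma eulerLagrange_of_real (hβ : 0 < β) (hc : 0 ≤ c) {t y σ : ℝ} (hσ : σ = 1 ∨ σ = -1)
    (hy : 0 < y) (hy1 : y ≤ 1) (hqy : 0 < y + σ * ratioParam β c)
    (hv : t ^ 2 = scaleParam β c * (1 + σ * ratioParam β c * y) *
      (1 + σ * ratioParam β c / y)) :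
    robinConst β c ≤ -(β * logPot (eqMeasure β c) t) + t ^ 2 - 2 * c * Real.log |t| := by
  have hσ2 : σ ^ 2 = 1 := by rcases hσ with rfl | rfl <;> norm_num
  have hσinv : σ⁻¹ = σ := by rcases hσ with rfl | rfl <;> norm_num
  have hσ0 : σ ≠ 0 := by rcases hσ with rfl | rfl <;> norm_num
  have hr := ratioParam_pos hβ hc
  have hκ := scaleParam_pos hβ hc
  have h1 := scaleParam_mul_ratioParam_sq hβ hc
  have h2 := scaleParam_mul_one_sub hβ hc
  have hnorm : ‖((σ * y : ℝ) : ℂ)‖ = y := by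
    rw [Complex.norm_real, Real.norm_eq_abs, abs_mul, abs_of_pos hy]
    rcases hσ with rfl | rfl <;> norm_num
  have h1q : 0 < 1 + σ * ratioParam β c * y := by nlinarith
  have h3 := beta_mul_logPot hβ hc (t := t) (w := ((σ * y : ℝ) : ℂ)) (by rw [hnorm]; exact hy1)
    (by rw [Ne, Complex.ofReal_eq_zero]; positivity) (by
      rw [hv, show σ * ratioParam β c / y = ratioParam β c / (σ * y) by
        rw [div_mul_eq_div_div, div_eq_mul_inv (ratioParam β c) σ, hσinv, mul_comm]]
      push_cast
      ring)
  have hnorm2 : ‖1 + (ratioParam β c : ℂ) * ((σ * y : ℝ) : ℂ)‖ = 1 + σ * ratioParam β c * y := by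
    rw [← Complex.ofReal_mul, ← Complex.ofReal_one, ← Complex.ofReal_add, Complex.norm_real,
      Real.norm_eq_abs, abs_of_pos (by linarith)]
    ring
  rw [hnorm, hnorm2, Complex.ofReal_re] at h3
  have h4 : 2 * Real.log |t| = Real.log (scaleParam β c) + Real.log (1 + σ * ratioParam β c * y)
      + (Real.log (y + σ * ratioParam β c) - Real.log y) := by
    have : (2 : ℝ) * Real.log |t| = Real.log (t ^ 2) := by rw [← sq_abs, Real.log_pow]; norm_num
    rw [this, hv, show 1 + σ * ratioParam β c / y = (y + σ * ratioParam β c) / y by field_simp,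
      Real.log_mul (by positivity) (by positivity), Real.log_mul (by positivity) (by positivity),
      Real.log_div (by positivity) (by positivity)]
  have h5 := mul_nonneg hκ.le (eulerLagrange_aux hy hy1 hqy)
  have h6 : 2 * c * Real.log |t| = c * (2 * Real.log |t|) := by ring
  rw [h3, h6, h4, hv, robinConst]
  generalize scaleParam β c = κ at *
  generalize ratioParam β c = r at *
  have h7 : β = 4 * (κ * r ^ 2) := by linarith
  rw [mul_pow, hσ2, one_mul] at h5
  rw [h7, ← h2]
  have h8 : κ * (1 + σ * r * y) * (1 + σ * r / y) =
      κ * (1 + r ^ 2) + κ * (σ * r) * (1 / y + y) := by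
    field_simp
    have : σ * σ = 1 := by rw [← sq]; exact hσ2
    linear_combination (r ^ 2 * y) * this
  rw [h8]
  nlinarith

/-- The Euler-Lagrange equation on the support. -/
lemma eulerLagrange_eq (hβ : 0 < β) (hc : 0 ≤ c) {t : ℝ} (ht : t ≠ 0 ∨ c = 0)
    (h : |(t ^ 2 / scaleParam β c - 1 - ratioParam β c ^ 2) / (2 * ratioParam β c)| ≤ 1) :
    -(β * logPot (eqMeasure β c) t) + t ^ 2 - 2 * c * Real.log |t| = robinConst β c := by
  have hr := ratioParam_pos hβ hc
  have hκ := scaleParam_pos hβ hc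
  have h2 := scaleParam_mul_one_sub hβ hc
  set x := (t ^ 2 / scaleParam β c - 1 - ratioParam β c ^ 2) / (2 * ratioParam β c) with hx
  have hx2 : x ^ 2 ≤ 1 := by rw [← sq_abs]; exact pow_le_one₀ (abs_nonneg x) h
  have htx : t ^ 2 = scaleParam β c * (1 + 2 * ratioParam β c * x + ratioParam β c ^ 2) := by
    rw [hx]; field_simp; ring
  set w : ℂ := ⟨x, √(1 - x ^ 2)⟩ with hw
  have hsq : √(1 - x ^ 2) ^ 2 = 1 - x ^ 2 := Real.sq_sqrt (by linarith)
  have hn : ‖w‖ = 1 := by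
    have h1 : ‖w‖ ^ 2 = 1 := by
      rw [Complex.sq_norm, Complex.normSq_apply]
      simp only [hw]
      nlinarith
    nlinarith [norm_nonneg w]
  have hw0 : w ≠ 0 := by
    intro h0; rw [h0, norm_zero] at hn; exact zero_ne_one hn
  have hwinv : w⁻¹ = (starRingEnd ℂ) w := by
    rw [Complex.inv_def, Complex.normSq_eq_norm_sq, hn]; simp
  have hwre : w.re = x := rfl
  have hsum : w + (starRingEnd ℂ) w = 2 * (x : ℂ) := by
    rw [Complex.add_conj, hwre]; push_cast; ring
  have hmul : w * (starRingEnd ℂ) w = 1 := by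
    rw [Complex.mul_conj, Complex.normSq_eq_norm_sq, hn]; simp
  have h3 := beta_mul_logPot hβ hc (t := t) hn.le hw0 (by
    rw [htx, div_eq_mul_inv, hwinv]
    push_cast
    linear_combination (-(scaleParam β c : ℂ) * ratioParam β c) * hsum
      - ((scaleParam β c : ℂ) * ratioParam β c ^ 2) * hmul)
  rw [hn, Real.log_one, hwre] at h3
  have h4 : 2 * c * Real.log |t| = c * Real.log (scaleParam β c) +
      2 * c * Real.log ‖1 + ratioParam β c * w‖ := by
    rcases ht with ht | ht
    · have h5 : t ^ 2 = scaleParam β c * ‖1 + ratioParam β c * w‖ ^ 2 := by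
        rw [sq_norm_one_add hn, htx, hwre]
      have h6 : ‖1 + ratioParam β c * w‖ ≠ 0 := by
        intro h0
        rw [h0] at h5
        simp at h5
        exact ht h5
      have : (2 : ℝ) * Real.log |t| = Real.log (t ^ 2) := by rw [← sq_abs, Real.log_pow]; norm_num
      rw [mul_right_comm, this, h5, Real.log_mul hκ.ne' (by positivity), Real.log_pow]
      push_cast
      ring
    · rw [ht]; ring
  rw [h3, h4, htx, robinConst]
  ring

/-- The Euler-Lagrange inequality. At `t = 0` it is claimed for `c = 0` only, because the potential
`Q_c` is infinite there otherwise. -/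
lemma eulerLagrange_le (hβ : 0 < β) (hc : 0 ≤ c) {t : ℝ} (ht : t ≠ 0 ∨ c = 0) :
    robinConst β c ≤ -(β * logPot (eqMeasure β c) t) + t ^ 2 - 2 * c * Real.log |t| := by
  have hr := ratioParam_pos hβ hc
  have hr1 := ratioParam_le_one hβ hc
  have hκ := scaleParam_pos hβ hc
  have h2 := scaleParam_mul_one_sub hβ hc
  set x := (t ^ 2 / scaleParam β c - 1 - ratioParam β c ^ 2) / (2 * ratioParam β c) with hx
  have htx : t ^ 2 = scaleParam β c * (1 + 2 * ratioParam β c * x + ratioParam β c ^ 2) := by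
    rw [hx]; field_simp; ring
  by_cases h : |x| ≤ 1
  · exact (eulerLagrange_eq hβ hc ht h).ge
  -- off the support, `w = ± y` with `y + 1 / y = 2 |x|`
  have hX : 1 < |x| := not_le.1 h
  set y := |x| - √(|x| ^ 2 - 1) with hy
  have hsq : √(|x| ^ 2 - 1) ^ 2 = |x| ^ 2 - 1 := Real.sq_sqrt (by nlinarith)
  have hsn : 0 ≤ √(|x| ^ 2 - 1) := Real.sqrt_nonneg _
  have hy0 : 0 < y := by
    have : √(|x| ^ 2 - 1) < |x| := (Real.sqrt_lt' (by linarith)).2 (by linarith)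
    linarith
  have hyy : y ^ 2 + 1 = 2 * |x| * y := by rw [hy]; nlinarith
  have hy1 : y ≤ 1 := by
    have : |x| - 1 ≤ √(|x| ^ 2 - 1) := Real.le_sqrt_of_sq_le (by nlinarith)
    linarith
  have hx2 : 2 * |x| = y + 1 / y := by field_simp; linarith
  rcases le_or_gt 0 x with h0 | h0
  · rw [abs_of_nonneg h0] at hx2
    refine eulerLagrange_of_real hβ hc (Or.inl rfl) hy0 hy1 (by linarith) ?_
    rw [htx, show 2 * ratioParam β c * x = ratioParam β c * (2 * x) by ring, hx2]
    field_simp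
    ring
  · rw [abs_of_neg h0] at hx2
    have hv : t ^ 2 = scaleParam β c * (1 + -1 * ratioParam β c * y) *
        (1 + -1 * ratioParam β c / y) := by
      rw [htx, show 2 * ratioParam β c * x = -(ratioParam β c * (2 * -x)) by ring, hx2]
      field_simp
      ring
    have ht0 : t ≠ 0 := by
      rcases ht with ht | ht
      · exact ht
      · -- for `c = 0` the support contains the origin
        intro ht0
        have hr2 : ratioParam β c ^ 2 = 1 := by
          rw [ht] at h2
          have := (mul_eq_zero.1 h2).resolve_left (by rw [ht] at hκ; exact hκ.ne')
          rw [ht]; linarith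
        have hr3 : ratioParam β c = 1 := by nlinarith
        apply h
        rw [hx, ht0, hr3]
        norm_num
    have h1 : 0 < 1 + -1 * ratioParam β c * y := by
      have hyx : y < 1 := by
        refine lt_of_le_of_ne hy1 fun h1 => ?_
        rw [h1] at hyy; linarith
      nlinarith
    have h3 : 0 < 1 + -1 * ratioParam β c / y := by
      have : 0 < t ^ 2 := by positivity
      rw [hv] at this
      exact (pos_iff_pos_of_mul_pos this).1 (mul_pos hκ h1)
    refine eulerLagrange_of_real hβ hc (Or.inr rfl) hy0 hy1 ?_ hv
    have : y + -1 * ratioParam β c = y * (1 + -1 * ratioParam β c / y) := by field_simp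
    rw [this]
    positivity

lemma eulerLagrange_ae (hβ : 0 < β) (hc : 0 ≤ c) : ∀ᵐ t ∂(eqMeasure β c),
    -(β * logPot (eqMeasure β c) t) + t ^ 2 - 2 * c * Real.log |t| = robinConst β c := by
  have hr := ratioParam_pos hβ hc
  have hr1 := ratioParam_le_one hβ hc
  have hκ := scaleParam_pos hβ hc
  have := isProbabilityMeasure_eqMeasure hβ hc
  filter_upwards [ae_abs_mem_eqMeasure, (hasBoundedDensity_eqMeasure hβ hc).ae_ne 0]
    with t ht ht0
  refine eulerLagrange_eq hβ hc (Or.inl ht0) ?_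
  have hs := Real.sqrt_pos.2 hκ
  have hss := Real.sq_sqrt hκ.le
  rw [innerEdge_eq hβ hc, outerEdge_eq hβ hc] at ht
  have h1 := pow_le_pow_left₀ (mul_nonneg hs.le (by linarith)) ht.1 2
  have h2 := pow_le_pow_left₀ (abs_nonneg t) ht.2 2
  rw [sq_abs, mul_pow, hss] at h1 h2
  have h3 : (1 - ratioParam β c) ^ 2 ≤ t ^ 2 / scaleParam β c := by
    rw [le_div_iff₀ hκ]; linarith
  have h4 : t ^ 2 / scaleParam β c ≤ (1 + ratioParam β c) ^ 2 := by
    rw [div_le_iff₀ hκ]; linarith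
  rw [abs_le, le_div_iff₀ (by positivity), div_le_iff₀ (by positivity)]
  constructor <;> nlinarith

end EulerLagrange

/-! ### Positive definiteness of the regularised logarithmic kernel -/

section PositiveDefinite

lemma cos_mul_exp_eq_re (x s ξ : ℝ) :
    Real.cos (x * ξ) * Real.exp (-s * ξ) = (Complex.exp ((-s + x * Complex.I) * ξ)).re := by
  rw [Complex.exp_re]
  simp
  ring

/-- The kernel `s / (x² + s²)` is a positive mixture of the characters `cos (x ξ)`. -/
lemma integral_cos_mul_exp (x : ℝ) {s : ℝ} (hs : 0 < s) :
    ∫ ξ in Set.Ioi 0, Real.cos (x * ξ) * Real.exp (-s * ξ) = s / (x ^ 2 + s ^ 2) := by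
  have hre : (-(s : ℂ) + x * Complex.I).re < 0 := by simpa using hs
  have h1 := integral_re (𝕜 := ℂ) (integrableOn_exp_mul_complex_Ioi hre 0)
  simp only [RCLike.re_to_complex] at h1
  simp_rw [cos_mul_exp_eq_re]
  rw [h1, integral_exp_mul_complex_Ioi hre 0]
  have : x ^ 2 + s ^ 2 ≠ 0 := by positivity
  simp [Complex.div_re, Complex.normSq_apply]
  field_simp
  ring

lemma integral_div_sq_add_sq (x : ℝ) {ε R : ℝ} (hε : 0 < ε) (hεR : ε ≤ R) :
    ∫ s in ε..R, s / (x ^ 2 + s ^ 2) =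
      1 / 2 * Real.log (x ^ 2 + R ^ 2) - 1 / 2 * Real.log (x ^ 2 + ε ^ 2) := by
  have hpos : ∀ s ∈ Set.uIcc ε R, 0 < x ^ 2 + s ^ 2 := by
    intro s hs
    rw [Set.uIcc_of_le hεR] at hs
    have : 0 < s := hε.trans_le hs.1
    positivity
  refine intervalIntegral.integral_eq_sub_of_hasDerivAt
    (f := fun s => 1 / 2 * Real.log (x ^ 2 + s ^ 2)) (fun s hs => ?_) ?_
  · have h := hpos s hs
    have h1 : HasDerivAt (fun s : ℝ => x ^ 2 + s ^ 2) (2 * s) s := by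
      simpa using (hasDerivAt_pow 2 s).const_add (x ^ 2)
    exact ((h1.log h.ne').const_mul (1 / 2)).congr_deriv (by ring)
  · exact (ContinuousOn.div (by fun_prop) (by fun_prop)
      fun s hs => (hpos s hs).ne').intervalIntegrable

variable {P N : Measure ℝ} [IsFiniteMeasure P] [IsFiniteMeasure N]

lemma integrable_log_sq_add_sq (hP : Integrable (fun x : ℝ => x ^ 2) P) {ε : ℝ} (hε : 0 < ε) :
    Integrable (fun x : ℝ => 1 / 2 * Real.log (x ^ 2 + ε ^ 2)) P := by
  have hcont : Continuous fun x : ℝ => 1 / 2 * Real.log (x ^ 2 + ε ^ 2) :=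
    continuous_const.mul (Continuous.log (by fun_prop) fun s => by positivity)
  refine (hP.add (integrable_const (ε ^ 2 + |Real.log (ε ^ 2)|))).mono'
    hcont.aestronglyMeasurable (Eventually.of_forall fun x => ?_)
  have h1 : Real.log (ε ^ 2) ≤ Real.log (x ^ 2 + ε ^ 2) :=
    Real.log_le_log (by positivity) (by nlinarith)
  have h2 : Real.log (x ^ 2 + ε ^ 2) ≤ x ^ 2 + ε ^ 2 :=
    (Real.log_le_sub_one_of_pos (by positivity)).trans (by linarith)
  have h3 := neg_abs_le (Real.log (ε ^ 2))
  have h4 := abs_nonneg (Real.log (ε ^ 2))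
  simp only [Pi.add_apply]
  rw [Real.norm_eq_abs, abs_le]
  constructor <;> nlinarith [sq_nonneg x, sq_nonneg ε]

lemma continuous_integral_cos (P : Measure ℝ) [IsFiniteMeasure P] :
    Continuous fun ξ : ℝ => ∫ x, Real.cos (x * ξ) ∂P :=
  continuous_of_dominated (bound := fun _ => 1)
    (fun ξ => (by fun_prop : Continuous fun x : ℝ => Real.cos (x * ξ)).aestronglyMeasurable)
    (fun ξ => Eventually.of_forall fun x => Real.abs_cos_le_one _) (integrable_const 1)
    (Eventually.of_forall fun x => by fun_prop)

lemma abs_integral_cos_le (P : Measure ℝ) [IsFiniteMeasure P] (ξ : ℝ) :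
    ‖∫ x, Real.cos (x * ξ) ∂P‖ ≤ P.real Set.univ := by
  refine (norm_integral_le_of_norm_le_const (C := 1)
    (Eventually.of_forall fun x => Real.abs_cos_le_one _)).trans ?_
  rw [one_mul]

lemma integrableOn_integral_cos_mul_exp (P : Measure ℝ) [IsFiniteMeasure P] {s : ℝ} (hs : 0 < s) :
    IntegrableOn (fun ξ => (∫ x, Real.cos (x * ξ) ∂P) * Real.exp (-s * ξ)) (Set.Ioi 0) :=
  (integrableOn_exp_mul_Ioi (a := -s) (by linarith) 0).bdd_mul (c := P.real Set.univ)
    (continuous_integral_cos P).aestronglyMeasurable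
    (Eventually.of_forall fun ξ => abs_integral_cos_le P ξ)

lemma integral_poisson_eq (P : Measure ℝ) [IsFiniteMeasure P] {s : ℝ} (hs : 0 < s) :
    ∫ x, s / (x ^ 2 + s ^ 2) ∂P =
      ∫ ξ in Set.Ioi 0, (∫ x, Real.cos (x * ξ) ∂P) * Real.exp (-s * ξ) := by
  simp_rw [← integral_cos_mul_exp _ hs, ← integral_mul_const]
  refine integral_integral_swap ?_
  have h1 : Integrable (fun p : ℝ × ℝ => (1 : ℝ) * Real.exp (-s * p.2))
      (P.prod (volume.restrict (Set.Ioi 0))) :=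
    Integrable.mul_prod (integrable_const 1) (integrableOn_exp_mul_Ioi (by linarith) 0)
  refine h1.mono (by fun_prop) (Eventually.of_forall fun p => ?_)
  simp only [Function.uncurry, norm_mul, one_mul]
  exact mul_le_of_le_one_left (norm_nonneg _) (Real.abs_cos_le_one _)

lemma integrable_poisson_prod (P : Measure ℝ) [IsFiniteMeasure P] {ε R : ℝ} (hε : 0 < ε) :
    Integrable (Function.uncurry fun x s : ℝ => s / (x ^ 2 + s ^ 2))
      (P.prod (volume.restrict (Set.Ioc ε R))) := by
  refine Integrable.of_bound (C := 1 / ε) (Measurable.aestronglyMeasurable ?_) ?_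
  · exact measurable_snd.div ((measurable_fst.pow_const 2).add (measurable_snd.pow_const 2))
  · have h : ∀ᵐ p : ℝ × ℝ ∂(P.prod (volume.restrict (Set.Ioc ε R))), p.2 ∈ Set.Ioc ε R :=
      Measure.quasiMeasurePreserving_snd.ae (ae_restrict_mem measurableSet_Ioc)
    filter_upwards [h] with p hp
    have hs : 0 < p.2 := hε.trans hp.1
    simp only [Function.uncurry]
    rw [Real.norm_of_nonneg (by positivity), div_le_div_iff₀ (by positivity) hε]
    nlinarith [hp.1, sq_nonneg p.1]

/-- Let `P` and `N` be finite measures of equal mass such that the Fourier transform `g` of `P - N`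
is nonnegative. Then the integral of the kernel `-½ log (x² + ε²)` against `P - N` is at least
`∫ e^{-2ξ} g(ξ) dξ`. Indeed the kernel is `∫_ε^R s / (x² + s²) ds - ½ log (x² + R²)`, each
`s / (x² + s²)` is a positive mixture of characters, and the last term is asymptotically constant
as `R → ∞`. -/
lemma le_integral_regularized (hmass : P.real Set.univ = N.real Set.univ)
    (hP : Integrable (fun x : ℝ => x ^ 2) P) (hN : Integrable (fun x : ℝ => x ^ 2) N)
    {g : ℝ → ℝ} (hg : ∀ ξ, (∫ x, Real.cos (x * ξ) ∂P) - ∫ x, Real.cos (x * ξ) ∂N = g ξ)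
    (hg0 : ∀ ξ, 0 ≤ g ξ) {ε : ℝ} (hε : 0 < ε) (hε1 : ε ≤ 1) :
    ∫ ξ in Set.Ioi 0, Real.exp (-2 * ξ) * g ξ ≤
      (∫ x, 1 / 2 * Real.log (x ^ 2 + ε ^ 2) ∂N) - ∫ x, 1 / 2 * Real.log (x ^ 2 + ε ^ 2) ∂P := by
  set φ : ℝ → ℝ := fun s => (∫ x, s / (x ^ 2 + s ^ 2) ∂P) - ∫ x, s / (x ^ 2 + s ^ 2) ∂N with hφ
  have hφeq : ∀ s, 0 < s → φ s = ∫ ξ in Set.Ioi 0, g ξ * Real.exp (-s * ξ) := by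
    intro s hs
    rw [hφ]
    simp only
    rw [integral_poisson_eq P hs, integral_poisson_eq N hs,
      ← integral_sub (integrableOn_integral_cos_mul_exp P hs)
        (integrableOn_integral_cos_mul_exp N hs)]
    refine integral_congr_ae (Eventually.of_forall fun ξ => ?_)
    simp only
    rw [← hg ξ]; ring
  have hgi : ∀ s, 0 < s → IntegrableOn (fun ξ => g ξ * Real.exp (-s * ξ)) (Set.Ioi 0) := by
    intro s hs
    refine ((integrableOn_integral_cos_mul_exp P hs).sub
      (integrableOn_integral_cos_mul_exp N hs)).congr (Eventually.of_forall fun ξ => ?_)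
    simp only [Pi.sub_apply]
    rw [← hg ξ]; ring
  have hφ0 : ∀ s, 0 < s → 0 ≤ φ s := fun s hs => by
    rw [hφeq s hs]
    exact setIntegral_nonneg measurableSet_Ioi fun ξ _ => mul_nonneg (hg0 ξ) (Real.exp_pos _).le
  set G := ∫ ξ in Set.Ioi 0, Real.exp (-2 * ξ) * g ξ with hG
  have hφG : ∀ s ∈ Set.Icc (1 : ℝ) 2, G ≤ φ s := by
    intro s hs
    rw [hφeq s (by linarith [hs.1]), hG]
    have h2 := hgi 2 two_pos
    simp_rw [mul_comm (g _)] at h2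
    refine setIntegral_mono_on h2 (hgi s (by linarith [hs.1])) measurableSet_Ioi fun ξ hξ => ?_
    rw [mul_comm]
    refine mul_le_mul_of_nonneg_left (Real.exp_le_exp.2 ?_) (hg0 ξ)
    nlinarith [hs.2, Set.mem_Ioi.1 hξ]
  have hsum : ∀ Q : Measure ℝ, IsFiniteMeasure Q → Integrable (fun x : ℝ => x ^ 2) Q →
      ∀ R, 2 ≤ R → IntegrableOn (fun s => ∫ x, s / (x ^ 2 + s ^ 2) ∂Q) (Set.Ioc ε R) ∧
      ∫ s in Set.Ioc ε R, (∫ x, s / (x ^ 2 + s ^ 2) ∂Q) =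
        (∫ x, 1 / 2 * Real.log (x ^ 2 + R ^ 2) ∂Q) -
          ∫ x, 1 / 2 * Real.log (x ^ 2 + ε ^ 2) ∂Q := by
    intro Q hQ hQ2 R hR
    have hi := integrable_poisson_prod Q (R := R) hε
    refine ⟨hi.integral_prod_right, ?_⟩
    rw [← integral_integral_swap hi, ← integral_sub (integrable_log_sq_add_sq hQ2 (by linarith))
      (integrable_log_sq_add_sq hQ2 hε)]
    refine integral_congr_ae (Eventually.of_forall fun x => ?_)
    simp only
    rw [← integral_div_sq_add_sq x hε (by linarith), intervalIntegral.integral_of_le (by linarith)]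
  -- the part of the kernel at scale `R` is within `O(R⁻²)` of a constant
  have htail : ∀ R, 2 ≤ R → -((∫ x, x ^ 2 ∂P) / R ^ 2) ≤
      (∫ x, 1 / 2 * Real.log (x ^ 2 + R ^ 2) ∂N) - ∫ x, 1 / 2 * Real.log (x ^ 2 + R ^ 2) ∂P := by
    intro R hR
    have hR0 : 0 < R := by linarith
    have h1 : ∫ _, 1 / 2 * Real.log (R ^ 2) ∂N ≤ ∫ x, 1 / 2 * Real.log (x ^ 2 + R ^ 2) ∂N := by
      refine integral_mono (integrable_const _) (integrable_log_sq_add_sq hN hR0) fun x => ?_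
      have := Real.log_le_log (by positivity : 0 < R ^ 2)
        (by nlinarith [sq_nonneg x] : R ^ 2 ≤ x ^ 2 + R ^ 2)
      simp only
      linarith
    have h2 : ∫ x, 1 / 2 * Real.log (x ^ 2 + R ^ 2) ∂P ≤
        ∫ x, (1 / 2 * Real.log (R ^ 2) + x ^ 2 / R ^ 2) ∂P := by
      refine integral_mono (integrable_log_sq_add_sq hP hR0)
        ((integrable_const _).add (hP.div_const _)) fun x => ?_
      simp only
      have h3 : x ^ 2 + R ^ 2 = R ^ 2 * (1 + x ^ 2 / R ^ 2) := by field_simp; ring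
      have h4 : 0 ≤ x ^ 2 / R ^ 2 := by positivity
      rw [h3, Real.log_mul (by positivity) (by positivity)]
      have h5 := Real.log_le_sub_one_of_pos (by positivity : 0 < 1 + x ^ 2 / R ^ 2)
      linarith
    rw [integral_add (integrable_const _) (hP.div_const _), integral_div] at h2
    simp only [integral_const, smul_eq_mul] at h1 h2
    rw [hmass] at h2
    linarith
  have hmain : ∀ R, 2 ≤ R → G - (∫ x, x ^ 2 ∂P) / R ^ 2 ≤
      (∫ x, 1 / 2 * Real.log (x ^ 2 + ε ^ 2) ∂N) - ∫ x, 1 / 2 * Real.log (x ^ 2 + ε ^ 2) ∂P := by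
    intro R hR
    obtain ⟨hPi, hPe⟩ := hsum P inferInstance hP R hR
    obtain ⟨hNi, hNe⟩ := hsum N inferInstance hN R hR
    have h1 : ∫ s in Set.Ioc ε R, φ s = (∫ s in Set.Ioc ε R, (∫ x, s / (x ^ 2 + s ^ 2) ∂P)) -
        ∫ s in Set.Ioc ε R, (∫ x, s / (x ^ 2 + s ^ 2) ∂N) := integral_sub hPi hNi
    have hφi : IntegrableOn φ (Set.Ioc ε R) := hPi.sub hNi
    have h2 : G ≤ ∫ s in Set.Ioc ε R, φ s := by
      have hsub : Set.Ioc (1 : ℝ) 2 ⊆ Set.Ioc ε R := Set.Ioc_subset_Ioc hε1 hR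
      calc G = ∫ _ in Set.Ioc (1 : ℝ) 2, G := by
            rw [setIntegral_const]; norm_num [Measure.real]
        _ ≤ ∫ s in Set.Ioc (1 : ℝ) 2, φ s :=
            setIntegral_mono_on (by simp) (hφi.mono_set hsub) measurableSet_Ioc
              fun s hs => hφG s ⟨hs.1.le, hs.2⟩
        _ ≤ ∫ s in Set.Ioc ε R, φ s := by
            refine setIntegral_mono_set hφi ?_ hsub.eventuallyLE
            filter_upwards [ae_restrict_mem measurableSet_Ioc] with s hs
            exact hφ0 s (hε.trans hs.1)
    have h3 := htail R hR
    rw [h1, hPe, hNe] at h2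
    linarith
  have hlim : Tendsto (fun R : ℝ => G - (∫ x, x ^ 2 ∂P) / R ^ 2) atTop (𝓝 (G - 0)) :=
    tendsto_const_nhds.sub (tendsto_const_nhds.div_atTop (tendsto_pow_atTop two_ne_zero))
  rw [sub_zero] at hlim
  exact le_of_tendsto hlim (eventually_atTop.2 ⟨2, hmain⟩)

end PositiveDefinite

section CharFun

variable {μ ν : Measure ℝ} [IsProbabilityMeasure μ] [IsProbabilityMeasure ν]

lemma integral_cos_sub_prod (μ ν : Measure ℝ) [IsProbabilityMeasure μ] [IsProbabilityMeasure ν]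
    (ξ : ℝ) : ∫ p : ℝ × ℝ, Real.cos ((p.1 - p.2) * ξ) ∂(μ.prod ν) =
      (charFun μ ξ * (starRingEnd ℂ) (charFun ν ξ)).re := by
  rw [charFun_apply_real, charFun_apply_real, ← integral_conj, ← integral_prod_mul]
  have hi : Integrable (fun z : ℝ × ℝ => Complex.exp (ξ * z.1 * Complex.I) *
      (starRingEnd ℂ) (Complex.exp (ξ * z.2 * Complex.I))) (μ.prod ν) := by
    refine Integrable.of_bound (C := 1) (Continuous.aestronglyMeasurable ?_)
      (Eventually.of_forall fun z => ?_)
    · exact Continuous.mul (by fun_prop) (Complex.continuous_conj.comp (by fun_prop))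
    · rw [norm_mul, RCLike.norm_conj, ← Complex.ofReal_mul, ← Complex.ofReal_mul,
        Complex.norm_exp_ofReal_mul_I, Complex.norm_exp_ofReal_mul_I, one_mul]
  have h := integral_re hi
  simp only [RCLike.re_to_complex] at h
  rw [← h]
  refine integral_congr_ae (Eventually.of_forall fun p => ?_)
  simp only
  rw [← Complex.exp_conj, ← Complex.exp_add]
  have : (ξ : ℂ) * p.1 * Complex.I + (starRingEnd ℂ) (ξ * p.2 * Complex.I) =
      (((p.1 - p.2) * ξ : ℝ) : ℂ) * Complex.I := by
    simp only [map_mul, Complex.conj_ofReal, Complex.conj_I]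
    push_cast; ring
  rw [this, Complex.exp_ofReal_mul_I_re]

/-- The regularised logarithmic energy of `μ - ν` dominates a weighted `L²` distance of the
characteristic functions. -/
lemma integral_charFun_sub_sq_le (hμ : Integrable (fun x : ℝ => x ^ 2) μ)
    (hν : Integrable (fun x : ℝ => x ^ 2) ν) {ε : ℝ} (hε : 0 < ε) (hε1 : ε ≤ 1) :
    ∫ ξ in Set.Ioi 0, Real.exp (-2 * ξ) * ‖charFun μ ξ - charFun ν ξ‖ ^ 2 ≤
      2 * (∫ p : ℝ × ℝ, 1 / 2 * Real.log ((p.1 - p.2) ^ 2 + ε ^ 2) ∂(μ.prod ν))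
        - (∫ p : ℝ × ℝ, 1 / 2 * Real.log ((p.1 - p.2) ^ 2 + ε ^ 2) ∂(μ.prod μ))
        - ∫ p : ℝ × ℝ, 1 / 2 * Real.log ((p.1 - p.2) ^ 2 + ε ^ 2) ∂(ν.prod ν) := by
  have hsub : Measurable fun p : ℝ × ℝ => p.1 - p.2 := measurable_fst.sub measurable_snd
  have hsq : ∀ α γ : Measure ℝ, IsProbabilityMeasure α → IsProbabilityMeasure γ →
      Integrable (fun x : ℝ => x ^ 2) α → Integrable (fun x : ℝ => x ^ 2) γ →
      Integrable (fun x : ℝ => x ^ 2) ((α.prod γ).map fun p => p.1 - p.2) := by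
    intro α γ _ _ hα hγ
    rw [integrable_map_measure (by fun_prop) hsub.aemeasurable]
    refine (((hα.comp_fst γ).add (hγ.comp_snd α)).const_mul 2).mono' (by fun_prop)
      (Eventually.of_forall fun p => ?_)
    simp only [Function.comp_apply, Pi.add_apply]
    rw [Real.norm_of_nonneg (sq_nonneg _)]
    nlinarith [sq_nonneg (p.1 + p.2)]
  have hmap : ∀ α γ : Measure ℝ, ∀ f : ℝ → ℝ, Measurable f →
      ∫ x, f x ∂((α.prod γ).map fun p => p.1 - p.2) = ∫ p : ℝ × ℝ, f (p.1 - p.2) ∂(α.prod γ) :=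
    fun α γ f hf => integral_map hsub.aemeasurable hf.aestronglyMeasurable
  set A := (μ.prod μ).map fun p => p.1 - p.2 with hA
  set B := (ν.prod ν).map fun p => p.1 - p.2 with hB
  set D := (μ.prod ν).map fun p => p.1 - p.2 with hD
  have : IsProbabilityMeasure A := Measure.isProbabilityMeasure_map hsub.aemeasurable
  have : IsProbabilityMeasure B := Measure.isProbabilityMeasure_map hsub.aemeasurable
  have : IsProbabilityMeasure D := Measure.isProbabilityMeasure_map hsub.aemeasurable
  have hA2 := hsq μ μ inferInstance inferInstance hμ hμ
  have hB2 := hsq ν ν inferInstance inferInstance hν hν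
  have hD2 := hsq μ ν inferInstance inferInstance hμ hν
  have hlogm : Measurable fun x : ℝ => 1 / 2 * Real.log (x ^ 2 + ε ^ 2) := by fun_prop
  have hcosi : ∀ (Q : Measure ℝ), IsFiniteMeasure Q → ∀ ξ : ℝ,
      Integrable (fun x => Real.cos (x * ξ)) Q := fun Q _ ξ =>
    Integrable.of_bound (C := 1) (by fun_prop : Continuous fun x : ℝ =>
      Real.cos (x * ξ)).aestronglyMeasurable (Eventually.of_forall fun x => Real.abs_cos_le_one _)
  have hcosm : ∀ ξ : ℝ, Measurable fun x : ℝ => Real.cos (x * ξ) := fun ξ => by fun_prop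
  have h := le_integral_regularized (P := A + B) (N := D + D) (by
      rw [measureReal_add_apply, measureReal_add_apply]; simp)
    (hA2.add_measure hB2) (hD2.add_measure hD2)
    (g := fun ξ => ‖charFun μ ξ - charFun ν ξ‖ ^ 2) (fun ξ => by
      rw [integral_add_measure (hcosi A inferInstance ξ) (hcosi B inferInstance ξ),
        integral_add_measure (hcosi D inferInstance ξ) (hcosi D inferInstance ξ),
        hmap _ _ _ (hcosm ξ), hmap _ _ _ (hcosm ξ), hmap _ _ _ (hcosm ξ),
        integral_cos_sub_prod, integral_cos_sub_prod, integral_cos_sub_prod,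
        Complex.sq_norm, Complex.normSq_apply]
      simp only [Complex.mul_re, Complex.conj_re, Complex.conj_im, Complex.sub_re, Complex.sub_im]
      ring) (fun ξ => sq_nonneg _) hε hε1
  rw [integral_add_measure (integrable_log_sq_add_sq hA2 hε) (integrable_log_sq_add_sq hB2 hε),
    integral_add_measure (integrable_log_sq_add_sq hD2 hε) (integrable_log_sq_add_sq hD2 hε),
    hmap _ _ _ hlogm, hmap _ _ _ hlogm, hmap _ _ _ hlogm] at h
  linarith

end CharFun

/-! ### Empirical measures -/

section Empirical

variable {n : ℕ}

lemma isProbabilityMeasure_empirical (hn : n ≠ 0) (x : Fin n → ℝ) :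
    IsProbabilityMeasure (empirical n x) := by
  constructor
  have hn' : (0 : ℝ) < n := by exact_mod_cast Nat.pos_of_ne_zero hn
  rw [empirical, Measure.smul_apply, Measure.finsetSum_apply]
  simp only [measure_univ, Finset.sum_const, Finset.card_univ, Fintype.card_fin, nsmul_eq_mul,
    mul_one, smul_eq_mul]
  rw [← ENNReal.ofReal_natCast, ← ENNReal.ofReal_mul (by positivity), one_div,
    inv_mul_cancel₀ hn'.ne', ENNReal.ofReal_one]

lemma integrable_empirical (x : Fin n → ℝ) (f : ℝ → ℝ) : Integrable f (empirical n x) := by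
  unfold empirical
  refine Integrable.smul_measure ?_ ENNReal.ofReal_ne_top
  rw [integrable_finsetSum_measure]
  exact fun i _ => integrable_dirac (by simp)

lemma integral_empirical {E : Type*} [NormedAddCommGroup E] [NormedSpace ℝ E] [CompleteSpace E]
    (x : Fin n → ℝ) (f : ℝ → E) : ∫ t, f t ∂(empirical n x) = (1 / (n : ℝ)) • ∑ i, f (x i) := by
  unfold empirical
  rw [integral_smul_measure, integral_finsetSum_measure fun i _ => integrable_dirac (by simp),
    ENNReal.toReal_ofReal (by positivity)]
  simp

end Empirical

/-! ### The lower bound for the discrete energy -/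

section LowerBound

lemma integrable_log_sub_sq_add_sq {α γ : Measure ℝ} [IsProbabilityMeasure α]
    [IsProbabilityMeasure γ] (hα : Integrable (fun x : ℝ => x ^ 2) α)
    (hγ : Integrable (fun x : ℝ => x ^ 2) γ) {ε : ℝ} (hε : 0 < ε) :
    Integrable (fun p : ℝ × ℝ => 1 / 2 * Real.log ((p.1 - p.2) ^ 2 + ε ^ 2)) (α.prod γ) := by
  have hsub : Measurable fun p : ℝ × ℝ => p.1 - p.2 := measurable_fst.sub measurable_snd
  have h1 : Integrable (fun x : ℝ => x ^ 2) ((α.prod γ).map fun p => p.1 - p.2) := by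
    rw [integrable_map_measure (by fun_prop) hsub.aemeasurable]
    refine (((hα.comp_fst γ).add (hγ.comp_snd α)).const_mul 2).mono' (by fun_prop)
      (Eventually.of_forall fun p => ?_)
    simp only [Function.comp_apply, Pi.add_apply]
    rw [Real.norm_of_nonneg (sq_nonneg _)]
    nlinarith [sq_nonneg (p.1 + p.2)]
  have : IsProbabilityMeasure ((α.prod γ).map fun p => p.1 - p.2) :=
    Measure.isProbabilityMeasure_map hsub.aemeasurable
  exact (integrable_log_sq_add_sq h1 hε).comp_measurable hsub

/-- The weighted squared `L²` distance between the characteristic functions of the empirical measure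
of `x` and of `ν`. -/
noncomputable def charDist (ν : Measure ℝ) (n : ℕ) (x : Fin n → ℝ) : ℝ :=
  ∫ ξ in Set.Ioi 0, Real.exp (-2 * ξ) * ‖charFun (empirical n x) ξ - charFun ν ξ‖ ^ 2

lemma charDist_nonneg (ν : Measure ℝ) (n : ℕ) (x : Fin n → ℝ) : 0 ≤ charDist ν n x :=
  setIntegral_nonneg measurableSet_Ioi fun ξ _ => by positivity

/-- The interaction energy of distinct points is bounded below by its linearisation at `ν` plus the
distance of the empirical measure to `ν`, after the kernel has been regularised at scale `ε`. -/
lemma HasBoundedDensity.exists_interaction_le {ν : Measure ℝ} [IsProbabilityMeasure ν] {M b : ℝ}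
    (h : HasBoundedDensity ν M b) :
    ∃ C : ℝ, 0 ≤ C ∧ ∀ ε : ℝ, 0 < ε → ε ≤ 1 → ∀ n : ℕ, n ≠ 0 → ∀ x : Fin n → ℝ,
      Function.Injective x →
      (n : ℝ) ^ 2 * (charDist ν n x + (∫ t, logPot ν t ∂ν) - C * √ε) + n * Real.log ε
        - 2 * n * ∑ i, logPot ν (x i) ≤
        -∑ p ∈ (Finset.univ : Finset (Fin n)).offDiag, Real.log |x p.1 - x p.2| := by
  obtain ⟨C, hC0, hC⟩ := h.exists_regularized_le
  refine ⟨2 * C, by linarith, fun ε hε hε1 n hn x hx => ?_⟩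
  have hn' : (0 : ℝ) < n := by exact_mod_cast Nat.pos_of_ne_zero hn
  have := isProbabilityMeasure_empirical hn x
  have hν2 : Integrable (fun t : ℝ => t ^ 2) ν := h.integrable_of_continuous (by fun_prop)
  have hρ2 : Integrable (fun t : ℝ => t ^ 2) (empirical n x) := integrable_empirical x _
  set L : ℝ → ℝ := fun r => 1 / 2 * Real.log (r ^ 2 + ε ^ 2) with hL
  have hmain := integral_charFun_sub_sq_le hρ2 hν2 hε hε1
  have h1 : ∫ p : ℝ × ℝ, 1 / 2 * Real.log ((p.1 - p.2) ^ 2 + ε ^ 2)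
      ∂((empirical n x).prod (empirical n x)) = 1 / (n : ℝ) ^ 2 * ∑ i, ∑ j, L (x i - x j) := by
    rw [integral_prod _ (integrable_log_sub_sq_add_sq hρ2 hρ2 hε)]
    simp only [integral_empirical, smul_eq_mul]
    rw [← Finset.mul_sum, ← mul_assoc]
    congr 1
    field_simp
  have h2 : ∫ p : ℝ × ℝ, 1 / 2 * Real.log ((p.1 - p.2) ^ 2 + ε ^ 2)
      ∂((empirical n x).prod ν) ≤ 1 / (n : ℝ) * ∑ i, (logPot ν (x i) + C * √ε) := by
    rw [integral_prod _ (integrable_log_sub_sq_add_sq hρ2 hν2 hε), integral_empirical,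
      smul_eq_mul]
    refine mul_le_mul_of_nonneg_left (Finset.sum_le_sum fun i _ => ?_) (by positivity)
    refine le_trans (le_of_eq ?_) (hC ε hε (x i))
    refine integral_congr_ae (Eventually.of_forall fun s => ?_)
    simp only
    rw [← neg_sq, neg_sub]
  have h3 : ∫ t, logPot ν t ∂ν ≤ ∫ p : ℝ × ℝ, 1 / 2 * Real.log ((p.1 - p.2) ^ 2 + ε ^ 2)
      ∂(ν.prod ν) := by
    rw [h.integral_logPot.2]
    refine integral_mono_ae h.integrable_log_sub_prod (integrable_log_sub_sq_add_sq hν2 hν2 hε) ?_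
    have hne : ∀ᵐ p : ℝ × ℝ ∂(ν.prod ν), p.1 ≠ p.2 := by
      refine (Measure.ae_prod_iff_ae_ae ?_).2 (Eventually.of_forall fun s => ?_)
      · exact (measurableSet_eq_fun measurable_fst measurable_snd).compl
      · filter_upwards [h.ae_ne s] with t ht using ht.symm
    filter_upwards [hne] with p hp
    have hp' := abs_pos.2 (sub_ne_zero.2 hp)
    have : Real.log |p.1 - p.2| = 1 / 2 * Real.log ((p.1 - p.2) ^ 2) := by
      rw [← sq_abs, Real.log_pow]; push_cast; ring
    rw [this]
    have h4 := Real.log_le_log (by rw [← sq_abs]; positivity)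
      (by nlinarith : (p.1 - p.2) ^ 2 ≤ (p.1 - p.2) ^ 2 + ε ^ 2)
    linarith
  have h4 : ∑ p ∈ (Finset.univ : Finset (Fin n)).offDiag, Real.log |x p.1 - x p.2|
      + n * Real.log ε ≤ ∑ i, ∑ j, L (x i - x j) := by
    rw [← Finset.sum_product', Finset.univ_product_univ, ← Finset.univ_product_univ,
      ← Finset.diag_union_offDiag, Finset.sum_union (Finset.disjoint_diag_offDiag _),
      Finset.sum_diag, add_comm]
    refine add_le_add ?_ (Finset.sum_le_sum fun p hp => ?_)
    · simp only [hL, sub_self]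
      rw [zero_pow two_ne_zero, zero_add, Real.log_pow]
      simp only [Finset.sum_const, Finset.card_univ, Fintype.card_fin, nsmul_eq_mul]
      push_cast
      linarith
    · have hne : x p.1 ≠ x p.2 := fun he => (Finset.mem_offDiag.1 hp).2.2 (hx he)
      have hp' := abs_pos.2 (sub_ne_zero.2 hne)
      have : Real.log |x p.1 - x p.2| = 1 / 2 * Real.log ((x p.1 - x p.2) ^ 2) := by
        rw [← sq_abs, Real.log_pow]; push_cast; ring
      rw [this, hL]
      simp only
      have h4 := Real.log_le_log (by rw [← sq_abs]; positivity)
        (by nlinarith : (x p.1 - x p.2) ^ 2 ≤ (x p.1 - x p.2) ^ 2 + ε ^ 2)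
      linarith
  have h5 : charDist ν n x ≤ 2 * (1 / (n : ℝ) * ∑ i, (logPot ν (x i) + C * √ε))
      - 1 / (n : ℝ) ^ 2 * ∑ i, ∑ j, L (x i - x j) - ∫ t, logPot ν t ∂ν := by
    rw [h1] at hmain
    unfold charDist
    linarith
  rw [Finset.sum_add_distrib] at h5
  simp only [Finset.sum_const, Finset.card_univ, Fintype.card_fin, nsmul_eq_mul] at h5
  have h6 := mul_le_mul_of_nonneg_left h5 (sq_nonneg (n : ℝ))
  have h7 : (n : ℝ) ^ 2 * (2 * (1 / (n : ℝ) * (∑ i, logPot ν (x i) + n * (C * √ε)))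
      - 1 / (n : ℝ) ^ 2 * ∑ i, ∑ j, L (x i - x j) - ∫ t, logPot ν t ∂ν) =
      2 * n * ∑ i, logPot ν (x i) + 2 * (n : ℝ) ^ 2 * (C * √ε) - ∑ i, ∑ j, L (x i - x j)
        - (n : ℝ) ^ 2 * ∫ t, logPot ν t ∂ν := by
    field_simp
  rw [h7] at h6
  nlinarith

/-- The potential `Q_δ` with the real logarithm; it differs from `Q_δ` only at `0`, for `δ > 0`. -/
noncomputable def realPotential (δ t : ℝ) : ℝ := t ^ 2 - 2 * δ * Real.log |t|

/-- The discrete energy with the real logarithm; it agrees with `discreteEnergy` on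
configurations of finite energy. -/
noncomputable def realEnergy (β m : ℝ) (n : ℕ) (x : Fin n → ℝ) : ℝ :=
  -(β / 2) * ∑ p ∈ (Finset.univ : Finset (Fin n)).offDiag, Real.log |x p.1 - x p.2|
    + ((n : ℝ) - 1) * ∑ i, realPotential (m / n) (x i)

/-- The configurations of finite energy: the points are distinct, and nonzero if `m > 0`. -/
def IsRegular (m : ℝ) (n : ℕ) (x : Fin n → ℝ) : Prop :=
  Function.Injective x ∧ ∀ i, x i ≠ 0 ∨ m = 0

/-- The energy of the equilibrium measure, as computed from the Euler-Lagrange equation; see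
`energy_eqMeasure`. -/
noncomputable def eqEnergy (β c : ℝ) : ℝ :=
  robinConst β c + β / 2 * ∫ t, logPot (eqMeasure β c) t ∂(eqMeasure β c)

variable {β c : ℝ}

/-- A convex combination of the Euler-Lagrange inequality (weight `1 - θ`) with the quadratic growth
of the external potential (weight `θ`), which absorbs the difference between `(1 - 1/n) Q_α` and
`Q_c`. -/
lemma exists_potential_lower_bound (hβ : 0 < β) (hc : 0 ≤ c) :
    ∃ C : ℝ, 0 ≤ C ∧ ∀ θ ∈ Set.Ioo (0 : ℝ) 1, ∀ τ α t : ℝ, τ ≤ θ / 2 →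
      0 ≤ (1 - τ) * α - (1 - θ) * c → (1 - τ) * α - (1 - θ) * c ≤ θ * (c + 1) →
      (t ≠ 0 ∨ c = 0) →
      (1 - θ) * robinConst β c - θ * C + θ / 4 * t ^ 2 ≤
        -(β * logPot (eqMeasure β c) t) + (1 - τ) * realPotential α t := by
  have := isProbabilityMeasure_eqMeasure hβ hc
  have hB := hasBoundedDensity_eqMeasure hβ hc
  have hb := outerEdge_pos hβ hc
  refine ⟨(β + 2 * (c + 1)) ^ 2 + β * outerEdge β c, by positivity,
    fun θ hθ τ α t hτ h0 h1 ht => ?_⟩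
  have hEL := mul_le_mul_of_nonneg_left (eulerLagrange_le hβ hc ht) (by linarith [hθ.2] : 0 ≤ 1 - θ)
  have hpot := mul_le_mul_of_nonneg_left (hB.logPot_le t) (mul_pos hθ.1 hβ).le
  have hlog : Real.log |t| ≤ |t| := Real.log_le_self (abs_nonneg t)
  set γ := (1 - τ) * α - (1 - θ) * c with hγ
  have h2 : γ * Real.log |t| ≤ θ * (c + 1) * |t| :=
    (mul_le_mul_of_nonneg_left hlog h0).trans (mul_le_mul_of_nonneg_right h1 (abs_nonneg t))
  have hsplit : -(β * logPot (eqMeasure β c) t) + (1 - τ) * realPotential α t =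
      (1 - θ) * (-(β * logPot (eqMeasure β c) t) + t ^ 2 - 2 * c * Real.log |t|)
        - θ * β * logPot (eqMeasure β c) t + (θ - τ) * t ^ 2 - 2 * (γ * Real.log |t|) := by
    rw [hγ, realPotential]; ring
  have h3 : (θ / 2) * t ^ 2 ≤ (θ - τ) * t ^ 2 :=
    mul_le_mul_of_nonneg_right (by linarith) (sq_nonneg t)
  have h4 : 0 ≤ θ * (t ^ 2 / 4 - (β + 2 * (c + 1)) * |t| + (β + 2 * (c + 1)) ^ 2) := by
    refine mul_nonneg hθ.1.le ?_
    nlinarith [sq_nonneg (|t| / 2 - (β + 2 * (c + 1))), sq_abs t]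
  rw [hsplit]
  nlinarith

/-- The lower bound for the discrete energy: up to `o(n²)` it exceeds `n² E` by a multiple of the
squared distance of the empirical measure to the equilibrium measure, and by a multiple of its
second moment. -/
theorem eventually_le_realEnergy (hβ : 0 < β) {μ : ℕ → ℝ} (hμ : ∀ n, 0 ≤ μ n)
    (hc : Tendsto (fun n : ℕ => μ n / (n : ℝ)) atTop (𝓝 c)) {η : ℝ} (hη : 0 < η) :
    ∃ κ : ℝ, 0 < κ ∧ ∀ᶠ n : ℕ in atTop, ∀ x : Fin n → ℝ, IsRegular (μ n) n x →
      (n : ℝ) ^ 2 * (eqEnergy β c - η + β / 2 * charDist (eqMeasure β c) n x)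
        + κ * n * ∑ i, x i ^ 2 ≤ realEnergy β (μ n) n x := by
  have hc0 : 0 ≤ c := ge_of_tendsto' hc fun n => div_nonneg (hμ n) (Nat.cast_nonneg n)
  have := isProbabilityMeasure_eqMeasure hβ hc0
  have hB := hasBoundedDensity_eqMeasure hβ hc0
  obtain ⟨C, hC0, hC⟩ := exists_potential_lower_bound hβ hc0
  obtain ⟨K, hK0, hK⟩ := hB.exists_interaction_le
  set ℓ := robinConst β c
  -- the weight `θ` of the growth term and the scale `ε` of the regularisation
  obtain ⟨θ, hθ, hθη⟩ : ∃ θ ∈ Set.Ioo (0 : ℝ) 1, θ * (|ℓ| + C) ≤ η / 3 := by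
    refine ⟨min (1 / 2) (η / 3 / (|ℓ| + C + 1)), ⟨by positivity,
      (min_le_left _ _).trans_lt (by norm_num)⟩, ?_⟩
    have hpos : 0 < |ℓ| + C + 1 := by positivity
    calc min (1 / 2) (η / 3 / (|ℓ| + C + 1)) * (|ℓ| + C)
        ≤ η / 3 / (|ℓ| + C + 1) * (|ℓ| + C + 1) := by
          exact mul_le_mul (min_le_right _ _) (by linarith) (by positivity) (by positivity)
      _ = η / 3 := by field_simp
  obtain ⟨ε, hε, hε1, hεη⟩ : ∃ ε : ℝ, 0 < ε ∧ ε ≤ 1 ∧ β / 2 * (K * √ε) ≤ η / 3 := by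
    have hcont : Tendsto (fun ε : ℝ => β / 2 * (K * √ε)) (𝓝[>] 0) (𝓝 (β / 2 * (K * √0))) :=
      (Continuous.tendsto (by fun_prop) 0).mono_left nhdsWithin_le_nhds
    rw [Real.sqrt_zero, mul_zero, mul_zero] at hcont
    have h1 := hcont.eventually (ge_mem_nhds (by positivity : 0 < η / 3))
    have h2 : ∀ᶠ ε : ℝ in 𝓝[>] 0, ε ∈ Set.Ioc (0 : ℝ) 1 := Ioc_mem_nhdsGT one_pos
    obtain ⟨ε, h3, h4⟩ := (h1.and h2).exists
    exact ⟨ε, h4.1, h4.2, h3⟩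
  refine ⟨θ / 4, by linarith [hθ.1], ?_⟩
  have hinv : Tendsto (fun n : ℕ => 1 / (n : ℝ)) atTop (𝓝 0) := tendsto_one_div_atTop_nhds_zero_nat
  have hγ : Tendsto (fun n : ℕ => (1 - 1 / (n : ℝ)) * (μ n / n) - (1 - θ) * c) atTop
      (𝓝 (θ * c)) := by
    have := ((tendsto_const_nhds (x := (1 : ℝ))).sub hinv).mul hc |>.sub_const ((1 - θ) * c)
    convert this using 2
    ring
  have e1 : ∀ᶠ n : ℕ in atTop, 1 / (n : ℝ) ≤ θ / 2 :=
    hinv.eventually (ge_mem_nhds (by linarith [hθ.1]))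
  have e2 : ∀ᶠ n : ℕ in atTop, (1 - 1 / (n : ℝ)) * (μ n / n) - (1 - θ) * c ≤ θ * (c + 1) :=
    hγ.eventually (ge_mem_nhds (by nlinarith [hθ.1]))
  have e3 : ∀ᶠ n : ℕ in atTop, 0 ≤ (1 - 1 / (n : ℝ)) * (μ n / n) - (1 - θ) * c := by
    rcases hc0.eq_or_lt with h | h
    · filter_upwards [eventually_ge_atTop 1] with n hn
      have h1 : (1 : ℝ) ≤ n := by exact_mod_cast hn
      have h2 : 1 / (n : ℝ) ≤ 1 := by rw [div_le_one (by linarith)]; exact h1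
      rw [← h, mul_zero, sub_zero]
      exact mul_nonneg (by linarith) (div_nonneg (hμ n) (by linarith))
    · exact hγ.eventually (le_mem_nhds (mul_pos hθ.1 h))
  have e4 : ∀ᶠ n : ℕ in atTop, -(β / 2 * Real.log ε) * (1 / (n : ℝ)) ≤ η / 3 := by
    have := hinv.const_mul (-(β / 2 * Real.log ε))
    rw [mul_zero] at this
    exact this.eventually (ge_mem_nhds (by positivity))
  filter_upwards [e1, e2, e3, e4, eventually_ge_atTop 1] with n h1 h2 h3 h4 hn x hx
  have hn0 : n ≠ 0 := by omega
  have hn' : (0 : ℝ) < n := by exact_mod_cast Nat.pos_of_ne_zero hn0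
  have hI := hK ε hε hε1 n hn0 x hx.1
  have hpt : ∀ i, (1 - θ) * ℓ - θ * C + θ / 4 * x i ^ 2 ≤
      -(β * logPot (eqMeasure β c) (x i)) + (1 - 1 / (n : ℝ)) * realPotential (μ n / n) (x i) := by
    intro i
    refine hC θ hθ (1 / n) (μ n / n) (x i) h1 h3 h2 ?_
    rcases hx.2 i with h | h
    · exact Or.inl h
    · right
      rw [h, zero_div, mul_zero] at h3
      nlinarith [hθ.2]
  have hsum := Finset.sum_le_sum fun i (_ : i ∈ Finset.univ) => hpt i
  simp only [Finset.sum_add_distrib, ← Finset.mul_sum, Finset.sum_neg_distrib, Finset.sum_const,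
    Finset.card_univ, Fintype.card_fin, nsmul_eq_mul] at hsum
  have hsum' := mul_le_mul_of_nonneg_left hsum hn'.le
  have hn1 : (n : ℝ) * ((1 - 1 / (n : ℝ)) * ∑ i, realPotential (μ n / n) (x i)) =
      ((n : ℝ) - 1) * ∑ i, realPotential (μ n / n) (x i) := by
    field_simp
  rw [mul_add, mul_add (n : ℝ) (-_), hn1] at hsum'
  have hI' := mul_le_mul_of_nonneg_left hI (by positivity : 0 ≤ β / 2)
  have hl : θ * ℓ ≤ θ * |ℓ| := mul_le_mul_of_nonneg_left (le_abs_self ℓ) hθ.1.le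
  have h4' : -(β / 2 * (n * Real.log ε)) ≤ (n : ℝ) ^ 2 * (η / 3) := by
    have := mul_le_mul_of_nonneg_left h4 (sq_nonneg (n : ℝ))
    have h5 : (n : ℝ) ^ 2 * (-(β / 2 * Real.log ε) * (1 / (n : ℝ))) =
        -(β / 2 * (n * Real.log ε)) := by field_simp
    linarith
  have h5 : (n : ℝ) ^ 2 * (θ * ℓ + θ * C + β / 2 * (K * √ε)) ≤ (n : ℝ) ^ 2 * (2 * (η / 3)) :=
    mul_le_mul_of_nonneg_left (by nlinarith) (sq_nonneg _)
  unfold eqEnergy realEnergy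
  linarith

end LowerBound

/-! ### Extended-real energies in terms of real ones -/

section ExtendedReal

lemma coe_sum_ereal {ι : Type*} (s : Finset ι) (f : ι → ℝ) :
    ∑ i ∈ s, ((f i : ℝ) : EReal) = ((∑ i ∈ s, f i : ℝ) : EReal) := by
  classical
  induction s using Finset.induction_on with
  | empty => simp
  | insert a s ha ih => rw [Finset.sum_insert ha, Finset.sum_insert ha, ih, EReal.coe_add]

lemma sum_ne_bot_ereal {ι : Type*} {s : Finset ι} {f : ι → EReal} (hf : ∀ i ∈ s, f i ≠ ⊥) :
    ∑ i ∈ s, f i ≠ ⊥ := by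
  classical
  induction s using Finset.induction_on with
  | empty => simp
  | insert a s ha ih =>
    rw [Finset.sum_insert ha, EReal.add_ne_bot_iff]
    exact ⟨hf a (Finset.mem_insert_self a s), ih fun i hi => hf i (Finset.mem_insert_of_mem hi)⟩

lemma sum_eq_top_ereal {ι : Type*} {s : Finset ι} {f : ι → EReal} (hf : ∀ i ∈ s, f i ≠ ⊥)
    {a : ι} (ha : a ∈ s) (hfa : f a = ⊤) : ∑ i ∈ s, f i = ⊤ := by
  classical
  rw [← Finset.add_sum_erase s f ha, hfa]
  exact EReal.top_add_of_ne_bot (sum_ne_bot_ereal fun i hi => hf i (Finset.mem_of_mem_erase hi))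

lemma logInv_of_ne_zero {r : ℝ} (hr : r ≠ 0) : logInv r = ((-Real.log |r| : ℝ) : EReal) := by
  rw [logInv, if_neg hr, one_div, Real.log_inv]

lemma logInv_zero : logInv 0 = ⊤ := by rw [logInv, if_pos rfl]

lemma logInv_ne_bot (r : ℝ) : logInv r ≠ ⊥ := by
  by_cases hr : r = 0
  · rw [hr, logInv_zero]; exact top_ne_bot
  · rw [logInv_of_ne_zero hr]; exact EReal.coe_ne_bot _

lemma potential_eq_coe {δ t : ℝ} (h : t ≠ 0 ∨ δ = 0) :
    potential δ t = ((realPotential δ t : ℝ) : EReal) := by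
  rcases h with h | h
  · rw [potential, logInv_of_ne_zero h, ← EReal.coe_mul, ← EReal.coe_add, realPotential]
    congr 1; ring
  · rw [potential, h, mul_zero, EReal.coe_zero, zero_mul, add_zero, realPotential]
    congr 1; ring

lemma potential_zero {δ : ℝ} (hδ : 0 < δ) : potential δ 0 = ⊤ := by
  rw [potential, logInv_zero, EReal.coe_mul_top_of_pos (by positivity),
    EReal.coe_add_top]

lemma potential_eq_top {δ t : ℝ} (hδ : 0 ≤ δ) (h : ¬(t ≠ 0 ∨ δ = 0)) : potential δ t = ⊤ := by
  push Not at h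
  rw [h.1]
  exact potential_zero (lt_of_le_of_ne hδ (Ne.symm h.2))

lemma potential_ne_bot {δ : ℝ} (hδ : 0 ≤ δ) (t : ℝ) : potential δ t ≠ ⊥ := by
  by_cases h : t ≠ 0 ∨ δ = 0
  · rw [potential_eq_coe h]; exact EReal.coe_ne_bot _
  · rw [potential_eq_top hδ h]; exact top_ne_bot

lemma coe_mul_ne_bot {a : ℝ} (ha : 0 < a) {x : EReal} (hx : x ≠ ⊥) : (a : EReal) * x ≠ ⊥ := by
  induction x with
  | bot => exact absurd rfl hx
  | coe x => rw [← EReal.coe_mul]; exact EReal.coe_ne_bot _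
  | top => rw [EReal.coe_mul_top_of_pos ha]; exact top_ne_bot

/-- The energy kernel with the real logarithm. -/
noncomputable def realKernel (β δ : ℝ) (p : ℝ × ℝ) : ℝ :=
  -(β / 2) * Real.log |p.1 - p.2| + 1 / 2 * realPotential δ p.1 + 1 / 2 * realPotential δ p.2

/-- The set on which the energy kernel is finite. -/
def finiteSet (δ : ℝ) : Set (ℝ × ℝ) :=
  {p | p.1 ≠ p.2 ∧ (p.1 ≠ 0 ∨ δ = 0) ∧ (p.2 ≠ 0 ∨ δ = 0)}

lemma measurableSet_finiteSet (δ : ℝ) : MeasurableSet (finiteSet δ) := by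
  refine MeasurableSet.inter (measurableSet_eq_fun measurable_fst measurable_snd).compl
    (MeasurableSet.inter ?_ ?_)
  · exact (measurableSet_eq_fun measurable_fst measurable_const).compl.union
      (MeasurableSet.const _)
  · exact (measurableSet_eq_fun measurable_snd measurable_const).compl.union
      (MeasurableSet.const _)

lemma measurable_realPotential (δ : ℝ) : Measurable (realPotential δ) := by
  unfold realPotential
  exact (measurable_id.pow_const 2).sub
    ((Real.measurable_log.comp measurable_id.abs).const_mul _)

lemma measurable_realKernel (β δ : ℝ) : Measurable (realKernel β δ) := by
  unfold realKernel
  exact (((Real.measurable_log.comp (by fun_prop : Measurable fun p : ℝ × ℝ =>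
    |p.1 - p.2|)).const_mul _).add (((measurable_realPotential δ).comp measurable_fst).const_mul
      _)).add (((measurable_realPotential δ).comp measurable_snd).const_mul _)

variable {β δ : ℝ}

lemma energyKernel_eq_coe {p : ℝ × ℝ} (hp : p ∈ finiteSet δ) :
    energyKernel β δ p = ((realKernel β δ p : ℝ) : EReal) := by
  rw [energyKernel, logInv_of_ne_zero (sub_ne_zero.2 hp.1), potential_eq_coe hp.2.1,
    potential_eq_coe hp.2.2, ← EReal.coe_mul, ← EReal.coe_mul, ← EReal.coe_mul, ← EReal.coe_add,
    ← EReal.coe_add, realKernel]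
  congr 1; ring

lemma energyKernel_eq_top (hβ : 0 < β) (hδ : 0 ≤ δ) {p : ℝ × ℝ} (hp : p ∉ finiteSet δ) :
    energyKernel β δ p = ⊤ := by
  have hhalf : (0 : ℝ) < 1 / 2 := by norm_num
  have h1 : ((β / 2 : ℝ) : EReal) * logInv (p.1 - p.2) ≠ ⊥ :=
    coe_mul_ne_bot (by positivity) (logInv_ne_bot _)
  have h2 := coe_mul_ne_bot hhalf (potential_ne_bot hδ p.1)
  have h3 := coe_mul_ne_bot hhalf (potential_ne_bot hδ p.2)
  rw [energyKernel]
  by_cases e1 : p.1 ≠ p.2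
  · by_cases e2 : p.1 ≠ 0 ∨ δ = 0
    · have e3 : ¬(p.2 ≠ 0 ∨ δ = 0) := fun e3 => hp ⟨e1, e2, e3⟩
      rw [potential_eq_top hδ e3, EReal.coe_mul_top_of_pos hhalf]
      exact EReal.add_top_of_ne_bot (EReal.add_ne_bot_iff.2 ⟨h1, h2⟩)
    · rw [potential_eq_top hδ e2, EReal.coe_mul_top_of_pos hhalf, EReal.add_top_of_ne_bot h1]
      exact EReal.top_add_of_ne_bot h3
  · rw [not_not.1 e1, sub_self, logInv_zero, EReal.coe_mul_top_of_pos (by positivity),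
      EReal.top_add_of_ne_bot (by rw [← not_not.1 e1]; exact h2), EReal.top_add_of_ne_bot h3]

lemma measurable_energyKernel (hβ : 0 < β) (hδ : 0 ≤ δ) : Measurable (energyKernel β δ) := by
  classical
  have : energyKernel β δ = fun p =>
      if p ∈ finiteSet δ then ((realKernel β δ p : ℝ) : EReal) else ⊤ := by
    ext p
    split_ifs with h
    · exact energyKernel_eq_coe h
    · exact energyKernel_eq_top hβ hδ h
  rw [this]
  exact Measurable.ite (measurableSet_finiteSet δ)
    (measurable_coe_real_ereal.comp (measurable_realKernel β δ)) measurable_const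

/-- The energy kernel grows quadratically; the logarithms are absorbed by a quarter of the
quadratic terms. -/
lemma le_realKernel (hβ : 0 < β) (hδ : 0 ≤ δ) (p : ℝ × ℝ) :
    1 / 4 * p.1 ^ 2 + 1 / 4 * p.2 ^ 2 - 2 * (β / 2 + δ) ^ 2 ≤ realKernel β δ p := by
  have h1 : Real.log |p.1 - p.2| ≤ |p.1| + |p.2| :=
    (Real.log_le_self (abs_nonneg _)).trans (abs_sub _ _)
  have h2 : Real.log |p.1| ≤ |p.1| := Real.log_le_self (abs_nonneg _)
  have h3 : Real.log |p.2| ≤ |p.2| := Real.log_le_self (abs_nonneg _)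
  have h4 := mul_le_mul_of_nonneg_left h1 (by positivity : 0 ≤ β / 2)
  have h5 := mul_le_mul_of_nonneg_left h2 hδ
  have h6 := mul_le_mul_of_nonneg_left h3 hδ
  have h7 := sq_nonneg (|p.1| / 2 - (β / 2 + δ))
  have h8 := sq_nonneg (|p.2| / 2 - (β / 2 + δ))
  have h9 := sq_abs p.1
  have h10 := sq_abs p.2
  unfold realKernel realPotential
  nlinarith

lemma eintegral_eq_coe {X : Type*} [MeasurableSpace X] {m : Measure X} {f : X → EReal} {g : X → ℝ}
    (hfg : ∀ᵐ x ∂m, f x = ((g x : ℝ) : EReal)) (hg : Integrable g m) :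
    eintegral m f = ((∫ x, g x ∂m : ℝ) : EReal) := by
  have h1 : ∫⁻ x, (f x).toENNReal ∂m = ∫⁻ x, ENNReal.ofReal (g x) ∂m :=
    lintegral_congr_ae (hfg.mono fun x hx => by simp only [hx, EReal.real_coe_toENNReal])
  have h2 : ∫⁻ x, (-f x).toENNReal ∂m = ∫⁻ x, ENNReal.ofReal (-g x) ∂m :=
    lintegral_congr_ae (hfg.mono fun x hx => by
      simp only [hx, ← EReal.coe_neg, EReal.real_coe_toENNReal])
  have f1 : ∫⁻ x, ENNReal.ofReal (g x) ∂m ≠ ⊤ := hg.lintegral_lt_top.ne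
  have f2 : ∫⁻ x, ENNReal.ofReal (-g x) ∂m ≠ ⊤ := hg.neg.lintegral_lt_top.ne
  rw [eintegral, h1, h2, integral_eq_lintegral_pos_part_sub_lintegral_neg_part hg, EReal.coe_sub,
    EReal.coe_ennreal_toReal f1, EReal.coe_ennreal_toReal f2]

/-- The energy of a probability measure is either infinite, or the integral of the real kernel. -/
lemma energy_eq_top_or (hβ : 0 < β) (hδ : 0 ≤ δ) (ρ : Measure ℝ) [IsProbabilityMeasure ρ] :
    energy β δ ρ = ⊤ ∨ ((∀ᵐ p ∂(ρ.prod ρ), p ∈ finiteSet δ) ∧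
      Integrable (realKernel β δ) (ρ.prod ρ) ∧
      energy β δ ρ = ((∫ p, realKernel β δ p ∂(ρ.prod ρ) : ℝ) : EReal)) := by
  set K := 2 * (β / 2 + δ) ^ 2 with hK
  have hlow : ∀ p, -K ≤ realKernel β δ p := fun p => by
    have := le_realKernel hβ hδ p
    nlinarith [sq_nonneg p.1, sq_nonneg p.2]
  by_cases h : ∫⁻ p, (energyKernel β δ p).toENNReal ∂(ρ.prod ρ) = ⊤
  · left
    have hneg : ∫⁻ p, (-energyKernel β δ p).toENNReal ∂(ρ.prod ρ) ≤ ENNReal.ofReal K := by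
      calc ∫⁻ p, (-energyKernel β δ p).toENNReal ∂(ρ.prod ρ)
          ≤ ∫⁻ _, ENNReal.ofReal K ∂(ρ.prod ρ) := by
            refine lintegral_mono fun p => ?_
            by_cases hp : p ∈ finiteSet δ
            · rw [energyKernel_eq_coe hp, ← EReal.coe_neg, EReal.real_coe_toENNReal]
              exact ENNReal.ofReal_le_ofReal (by linarith [hlow p])
            · rw [energyKernel_eq_top hβ hδ hp, EReal.neg_top, EReal.toENNReal_bot]
              exact zero_le
        _ = ENNReal.ofReal K := by simp
    rw [energy, eintegral, h]
    generalize ∫⁻ p, (-energyKernel β δ p).toENNReal ∂(ρ.prod ρ) = z at hneg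
    have hz : z ≠ ⊤ := (hneg.trans_lt ENNReal.ofReal_lt_top).ne
    lift z to NNReal using hz
    rw [EReal.coe_ennreal_top, sub_eq_add_neg]
    refine EReal.top_add_of_ne_bot ?_
    rw [Ne, EReal.neg_eq_bot_iff]
    simp
  · right
    have hm := measurable_energyKernel hβ hδ
    have hae : ∀ᵐ p ∂(ρ.prod ρ), p ∈ finiteSet δ := by
      filter_upwards [ae_lt_top hm.ereal_toENNReal h] with p hp
      by_contra hcon
      rw [energyKernel_eq_top hβ hδ hcon, EReal.toENNReal_top] at hp
      exact lt_irrefl _ hp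
    have hi : Integrable (realKernel β δ) (ρ.prod ρ) := by
      have h1 : Integrable (fun p => realKernel β δ p + K) (ρ.prod ρ) := by
        refine ⟨((measurable_realKernel β δ).add_const _).aestronglyMeasurable, ?_⟩
        rw [hasFiniteIntegral_iff_ofReal (Eventually.of_forall fun p => by
          simp only [Pi.zero_apply]; linarith [hlow p])]
        calc ∫⁻ p, ENNReal.ofReal (realKernel β δ p + K) ∂(ρ.prod ρ)
            ≤ ∫⁻ p, ((energyKernel β δ p).toENNReal + ENNReal.ofReal K) ∂(ρ.prod ρ) := by
              refine lintegral_mono_ae (hae.mono fun p hp => ?_)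
              rw [energyKernel_eq_coe hp, EReal.real_coe_toENNReal]
              exact ENNReal.ofReal_add_le
          _ < ⊤ := by
              rw [lintegral_add_right _ measurable_const]
              exact ENNReal.add_lt_top.2 ⟨Ne.lt_top h, by simp⟩
      refine (h1.sub (integrable_const K)).congr (Eventually.of_forall fun p => ?_)
      simp
    exact ⟨hae, hi, eintegral_eq_coe (hae.mono fun p hp => energyKernel_eq_coe hp) hi⟩

/-! ### The discrete energy and its minimizers -/

variable {m : ℝ} {n : ℕ}

lemma discreteEnergy_eq_coe {x : Fin n → ℝ} (hx : IsRegular m n x) :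
    discreteEnergy β m n x = ((realEnergy β m n x : ℝ) : EReal) := by
  have h1 : ∀ p ∈ (Finset.univ : Finset (Fin n)).offDiag,
      logInv (x p.1 - x p.2) = ((-Real.log |x p.1 - x p.2| : ℝ) : EReal) := fun p hp =>
    logInv_of_ne_zero (sub_ne_zero.2 fun h => (Finset.mem_offDiag.1 hp).2.2 (hx.1 h))
  have h2 : ∀ i ∈ (Finset.univ : Finset (Fin n)),
      potential (m / n) (x i) = ((realPotential (m / n) (x i) : ℝ) : EReal) := fun i _ =>
    potential_eq_coe ((hx.2 i).imp_right fun h => by rw [h, zero_div])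
  rw [discreteEnergy, Finset.sum_congr rfl h1, Finset.sum_congr rfl h2, coe_sum_ereal,
    coe_sum_ereal, ← EReal.coe_mul, ← EReal.coe_mul, ← EReal.coe_add, realEnergy,
    Finset.sum_neg_distrib]
  congr 1; ring

lemma discreteEnergy_eq_top (hβ : 0 < β) (hm : 0 ≤ m) (hn : 2 ≤ n) {x : Fin n → ℝ}
    (hx : ¬IsRegular m n x) : discreteEnergy β m n x = ⊤ := by
  have hn' : (2 : ℝ) ≤ n := by exact_mod_cast hn
  have hδ : 0 ≤ m / (n : ℝ) := by positivity
  have hb1 : ∀ p ∈ (Finset.univ : Finset (Fin n)).offDiag, logInv (x p.1 - x p.2) ≠ ⊥ :=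
    fun p _ => logInv_ne_bot _
  have hb2 : ∀ i ∈ (Finset.univ : Finset (Fin n)), potential (m / n) (x i) ≠ ⊥ :=
    fun i _ => potential_ne_bot hδ _
  rw [discreteEnergy]
  by_cases h : Function.Injective x
  · have h2 : ∃ i, ¬(x i ≠ 0 ∨ m = 0) := by
      by_contra hcon
      exact hx ⟨h, fun i => not_not.1 fun hi => hcon ⟨i, hi⟩⟩
    obtain ⟨i, hi⟩ := h2
    have hi' : ¬(x i ≠ 0 ∨ m / (n : ℝ) = 0) := by
      rintro (h1 | h1)
      · exact hi (Or.inl h1)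
      · rw [div_eq_zero_iff] at h1
        rcases h1 with h1 | h1
        · exact hi (Or.inr h1)
        · linarith
    rw [sum_eq_top_ereal hb2 (Finset.mem_univ i) (potential_eq_top hδ hi'),
      EReal.coe_mul_top_of_pos (by linarith)]
    exact EReal.add_top_of_ne_bot (coe_mul_ne_bot (by positivity) (sum_ne_bot_ereal hb1))
  · rw [Function.not_injective_iff] at h
    obtain ⟨i, j, hij, hne⟩ := h
    rw [sum_eq_top_ereal hb1 (a := (i, j)) (by simp [hne])
      (by simp only [hij, sub_self, logInv_zero]), EReal.coe_mul_top_of_pos (by positivity)]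
    exact EReal.top_add_of_ne_bot (coe_mul_ne_bot (by linarith) (sum_ne_bot_ereal hb2))

lemma sum_offDiag_fst (f : Fin n → ℝ) :
    ∑ p ∈ (Finset.univ : Finset (Fin n)).offDiag, f p.1 = ((n : ℝ) - 1) * ∑ i, f i := by
  have h1 : ∑ p ∈ (Finset.univ : Finset (Fin n)).diag, f p.1 = ∑ i, f i := by
    rw [Finset.sum_diag]
  have h2 : ∑ p : Fin n × Fin n, f p.1 = n * ∑ i, f i := by
    rw [Fintype.sum_prod_type]
    simp [Finset.mul_sum]
  rw [← Finset.univ_product_univ, ← Finset.diag_union_offDiag,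
    Finset.sum_union (Finset.disjoint_diag_offDiag _), h1] at h2
  linarith

lemma sum_offDiag_snd (f : Fin n → ℝ) :
    ∑ p ∈ (Finset.univ : Finset (Fin n)).offDiag, f p.2 = ((n : ℝ) - 1) * ∑ i, f i := by
  rw [← sum_offDiag_fst f]
  refine Finset.sum_equiv (Equiv.prodComm _ _) (fun p => ?_) fun p _ => rfl
  simp [Finset.mem_offDiag, ne_comm]

lemma realEnergy_eq_sum (β m : ℝ) (x : Fin n → ℝ) :
    realEnergy β m n x = ∑ p ∈ (Finset.univ : Finset (Fin n)).offDiag,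
      realKernel β (m / n) (x p.1, x p.2) := by
  unfold realKernel
  simp only
  rw [Finset.sum_add_distrib, Finset.sum_add_distrib, ← Finset.mul_sum, ← Finset.mul_sum,
    ← Finset.mul_sum, sum_offDiag_fst (fun i => realPotential (m / n) (x i)),
    sum_offDiag_snd (fun i => realPotential (m / n) (x i)), realEnergy]
  ring

/-- The density `exp (-K_n)`, which is continuous and vanishes at infinity. -/
noncomputable def boltzmann (β m : ℝ) (n : ℕ) (x : Fin n → ℝ) : ℝ :=
  (∏ p ∈ (Finset.univ : Finset (Fin n)).offDiag, |x p.1 - x p.2| ^ (β / 2)) *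
    ∏ i, (|x i| ^ (2 * (m / n) * ((n : ℝ) - 1)) * Real.exp (-(((n : ℝ) - 1) * x i ^ 2)))

lemma boltzmann_eq_exp {x : Fin n → ℝ} (hx : IsRegular m n x) :
    boltzmann β m n x = Real.exp (-realEnergy β m n x) := by
  have h1 : ∀ p ∈ (Finset.univ : Finset (Fin n)).offDiag,
      |x p.1 - x p.2| ^ (β / 2) = Real.exp (β / 2 * Real.log |x p.1 - x p.2|) := fun p hp => by
    have h := abs_pos.2 (sub_ne_zero.2 fun h => (Finset.mem_offDiag.1 hp).2.2 (hx.1 h))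
    rw [Real.rpow_def_of_pos h, mul_comm]
  have h2 : ∀ i ∈ (Finset.univ : Finset (Fin n)), |x i| ^ (2 * (m / n) * ((n : ℝ) - 1)) *
      Real.exp (-(((n : ℝ) - 1) * x i ^ 2)) =
      Real.exp (-(((n : ℝ) - 1) * realPotential (m / n) (x i))) := fun i _ => by
    rcases hx.2 i with h | h
    · rw [Real.rpow_def_of_pos (abs_pos.2 h), ← Real.exp_add, realPotential]
      congr 1; ring
    · rw [h, realPotential]; simp
  rw [boltzmann, Finset.prod_congr rfl h1, Finset.prod_congr rfl h2, ← Real.exp_sum,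
    ← Real.exp_sum, ← Real.exp_add, realEnergy, ← Finset.mul_sum, Finset.sum_neg_distrib,
    ← Finset.mul_sum]
  congr 1; ring

lemma boltzmann_eq_zero (hβ : 0 < β) (hm : 0 ≤ m) (hn : 2 ≤ n) {x : Fin n → ℝ}
    (hx : ¬IsRegular m n x) : boltzmann β m n x = 0 := by
  have hn' : (2 : ℝ) ≤ n := by exact_mod_cast hn
  rw [boltzmann, mul_eq_zero, Finset.prod_eq_zero_iff, Finset.prod_eq_zero_iff]
  by_cases h : Function.Injective x
  · right
    by_contra hcon
    push Not at hcon
    refine hx ⟨h, fun i => ?_⟩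
    by_contra hi
    push Not at hi
    apply hcon i (Finset.mem_univ i)
    have hmpos : 0 < m := lt_of_le_of_ne hm (Ne.symm hi.2)
    have : 0 < 2 * (m / n) * ((n : ℝ) - 1) :=
      mul_pos (by positivity) (by linarith)
    rw [hi.1, abs_zero, Real.zero_rpow this.ne', zero_mul]
  · left
    rw [Function.not_injective_iff] at h
    obtain ⟨i, j, hij, hne⟩ := h
    refine ⟨(i, j), by simp [hne], ?_⟩
    simp only [hij, sub_self, abs_zero]
    exact Real.zero_rpow (by positivity)

lemma continuous_boltzmann (hβ : 0 < β) (hm : 0 ≤ m) (hn : 2 ≤ n) :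
    Continuous (boltzmann β m n) := by
  have hn' : (2 : ℝ) ≤ n := by exact_mod_cast hn
  unfold boltzmann
  refine Continuous.mul (continuous_finsetProd _ fun p _ => ?_)
    (continuous_finsetProd _ fun i _ => Continuous.mul ?_ (by fun_prop))
  · exact Continuous.rpow_const (by fun_prop) fun x => Or.inr (by positivity)
  · exact Continuous.rpow_const (by fun_prop) fun x =>
      Or.inr (mul_nonneg (by positivity) (by linarith))

lemma le_realEnergy (hβ : 0 < β) (hm : 0 ≤ m) (hn : 2 ≤ n) (x : Fin n → ℝ) :
    1 / 2 * ∑ i, x i ^ 2 - 2 * (β / 2 + m / n) ^ 2 * (n * ((n : ℝ) - 1)) ≤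
      realEnergy β m n x := by
  have hn' : (2 : ℝ) ≤ n := by exact_mod_cast hn
  rw [realEnergy_eq_sum]
  have h := Finset.sum_le_sum fun p (_ : p ∈ (Finset.univ : Finset (Fin n)).offDiag) =>
    le_realKernel hβ (div_nonneg hm (Nat.cast_nonneg n)) (x p.1, x p.2)
  refine le_trans ?_ h
  simp only
  have hconst := sum_offDiag_fst (n := n) fun _ => 2 * (β / 2 + m / n) ^ 2
  simp only [Finset.sum_const (s := (Finset.univ : Finset (Fin n))), Finset.card_univ,
    Fintype.card_fin, nsmul_eq_mul] at hconst
  rw [Finset.sum_sub_distrib, Finset.sum_add_distrib, sum_offDiag_fst (fun i => 1 / 4 * x i ^ 2),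
    sum_offDiag_snd (fun i => 1 / 4 * x i ^ 2), ← Finset.mul_sum, hconst]
  have hs : 0 ≤ ∑ i, x i ^ 2 := Finset.sum_nonneg fun i _ => sq_nonneg _
  nlinarith

lemma exists_isRegular (m : ℝ) (n : ℕ) : ∃ x : Fin n → ℝ, IsRegular m n x := by
  refine ⟨fun i => (i : ℝ) + 1, fun i j hij => ?_, fun i => Or.inl (by positivity)⟩
  simpa [Fin.ext_iff] using hij

/-- The discrete energy has a minimizer of finite energy. -/
theorem exists_minimizer (hβ : 0 < β) (hm : 0 ≤ m) (hn : 2 ≤ n) :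
    ∃ x : Fin n → ℝ, IsRegular m n x ∧
      ∀ y, IsRegular m n y → realEnergy β m n x ≤ realEnergy β m n y := by
  obtain ⟨x₀, hx₀⟩ := exists_isRegular m n
  set C := 2 * (β / 2 + m / n) ^ 2 * (n * ((n : ℝ) - 1)) with hC
  have hbound : ∀ x, boltzmann β m n x ≤ Real.exp (C - 1 / 2 * ‖x‖ ^ 2) := by
    intro x
    by_cases hx : IsRegular m n x
    · rw [boltzmann_eq_exp hx]
      refine Real.exp_le_exp.2 ?_
      have h1 := le_realEnergy hβ hm hn x
      have h2 : ‖x‖ ^ 2 ≤ ∑ i, x i ^ 2 := by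
        have hs : 0 ≤ ∑ i, x i ^ 2 := Finset.sum_nonneg fun i _ => sq_nonneg _
        rw [← Real.sqrt_le_sqrt_iff hs, Real.sqrt_sq (norm_nonneg x)]
        refine (pi_norm_le_iff_of_nonneg (Real.sqrt_nonneg _)).2 fun i => ?_
        rw [Real.norm_eq_abs]
        refine Real.abs_le_sqrt ?_
        exact Finset.single_le_sum (f := fun i => x i ^ 2) (fun j _ => sq_nonneg _)
          (Finset.mem_univ i)
      linarith
    · rw [boltzmann_eq_zero hβ hm hn hx]
      exact (Real.exp_pos _).le
  have hlim : Tendsto (fun x : Fin n → ℝ => Real.exp (C - 1 / 2 * ‖x‖ ^ 2))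
      (cocompact (Fin n → ℝ)) (𝓝 0) := by
    refine Real.tendsto_exp_atBot.comp ?_
    have h1 : Tendsto (fun x : Fin n → ℝ => ‖x‖ ^ 2) (cocompact (Fin n → ℝ)) atTop :=
      (tendsto_pow_atTop two_ne_zero).comp tendsto_norm_cocompact_atTop
    have h2 := h1.const_mul_atTop (by norm_num : (0 : ℝ) < 1 / 2)
    exact tendsto_atBot_add_const_left _ C (tendsto_neg_atTop_atBot.comp h2)
  have hpos : 0 < boltzmann β m n x₀ := by
    rw [boltzmann_eq_exp hx₀]; exact Real.exp_pos _
  obtain ⟨x, hx⟩ := (continuous_boltzmann hβ hm hn).exists_forall_ge' x₀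
    ((hlim.eventually (ge_mem_nhds hpos)).mono fun y hy => (hbound y).trans hy)
  have hxr : IsRegular m n x := by
    by_contra hcon
    have := hx x₀
    rw [boltzmann_eq_zero hβ hm hn hcon] at this
    linarith
  refine ⟨x, hxr, fun y hy => ?_⟩
  have := hx y
  rw [boltzmann_eq_exp hy, boltzmann_eq_exp hxr, Real.exp_le_exp] at this
  linarith

lemma iInf_discreteEnergy_eq (hβ : 0 < β) (hm : 0 ≤ m) (hn : 2 ≤ n) {x : Fin n → ℝ}
    (hx : IsRegular m n x)
    (hmin : ∀ y, IsRegular m n y → realEnergy β m n x ≤ realEnergy β m n y) :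
    ⨅ y : Fin n → ℝ, discreteEnergy β m n y = ((realEnergy β m n x : ℝ) : EReal) := by
  refine le_antisymm ?_ (le_iInf fun y => ?_)
  · rw [← discreteEnergy_eq_coe hx]
    exact iInf_le _ x
  · by_cases hy : IsRegular m n y
    · rw [discreteEnergy_eq_coe hy]
      exact EReal.coe_le_coe_iff.2 (hmin y hy)
    · rw [discreteEnergy_eq_top hβ hm hn hy]
      exact le_top

/-- The minimizers of the discrete energy are the regular minimizers of the real energy. -/
lemma isFekete_iff (hβ : 0 < β) (hm : 0 ≤ m) (hn : 2 ≤ n) {x : Fin n → ℝ} :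
    IsFekete β m n x ↔ IsRegular m n x ∧
      ∀ y, IsRegular m n y → realEnergy β m n x ≤ realEnergy β m n y := by
  constructor
  · intro h
    obtain ⟨x₁, hx₁, hmin⟩ := exists_minimizer hβ hm hn
    rw [IsFekete, iInf_discreteEnergy_eq hβ hm hn hx₁ hmin] at h
    have hx : IsRegular m n x := by
      by_contra hcon
      rw [discreteEnergy_eq_top hβ hm hn hcon] at h
      exact EReal.coe_ne_top _ h.symm
    rw [discreteEnergy_eq_coe hx, EReal.coe_eq_coe_iff] at h
    exact ⟨hx, fun y hy => h.le.trans (hmin y hy)⟩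
  · rintro ⟨hx, hmin⟩
    rw [IsFekete, iInf_discreteEnergy_eq hβ hm hn hx hmin, discreteEnergy_eq_coe hx]

end ExtendedReal

/-! ### Averaging the discrete energy over independent points -/

section Averaging

variable {β δ m : ℝ} {n : ℕ} {ρ : Measure ℝ}

lemma measurePreserving_eval_pair (ρ : Measure ℝ) [IsProbabilityMeasure ρ] {i j : Fin n}
    (hij : i ≠ j) :
    MeasurePreserving (fun x : Fin n → ℝ => (x i, x j)) (Measure.pi fun _ => ρ) (ρ.prod ρ) := by
  refine ⟨by fun_prop, ?_⟩
  have h := (ProbabilityTheory.iIndepFun_pi (μ := fun _ : Fin n => ρ) (X := fun _ t => t)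
    fun _ => aemeasurable_id).indepFun hij
  rw [h.map_prod_eq_prod_map_map (measurable_pi_apply i).aemeasurable
    (measurable_pi_apply j).aemeasurable]
  congr 1
  · exact (measurePreserving_eval (fun _ : Fin n => ρ) i).map_eq
  · exact (measurePreserving_eval (fun _ : Fin n => ρ) j).map_eq

/-- Independent points avoid the poles of the discrete energy, since a measure of finite energy has
no atom that the kernel sees. -/
lemma ae_isRegular_pi [IsProbabilityMeasure ρ] (hn : 2 ≤ n)
    (h : ∀ᵐ p ∂(ρ.prod ρ), p ∈ finiteSet (m / n)) :
    ∀ᵐ x ∂(Measure.pi fun _ : Fin n => ρ), IsRegular m n x := by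
  have h1 : ∀ᵐ x ∂(Measure.pi fun _ : Fin n => ρ), ∀ i j : Fin n, i ≠ j →
      (x i, x j) ∈ finiteSet (m / n) := by
    rw [ae_all_iff]; intro i
    rw [ae_all_iff]; intro j
    by_cases hij : i = j
    · exact Eventually.of_forall fun x hne => absurd hij hne
    · exact ((measurePreserving_eval_pair ρ hij).quasiMeasurePreserving.ae h).mono fun x hx _ => hx
  have hn0 : (n : ℝ) ≠ 0 := by positivity
  have : Nontrivial (Fin n) := Fin.nontrivial_iff_two_le.2 hn
  filter_upwards [h1] with x hx
  refine ⟨fun i j hij => ?_, fun i => ?_⟩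
  · by_contra hne
    exact (hx i j hne).1 hij
  · obtain ⟨j, hj⟩ := exists_ne i
    refine (hx i j hj.symm).2.1.imp_right fun h0 => ?_
    simpa [hn0] using h0

/-- The mean discrete energy of `n` independent points. -/
lemma integral_realEnergy_pi [IsProbabilityMeasure ρ]
    (h : Integrable (realKernel β (m / n)) (ρ.prod ρ)) :
    Integrable (realEnergy β m n) (Measure.pi fun _ : Fin n => ρ) ∧
      ∫ x, realEnergy β m n x ∂(Measure.pi fun _ : Fin n => ρ) =
        n * ((n : ℝ) - 1) * ∫ p, realKernel β (m / n) p ∂(ρ.prod ρ) := by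
  have hf : realEnergy β m n = fun x => ∑ p ∈ (Finset.univ : Finset (Fin n)).offDiag,
      realKernel β (m / n) (x p.1, x p.2) := funext fun x => realEnergy_eq_sum β m x
  have hp : ∀ p ∈ (Finset.univ : Finset (Fin n)).offDiag,
      MeasurePreserving (fun x : Fin n → ℝ => (x p.1, x p.2)) (Measure.pi fun _ => ρ)
        (ρ.prod ρ) := fun p hp => measurePreserving_eval_pair ρ (Finset.mem_offDiag.1 hp).2.2
  have hi : ∀ p ∈ (Finset.univ : Finset (Fin n)).offDiag,
      Integrable (fun x : Fin n → ℝ => realKernel β (m / n) (x p.1, x p.2))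
        (Measure.pi fun _ => ρ) := fun p hpm => (hp p hpm).integrable_comp_of_integrable h
  rw [hf]
  refine ⟨integrable_finsetSum _ hi, ?_⟩
  rw [integral_finsetSum _ hi]
  have hconst : ∀ p ∈ (Finset.univ : Finset (Fin n)).offDiag,
      ∫ x : Fin n → ℝ, realKernel β (m / n) (x p.1, x p.2) ∂(Measure.pi fun _ => ρ) =
        ∫ p, realKernel β (m / n) p ∂(ρ.prod ρ) := fun p hpm => by
    rw [← (hp p hpm).map_eq, integral_map (hp p hpm).aemeasurable
      (measurable_realKernel β _).aestronglyMeasurable]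
  rw [Finset.sum_congr rfl hconst]
  have := sum_offDiag_fst (n := n) fun _ => ∫ p, realKernel β (m / n) p ∂(ρ.prod ρ)
  rw [this]
  simp
  ring

/-- A lower bound for the discrete energy passes to the energy of every probability measure. -/
lemma le_energy_of_le_realEnergy (hβ : 0 < β) (hm : 0 ≤ m) (hn : 2 ≤ n) [IsProbabilityMeasure ρ]
    {L : ℝ} (hL : ∀ x : Fin n → ℝ, IsRegular m n x →
      n * ((n : ℝ) - 1) * L ≤ realEnergy β m n x) :
    (L : EReal) ≤ energy β (m / n) ρ := by
  have hn' : (2 : ℝ) ≤ n := by exact_mod_cast hn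
  rcases energy_eq_top_or hβ (div_nonneg hm (Nat.cast_nonneg n)) ρ with h | ⟨hae, hi, he⟩
  · rw [h]; exact le_top
  · rw [he, EReal.coe_le_coe_iff]
    obtain ⟨h1, h2⟩ := integral_realEnergy_pi hi
    have h3 : ∫ _, n * ((n : ℝ) - 1) * L ∂(Measure.pi fun _ : Fin n => ρ) ≤
        ∫ x, realEnergy β m n x ∂(Measure.pi fun _ : Fin n => ρ) :=
      integral_mono_ae (integrable_const _) h1 ((ae_isRegular_pi hn hae).mono hL)
    rw [h2, integral_const, probReal_univ, one_smul] at h3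
    exact le_of_mul_le_mul_left h3 (by nlinarith)

end Averaging

/-! ### The energy of the equilibrium measure -/

section EquilibriumEnergy

variable {β c δ : ℝ}

section BoundedDensity

variable {ν : Measure ℝ} [IsProbabilityMeasure ν] {M b : ℝ}

lemma HasBoundedDensity.integrable_realPotential (h : HasBoundedDensity ν M b) (δ : ℝ) :
    Integrable (realPotential δ) ν :=
  (h.integrable_of_continuous (by fun_prop : Continuous fun t : ℝ => t ^ 2)).sub
    (h.integrable_log_abs.const_mul _)

lemma HasBoundedDensity.integral_realPotential (h : HasBoundedDensity ν M b) (δ : ℝ) :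
    ∫ t, realPotential δ t ∂ν = ∫ t, t ^ 2 ∂ν - 2 * δ * ∫ t, Real.log |t| ∂ν := by
  unfold realPotential
  rw [integral_sub (h.integrable_of_continuous (by fun_prop : Continuous fun t : ℝ => t ^ 2))
    (h.integrable_log_abs.const_mul _), integral_const_mul]

lemma HasBoundedDensity.ae_mem_finiteSet (h : HasBoundedDensity ν M b) (δ : ℝ) :
    ∀ᵐ p ∂(ν.prod ν), p ∈ finiteSet δ := by
  refine (Measure.ae_prod_iff_ae_ae (measurableSet_finiteSet δ)).2 ?_
  filter_upwards [h.ae_ne 0] with s hs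
  filter_upwards [h.ae_ne 0, h.ae_ne s] with t ht hts
  exact ⟨hts.symm, Or.inl hs, Or.inl ht⟩

lemma HasBoundedDensity.integral_realKernel (h : HasBoundedDensity ν M b) (β δ : ℝ) :
    Integrable (realKernel β δ) (ν.prod ν) ∧
      ∫ p, realKernel β δ p ∂(ν.prod ν) = -(β / 2) * ∫ t, logPot ν t ∂ν
        + (∫ t, t ^ 2 ∂ν - 2 * δ * ∫ t, Real.log |t| ∂ν) := by
  have h1 := h.integrable_log_sub_prod.const_mul (-(β / 2))
  have h2 := ((h.integrable_realPotential δ).comp_fst ν).const_mul (1 / 2)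
  have h3 := ((h.integrable_realPotential δ).comp_snd ν).const_mul (1 / 2)
  have h12 := h1.add h2
  refine ⟨h12.add h3, ?_⟩
  have e1 : ∫ p, realKernel β δ p ∂(ν.prod ν) =
      -(β / 2) * ∫ p : ℝ × ℝ, Real.log |p.1 - p.2| ∂(ν.prod ν)
        + 1 / 2 * ∫ p : ℝ × ℝ, realPotential δ p.1 ∂(ν.prod ν)
        + 1 / 2 * ∫ p : ℝ × ℝ, realPotential δ p.2 ∂(ν.prod ν) := by
    rw [← integral_const_mul, ← integral_const_mul, ← integral_const_mul,
      ← integral_add h1 h2, ← integral_add (f := fun p : ℝ × ℝ =>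
        -(β / 2) * Real.log |p.1 - p.2| + 1 / 2 * realPotential δ p.1) h12 h3]
    rfl
  rw [e1, integral_fun_fst (f := realPotential δ), integral_fun_snd (f := realPotential δ),
    h.integral_logPot.2, h.integral_realPotential]
  simp
  ring

lemma HasBoundedDensity.energy_eq (h : HasBoundedDensity ν M b) (β δ : ℝ) :
    energy β δ ν = ((-(β / 2) * ∫ t, logPot ν t ∂ν
        + (∫ t, t ^ 2 ∂ν - 2 * δ * ∫ t, Real.log |t| ∂ν) : ℝ) : EReal) := by
  obtain ⟨h1, h2⟩ := h.integral_realKernel β δ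
  rw [energy, eintegral_eq_coe ((h.ae_mem_finiteSet δ).mono fun p hp => energyKernel_eq_coe hp) h1,
    h2]

end BoundedDensity

/-- The energy of the equilibrium measure for the parameter `c` in the potential with
parameter `δ`. -/
noncomputable def crossEnergy (β c δ : ℝ) : ℝ :=
  -(β / 2) * ∫ t, logPot (eqMeasure β c) t ∂(eqMeasure β c)
    + (∫ t, t ^ 2 ∂(eqMeasure β c) - 2 * δ * ∫ t, Real.log |t| ∂(eqMeasure β c))

lemma crossEnergy_self (hβ : 0 < β) (hc : 0 ≤ c) : crossEnergy β c c = eqEnergy β c := by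
  have := isProbabilityMeasure_eqMeasure hβ hc
  have hB := hasBoundedDensity_eqMeasure hβ hc
  have h2 := hB.integrable_of_continuous (by fun_prop : Continuous fun t : ℝ => t ^ 2)
  have h1 : Integrable (fun t => -(β * logPot (eqMeasure β c) t)) (eqMeasure β c) :=
    (hB.integral_logPot.1.const_mul β).neg
  have h3 := hB.integrable_log_abs.const_mul (2 * c)
  have h := integral_congr_ae (eulerLagrange_ae hβ hc)
  have h12 : Integrable (fun t => -(β * logPot (eqMeasure β c) t) + t ^ 2) (eqMeasure β c) :=
    h1.add h2
  rw [integral_sub h12 h3, integral_add h1 h2] at h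
  simp only [integral_neg, integral_const_mul, integral_const, probReal_univ,
    one_smul] at h
  rw [crossEnergy, eqEnergy]
  linarith

lemma tendsto_crossEnergy (hβ : 0 < β) (hc : 0 ≤ c) {α : ℕ → ℝ} (hα : Tendsto α atTop (𝓝 c)) :
    Tendsto (fun n => crossEnergy β c (α n)) atTop (𝓝 (eqEnergy β c)) := by
  rw [← crossEnergy_self hβ hc]
  unfold crossEnergy
  exact ((hα.const_mul 2).mul_const _).const_sub _ |>.const_add _

variable {μ : ℕ → ℝ}

/-- The energy part of `eventually_le_realEnergy`, with `n²` replaced by `n (n - 1)`. -/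
lemma eventually_mul_le_realEnergy (hβ : 0 < β) (hμ : ∀ n, 0 ≤ μ n)
    (hc : Tendsto (fun n : ℕ => μ n / (n : ℝ)) atTop (𝓝 c)) {L : ℝ} (hL : L < eqEnergy β c) :
    ∀ᶠ n : ℕ in atTop, ∀ x : Fin n → ℝ, IsRegular (μ n) n x →
      n * ((n : ℝ) - 1) * L ≤ realEnergy β (μ n) n x := by
  obtain ⟨κ, hκ, h⟩ := eventually_le_realEnergy hβ hμ hc
    (by linarith : 0 < (eqEnergy β c - L) / 2)
  obtain ⟨N, hN⟩ := exists_nat_ge (|L| / ((eqEnergy β c - L) / 2))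
  filter_upwards [h, eventually_ge_atTop N] with n hn hNn x hx
  refine le_trans ?_ (hn x hx)
  have h1 := charDist_nonneg (eqMeasure β c) n x
  have h2 : 0 ≤ ∑ i, x i ^ 2 := Finset.sum_nonneg fun i _ => sq_nonneg _
  have h3 : |L| ≤ n * ((eqEnergy β c - L) / 2) := by
    rw [← div_le_iff₀ (by linarith)]
    exact hN.trans (by exact_mod_cast hNn)
  have h4 : 0 ≤ κ * n * ∑ i, x i ^ 2 := by positivity
  have h5 : 0 ≤ (n : ℝ) ^ 2 * (β / 2 * charDist (eqMeasure β c) n x) := by positivity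
  have h6 := mul_le_mul_of_nonneg_left ((neg_le_abs L).trans h3) (Nat.cast_nonneg (α := ℝ) n)
  nlinarith

/-- The discrete energy of a minimizer is at most `n (n - 1)` times the energy of any measure, in
particular of the equilibrium measure. -/
lemma realEnergy_le_crossEnergy (hβ : 0 < β) (hc : 0 ≤ c) {m : ℝ} (hm : 0 ≤ m) {n : ℕ}
    (hn : 2 ≤ n) {x : Fin n → ℝ}
    (hmin : ∀ y, IsRegular m n y → realEnergy β m n x ≤ realEnergy β m n y) :
    realEnergy β m n x ≤ n * ((n : ℝ) - 1) * crossEnergy β c (m / n) := by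
  have hn' : (2 : ℝ) ≤ n := by exact_mod_cast hn
  have hpos : 0 < n * ((n : ℝ) - 1) := by nlinarith
  have := isProbabilityMeasure_eqMeasure hβ hc
  have h := le_energy_of_le_realEnergy (ρ := eqMeasure β c) hβ hm hn
    (L := realEnergy β m n x / (n * ((n : ℝ) - 1))) fun y hy => by
      rw [mul_div_cancel₀ _ hpos.ne']; exact hmin y hy
  rw [(hasBoundedDensity_eqMeasure hβ hc).energy_eq, EReal.coe_le_coe_iff,
    div_le_iff₀' hpos] at h
  exact h

lemma energy_eqMeasure (hβ : 0 < β) (hc : 0 ≤ c) :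
    energy β c (eqMeasure β c) = ((eqEnergy β c : ℝ) : EReal) := by
  have := isProbabilityMeasure_eqMeasure hβ hc
  rw [(hasBoundedDensity_eqMeasure hβ hc).energy_eq, ← crossEnergy_self hβ hc, crossEnergy]

/-- The equilibrium measure minimizes the energy. -/
theorem minEnergy_eq (hβ : 0 < β) (hc : 0 ≤ c) :
    minEnergy β c = ((eqEnergy β c : ℝ) : EReal) := by
  have := isProbabilityMeasure_eqMeasure hβ hc
  refine le_antisymm ?_ (le_iInf fun ρ => EReal.ge_of_forall_gt_iff_ge.1 fun L hL => ?_)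
  · rw [← energy_eqMeasure hβ hc]
    exact iInf_le (fun ρ : ProbabilityMeasure ℝ => energy β c (ρ : Measure ℝ))
      ⟨eqMeasure β c, this⟩
  -- apply the discrete lower bound to the sequence `c n`, whose ratio to `n` is constant
  · have hμ : ∀ n : ℕ, 0 ≤ c * (n : ℝ) := fun n => by positivity
    have hlim : Tendsto (fun n : ℕ => c * (n : ℝ) / (n : ℝ)) atTop (𝓝 c) := by
      refine tendsto_const_nhds.congr' ?_
      filter_upwards [eventually_ne_atTop 0] with n hn
      rw [mul_div_cancel_right₀ _ (Nat.cast_ne_zero.2 hn)]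
    obtain ⟨n, h1, h2⟩ := ((eventually_mul_le_realEnergy hβ hμ hlim
      (EReal.coe_lt_coe_iff.1 hL)).and (eventually_ge_atTop 2)).exists
    have h3 := le_energy_of_le_realEnergy (ρ := (ρ : Measure ℝ)) hβ (hμ n) h2 h1
    rwa [mul_div_cancel_right₀ _ (Nat.cast_ne_zero.2 (by omega))] at h3

/-- The normalised minimum of the discrete energy converges to the minimal energy. -/
theorem tendsto_tau (hβ : 0 < β) (hμ : ∀ n, 0 ≤ μ n)
    (hc : Tendsto (fun n : ℕ => μ n / (n : ℝ)) atTop (𝓝 c)) :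
    Tendsto (fun n : ℕ => tau β (μ n) n) atTop (𝓝 ((eqEnergy β c : ℝ) : EReal)) := by
  have hc0 : 0 ≤ c := ge_of_tendsto' hc fun n => div_nonneg (hμ n) (Nat.cast_nonneg n)
  have key : ∀ n : ℕ, ∃ e : ℝ, 2 ≤ n → tau β (μ n) n = e ∧ e ≤ crossEnergy β c (μ n / n) ∧
      ∀ L : ℝ, (∀ x : Fin n → ℝ, IsRegular (μ n) n x →
        n * ((n : ℝ) - 1) * L ≤ realEnergy β (μ n) n x) → L ≤ e := by
    intro n
    by_cases hn : 2 ≤ n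
    · have hn' : (2 : ℝ) ≤ n := by exact_mod_cast hn
      have hpos : 0 < n * ((n : ℝ) - 1) := by nlinarith
      obtain ⟨x, hx, hmin⟩ := exists_minimizer hβ (hμ n) hn
      refine ⟨1 / (n * ((n : ℝ) - 1)) * realEnergy β (μ n) n x, fun _ => ⟨?_, ?_, fun L hL => ?_⟩⟩
      · rw [tau, iInf_discreteEnergy_eq hβ (hμ n) hn hx hmin, EReal.coe_mul]
      · rw [one_div_mul_eq_div, div_le_iff₀' hpos]
        exact realEnergy_le_crossEnergy hβ hc0 (hμ n) hn hmin
      · rw [one_div_mul_eq_div, le_div_iff₀' hpos]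
        exact hL x hx
    · exact ⟨0, fun h => absurd h hn⟩
  choose e he using key
  have hlim : Tendsto e atTop (𝓝 (eqEnergy β c)) := by
    refine tendsto_order.2 ⟨fun L hL => ?_, fun U hU => ?_⟩
    · obtain ⟨L', hL', hL''⟩ := exists_between hL
      filter_upwards [eventually_mul_le_realEnergy hβ hμ hc hL'', eventually_ge_atTop 2]
        with n hn hn2
      exact hL'.trans_le ((he n hn2).2.2 L' hn)
    · filter_upwards [(tendsto_crossEnergy hβ hc0 hc).eventually_lt_const hU,
        eventually_ge_atTop 2] with n hn hn2
      exact (he n hn2).2.1.trans_lt hn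
  refine (continuous_coe_real_ereal.tendsto _ |>.comp hlim).congr' ?_
  filter_upwards [eventually_ge_atTop 2] with n hn
  exact (he n hn).1.symm

end EquilibriumEnergy

/-! ### The partition function -/

section PartitionFunction

variable {β m : ℝ} {n : ℕ}

/-- The integrand of the partition function. -/
noncomputable def gibbsWeight (β m : ℝ) (n : ℕ) (x : Fin n → ℝ) : ℝ :=
  Real.exp (-(n : ℝ) * ∑ k, x k ^ 2) * (∏ k, |x k| ^ (2 * m)) *
    ∏ i, ∏ j ∈ Finset.Ioi i, |x i - x j| ^ β

lemma sum_offDiag_eq_two_mul (f : Fin n → Fin n → ℝ) (hf : ∀ i j, f i j = f j i) :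
    ∑ p ∈ (Finset.univ : Finset (Fin n)).offDiag, f p.1 p.2 =
      2 * ∑ i, ∑ j ∈ Finset.Ioi i, f i j := by
  have h1 : ∑ p ∈ (Finset.univ : Finset (Fin n)).offDiag, f p.1 p.2 =
      ∑ i, ∑ j, if i ≠ j then f i j else 0 := by
    rw [← Fintype.sum_prod_type', ← Finset.sum_filter]
    refine Finset.sum_congr ?_ fun _ _ => rfl
    ext p; simp [Finset.mem_offDiag]
  have h2 : ∀ i, ∑ j ∈ Finset.Ioi i, f i j = ∑ j, if i < j then f i j else 0 := fun i => by
    rw [← Finset.sum_filter]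
    refine Finset.sum_congr ?_ fun _ _ => rfl
    ext j; simp
  have h3 : ∑ i, ∑ j, (if i < j then f i j else 0) = ∑ i, ∑ j, if j < i then f i j else 0 := by
    rw [Finset.sum_comm]
    simp_rw [hf]
  rw [h1, Finset.sum_congr rfl fun i _ => h2 i, two_mul]
  nth_rewrite 2 [h3]
  rw [← Finset.sum_add_distrib]
  refine Finset.sum_congr rfl fun i _ => ?_
  rw [← Finset.sum_add_distrib]
  refine Finset.sum_congr rfl fun j _ => ?_
  rcases lt_trichotomy i j with h | h | h
  · simp [h, h.ne, h.not_gt]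
  · simp [h]
  · simp [h, h.ne', h.not_gt]

lemma gibbsWeight_eq_exp {x : Fin n → ℝ} (hx : IsRegular m n x) :
    gibbsWeight β m n x =
      Real.exp (-realEnergy β m n x - ∑ i, realPotential (m / n) (x i)) := by
  have h1 : ∀ i ∈ (Finset.univ : Finset (Fin n)), |x i| ^ (2 * m) =
      Real.exp (2 * m * Real.log |x i|) := fun i _ => by
    rcases hx.2 i with h | h
    · rw [Real.rpow_def_of_pos (abs_pos.2 h), mul_comm]
    · simp [h]
  have h2 : ∀ i ∈ (Finset.univ : Finset (Fin n)), ∏ j ∈ Finset.Ioi i, |x i - x j| ^ β =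
      Real.exp (∑ j ∈ Finset.Ioi i, β * Real.log |x i - x j|) := fun i _ => by
    rw [Real.exp_sum]
    refine Finset.prod_congr rfl fun j hj => ?_
    have h := abs_pos.2 (sub_ne_zero.2 fun h => (Finset.mem_Ioi.1 hj).ne (hx.1 h))
    rw [Real.rpow_def_of_pos h, mul_comm]
  rw [gibbsWeight, Finset.prod_congr rfl h1, Finset.prod_congr rfl h2, ← Real.exp_sum,
    ← Real.exp_sum, ← Real.exp_add, ← Real.exp_add, realEnergy,
    sum_offDiag_eq_two_mul (fun i j => Real.log |x i - x j|) fun i j => by rw [abs_sub_comm]]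
  congr 1
  simp only [realPotential, Finset.sum_sub_distrib, ← Finset.mul_sum]
  rcases Nat.eq_zero_or_pos n with h0 | h0
  · subst h0; simp
  · have : (n : ℝ) ≠ 0 := by positivity
    field_simp
    ring

lemma gibbsWeight_eq_zero (hβ : 0 < β) {x : Fin n → ℝ} (hx : ¬IsRegular m n x) :
    gibbsWeight β m n x = 0 := by
  rw [gibbsWeight]
  by_cases h : Function.Injective x
  · have h2 : ∃ i, ¬(x i ≠ 0 ∨ m = 0) := by
      by_contra hcon
      exact hx ⟨h, fun i => not_not.1 fun hi => hcon ⟨i, hi⟩⟩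
    obtain ⟨i, hi⟩ := h2
    push Not at hi
    rw [Finset.prod_eq_zero (Finset.mem_univ i), mul_zero, zero_mul]
    rw [hi.1, abs_zero, Real.zero_rpow (mul_ne_zero two_ne_zero hi.2)]
  · rw [Function.not_injective_iff] at h
    obtain ⟨i, j, hij, hne⟩ := h
    wlog hlt : i < j generalizing i j
    · exact this j i hij.symm hne.symm (lt_of_le_of_ne (not_lt.1 hlt) hne.symm)
    have h0 : ∏ k ∈ Finset.Ioi i, |x i - x k| ^ β = 0 := by
      refine Finset.prod_eq_zero (Finset.mem_Ioi.2 hlt) ?_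
      rw [hij, sub_self, abs_zero, Real.zero_rpow hβ.ne']
    rw [Finset.prod_eq_zero (f := fun i => ∏ k ∈ Finset.Ioi i, |x i - x k| ^ β)
      (Finset.mem_univ i) h0, mul_zero]

lemma neg_realPotential_le {δ : ℝ} (hδ : 0 ≤ δ) (t : ℝ) :
    -realPotential δ t ≤ 2 * δ ^ 2 - 1 / 2 * t ^ 2 := by
  have h := mul_le_mul_of_nonneg_left (Real.log_le_self (abs_nonneg t)) hδ
  have := sq_nonneg (2 * δ - |t|)
  have := sq_abs t
  unfold realPotential
  nlinarith

/-- The partition function is at most its largest Boltzmann weight times a Gaussian integral. -/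
lemma partitionFn_le (hβ : 0 < β) (hm : 0 ≤ m) {e : ℝ}
    (he : ∀ x, IsRegular m n x → e ≤ realEnergy β m n x) :
    partitionFn β m n ≤ ENNReal.ofReal
      (Real.exp (-e + n * (2 * (m / n) ^ 2 + Real.log √(Real.pi / (1 / 2))))) := by
  have hg : Integrable (fun t : ℝ => Real.exp (-(1 / 2) * t ^ 2)) :=
    integrable_exp_neg_mul_sq (by norm_num)
  have hp : ∀ x, gibbsWeight β m n x ≤ Real.exp (-e + n * (2 * (m / n) ^ 2)) *
      ∏ i, Real.exp (-(1 / 2) * x i ^ 2) := by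
    intro x
    by_cases hx : IsRegular m n x
    · rw [gibbsWeight_eq_exp hx, ← Real.exp_sum, ← Real.exp_add, Real.exp_le_exp]
      have h1 := Finset.sum_le_sum fun i (_ : i ∈ (Finset.univ : Finset (Fin n))) =>
        neg_realPotential_le (div_nonneg hm (Nat.cast_nonneg n)) (x i)
      rw [Finset.sum_neg_distrib, Finset.sum_sub_distrib, Finset.sum_const, Finset.card_univ,
        Fintype.card_fin, nsmul_eq_mul] at h1
      simp only [neg_mul, Finset.sum_neg_distrib]
      linarith [he x hx]
    · rw [gibbsWeight_eq_zero hβ hx]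
      positivity
  calc partitionFn β m n
      = ∫⁻ x : Fin n → ℝ, ENNReal.ofReal (gibbsWeight β m n x) := rfl
    _ ≤ ∫⁻ x : Fin n → ℝ, ENNReal.ofReal (Real.exp (-e + n * (2 * (m / n) ^ 2)) *
          ∏ i, Real.exp (-(1 / 2) * x i ^ 2)) :=
        lintegral_mono fun x => ENNReal.ofReal_le_ofReal (hp x)
    _ = ENNReal.ofReal (∫ x : Fin n → ℝ, Real.exp (-e + n * (2 * (m / n) ^ 2)) *
          ∏ i, Real.exp (-(1 / 2) * x i ^ 2)) :=
        (ofReal_integral_eq_lintegral_ofReal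
          ((Integrable.fintype_prod (f := fun _ : Fin n => fun t : ℝ =>
            Real.exp (-(1 / 2) * t ^ 2)) fun _ => hg).const_mul _)
          (Eventually.of_forall fun x => by simp only [Pi.zero_apply]; positivity)).symm
    _ = _ := by
        rw [integral_const_mul, integral_fintype_prod_volume_eq_pow
          (fun t : ℝ => Real.exp (-(1 / 2) * t ^ 2)), integral_gaussian, Fintype.card_fin,
          mul_add, ← add_assoc, Real.exp_add _ (n * Real.log _), Real.exp_nat_mul (Real.log _) n,
          Real.exp_log (by positivity)]

/-- The comparison `ν ≤ M • volume` is passed to the product through the outer measures that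
define the product measures. -/
lemma pi_le_smul_volume {ν : Measure ℝ} [SigmaFinite ν] {M : NNReal}
    (h : ν ≤ (M : ℝ≥0∞) • volume) :
    Measure.pi (fun _ : Fin n => ν) ≤ (M : ℝ≥0∞) ^ n • volume := by
  have : SigmaFinite ((M : ℝ≥0∞) • (volume : Measure ℝ)) :=
    inferInstanceAs (SigmaFinite (M • (volume : Measure ℝ)))
  have h1 : Measure.pi (fun _ : Fin n => (M : ℝ≥0∞) • (volume : Measure ℝ)) =
      (M : ℝ≥0∞) ^ n • volume := by
    refine Measure.pi_eq fun s _ => ?_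
    simp [volume_pi_pi, Finset.prod_mul_distrib]
  rw [← h1, Measure.le_iff]
  intro s hs
  rw [Measure.pi, Measure.pi, toMeasure_apply _ _ hs, toMeasure_apply _ _ hs]
  refine (OuterMeasure.le_pi.2 fun t _ => ?_ : OuterMeasure.pi _ ≤ OuterMeasure.pi _) s
  exact (OuterMeasure.pi_pi_le _ t).trans (Finset.prod_le_prod' fun i _ => h (t i))

/-- Jensen's inequality for the exponential function. -/
lemma ofReal_exp_integral_le {X : Type*} [MeasurableSpace X] {P : Measure X}
    [IsProbabilityMeasure P] {g : X → ℝ} (hg : Integrable g P) :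
    ENNReal.ofReal (Real.exp (∫ x, g x ∂P)) ≤ ∫⁻ x, ENNReal.ofReal (Real.exp (g x)) ∂P := by
  set a := ∫ x, g x ∂P with ha
  have hi : Integrable (fun x => Real.exp a * (g x - a + 1)) P :=
    ((hg.sub (integrable_const a)).add (integrable_const 1)).const_mul _
  have h1 : ∫ x, Real.exp a * (g x - a + 1) ∂P = Real.exp a := by
    rw [integral_const_mul, integral_add (f := fun x => g x - a) (hg.sub (integrable_const a))
      (integrable_const 1), integral_sub hg (integrable_const a)]
    simp [← ha]
  calc ENNReal.ofReal (Real.exp a)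
      = ENNReal.ofReal (∫ x, Real.exp a * (g x - a + 1) ∂P) := by rw [h1]
    _ ≤ ∫⁻ x, ENNReal.ofReal (Real.exp a * (g x - a + 1)) ∂P := by
        refine ENNReal.ofReal_le_of_le_toReal ?_
        rw [integral_eq_lintegral_pos_part_sub_lintegral_neg_part hi]
        exact sub_le_self _ ENNReal.toReal_nonneg
    _ ≤ ∫⁻ x, ENNReal.ofReal (Real.exp (g x)) ∂P := by
        refine lintegral_mono fun x => ENNReal.ofReal_le_ofReal ?_
        have := mul_le_mul_of_nonneg_left (Real.add_one_le_exp (g x - a)) (Real.exp_pos a).le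
        rwa [← Real.exp_add, add_sub_cancel] at this

/-- The lower bound for the partition function obtained from Jensen's inequality for `n` independent
points distributed according to a measure with bounded density. -/
lemma HasBoundedDensity.le_partitionFn {ν : Measure ℝ} [IsProbabilityMeasure ν] {M b : ℝ}
    (h : HasBoundedDensity ν M b) (hM : 0 < M) (hn : 2 ≤ n) (β m : ℝ) :
    ENNReal.ofReal (Real.exp (-(n * ((n : ℝ) - 1) * ∫ p, realKernel β (m / n) p ∂(ν.prod ν))
      - n * ∫ t, realPotential (m / n) t ∂ν - n * Real.log M)) ≤ partitionFn β m n := by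
  obtain ⟨h1, h2⟩ := integral_realEnergy_pi (n := n) (h.integral_realKernel β (m / n)).1
  have hi := h.integrable_realPotential (m / n)
  have h3 : ∀ i ∈ (Finset.univ : Finset (Fin n)), Integrable
      (fun x : Fin n → ℝ => realPotential (m / n) (x i)) (Measure.pi fun _ => ν) := fun i _ =>
    (measurePreserving_eval (fun _ : Fin n => ν) i).integrable_comp_of_integrable hi
  have h4 : ∀ i ∈ (Finset.univ : Finset (Fin n)), ∫ x : Fin n → ℝ,
      realPotential (m / n) (x i) ∂(Measure.pi fun _ => ν) = ∫ t, realPotential (m / n) t ∂ν :=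
    fun i _ => by
      have he := measurePreserving_eval (fun _ : Fin n => ν) i
      have := integral_map (μ := Measure.pi fun _ : Fin n => ν) he.aemeasurable
        (f := realPotential (m / n)) (measurable_realPotential _).aestronglyMeasurable
      rw [he.map_eq] at this
      exact this.symm
  have hg := h1.neg.sub (integrable_finsetSum _ h3)
  have hgi : ∫ x, (-realEnergy β m n x - ∑ i, realPotential (m / n) (x i))
      ∂(Measure.pi fun _ : Fin n => ν) =
      -(n * ((n : ℝ) - 1) * ∫ p, realKernel β (m / n) p ∂(ν.prod ν))
        - n * ∫ t, realPotential (m / n) t ∂ν := by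
    rw [integral_sub (f := fun x => -realEnergy β m n x) h1.neg (integrable_finsetSum _ h3),
      integral_neg, h2, integral_finsetSum _ h3, Finset.sum_congr rfl h4]
    simp
  have hJ := ofReal_exp_integral_le hg
  have hle := pi_le_smul_volume (n := n) (M := M.toNNReal) h.le_smul_volume
  have hMn : ((M.toNNReal : ℝ≥0∞) ^ n) = ENNReal.ofReal (Real.exp (n * Real.log M)) := by
    rw [Real.exp_nat_mul, Real.exp_log hM, ENNReal.ofReal_pow hM.le]; rfl
  have h5 : ∫⁻ x, ENNReal.ofReal (Real.exp (-realEnergy β m n x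
      - ∑ i, realPotential (m / n) (x i))) ∂(Measure.pi fun _ : Fin n => ν) ≤
      ENNReal.ofReal (Real.exp (n * Real.log M)) * partitionFn β m n := by
    calc ∫⁻ x, ENNReal.ofReal (Real.exp (-realEnergy β m n x
          - ∑ i, realPotential (m / n) (x i))) ∂(Measure.pi fun _ : Fin n => ν)
        = ∫⁻ x, ENNReal.ofReal (gibbsWeight β m n x) ∂(Measure.pi fun _ : Fin n => ν) := by
          refine lintegral_congr_ae ?_
          filter_upwards [ae_isRegular_pi hn (h.ae_mem_finiteSet (m / n))] with x hx
          rw [gibbsWeight_eq_exp hx]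
      _ ≤ ∫⁻ x, ENNReal.ofReal (gibbsWeight β m n x) ∂((M.toNNReal : ℝ≥0∞) ^ n • volume) :=
          lintegral_mono' hle le_rfl
      _ = _ := by rw [lintegral_smul_measure, hMn]; rfl
  have h6 := (hJ.trans h5)
  simp only [Pi.sub_apply, Pi.neg_apply] at h6
  rw [hgi] at h6
  rw [Real.exp_sub _ (n * Real.log M), ENNReal.ofReal_div_of_pos (Real.exp_pos _)]
  exact ENNReal.div_le_of_le_mul' h6

lemma exists_log_eq_coe {A : ℝ≥0∞} {lo hi : ℝ} (h1 : ENNReal.ofReal (Real.exp lo) ≤ A)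
    (h2 : A ≤ ENNReal.ofReal (Real.exp hi)) :
    ∃ a : ℝ, ENNReal.log A = a ∧ lo ≤ a ∧ a ≤ hi := by
  have hA : A ≠ ⊤ := (h2.trans_lt ENNReal.ofReal_lt_top).ne
  have h1' := (ENNReal.ofReal_le_iff_le_toReal hA).1 h1
  have hpos := (Real.exp_pos lo).trans_le h1'
  refine ⟨Real.log A.toReal, ?_, (Real.le_log_iff_exp_le hpos).2 h1',
    (Real.log_le_iff_le_exp hpos).2 (ENNReal.toReal_le_of_le_ofReal (Real.exp_pos _).le h2)⟩
  rw [← ENNReal.log_ofReal_of_pos hpos, ENNReal.ofReal_toReal hA]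

variable {c : ℝ} {μ : ℕ → ℝ}

/-- The free energy converges to the minimal energy. -/
theorem tendsto_log_partitionFn (hβ : 0 < β) (hμ : ∀ n, 0 ≤ μ n)
    (hc : Tendsto (fun n : ℕ => μ n / (n : ℝ)) atTop (𝓝 c)) :
    Tendsto (fun n : ℕ => ((-(1 / (n : ℝ) ^ 2) : ℝ) : EReal) *
      ENNReal.log (partitionFn β (μ n) n)) atTop (𝓝 ((eqEnergy β c : ℝ) : EReal)) := by
  have hc0 : 0 ≤ c := ge_of_tendsto' hc fun n => div_nonneg (hμ n) (Nat.cast_nonneg n)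
  have := isProbabilityMeasure_eqMeasure hβ hc0
  have hB := hasBoundedDensity_eqMeasure hβ hc0
  have hb := outerEdge_pos hβ hc0
  set M := 2 / (Real.pi * β) * outerEdge β c with hM
  have hM0 : 0 < M := by have := Real.pi_pos; positivity
  set G : ℕ → ℝ := fun n => 2 * (μ n / n) ^ 2 + Real.log √(Real.pi / (1 / 2)) with hG
  set R : ℕ → ℝ := fun n =>
    ∫ t, t ^ 2 ∂(eqMeasure β c) - 2 * (μ n / n) * ∫ t, Real.log |t| ∂(eqMeasure β c) with hR
  have hGlim : Tendsto (fun n : ℕ => G n / n) atTop (𝓝 0) :=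
    (((hc.pow 2).const_mul 2).add_const _).div_atTop tendsto_natCast_atTop_atTop
  have hRlim : Tendsto (fun n : ℕ => (R n + Real.log M) / n) atTop (𝓝 0) :=
    (((hc.const_mul 2).mul_const _ |>.const_sub _).add_const _).div_atTop
      tendsto_natCast_atTop_atTop
  have hone : Tendsto (fun n : ℕ => 1 - 1 / (n : ℝ)) atTop (𝓝 1) := by
    simpa using (tendsto_one_div_atTop_nhds_zero_nat (𝕜 := ℝ)).const_sub 1
  have key : ∀ n : ℕ, ∃ a : ℝ, 2 ≤ n → ENNReal.log (partitionFn β (μ n) n) = a ∧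
      -(1 / (n : ℝ) ^ 2) * a ≤
        (1 - 1 / (n : ℝ)) * crossEnergy β c (μ n / n) + (R n + Real.log M) / n ∧
      ∀ L : ℝ, (∀ x : Fin n → ℝ, IsRegular (μ n) n x →
        n * ((n : ℝ) - 1) * L ≤ realEnergy β (μ n) n x) →
        (1 - 1 / (n : ℝ)) * L - G n / n ≤ -(1 / (n : ℝ) ^ 2) * a := by
    intro n
    by_cases hn : 2 ≤ n
    · have hn' : (2 : ℝ) ≤ n := by exact_mod_cast hn
      have hn2 : 0 < (n : ℝ) ^ 2 := by positivity
      obtain ⟨x, hx, hmin⟩ := exists_minimizer hβ (hμ n) hn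
      have hlow := hB.le_partitionFn hM0 hn β (μ n)
      rw [(hB.integral_realKernel β _).2, hB.integral_realPotential] at hlow
      obtain ⟨a, ha, ha1, ha2⟩ := exists_log_eq_coe hlow (partitionFn_le hβ (hμ n) hmin)
      refine ⟨a, fun _ => ⟨ha, ?_, fun L hL => ?_⟩⟩
      · have : -(1 / (n : ℝ) ^ 2) * a = -a / (n : ℝ) ^ 2 := by ring
        rw [this, div_le_iff₀ hn2, crossEnergy]
        have h : -a ≤ n * ((n : ℝ) - 1) * (-(β / 2) * ∫ t, logPot (eqMeasure β c) t
            ∂(eqMeasure β c) + R n) + n * R n + n * Real.log M := by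
          simp only [hR]; linarith
        refine h.trans (le_of_eq ?_)
        simp only [hR]
        field_simp
        ring
      · have : -(1 / (n : ℝ) ^ 2) * a = -a / (n : ℝ) ^ 2 := by ring
        rw [this, le_div_iff₀ hn2]
        have h : n * ((n : ℝ) - 1) * L - n * G n ≤ -a := by
          have := hL x hx
          simp only [hG]; linarith
        refine le_trans (le_of_eq ?_) h
        field_simp
    · exact ⟨0, fun h => absurd h hn⟩
  choose a ha using key
  have hlim : Tendsto (fun n : ℕ => -(1 / (n : ℝ) ^ 2) * a n) atTop (𝓝 (eqEnergy β c)) := by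
    refine tendsto_order.2 ⟨fun L hL => ?_, fun U hU => ?_⟩
    · obtain ⟨L', hL', hL''⟩ := exists_between hL
      have h := ((hone.mul_const L').sub hGlim)
      rw [one_mul, sub_zero] at h
      filter_upwards [eventually_mul_le_realEnergy hβ hμ hc hL'', eventually_ge_atTop 2,
        h.eventually_const_lt hL'] with n hn hn2 hn3
      exact hn3.trans_le ((ha n hn2).2.2 L' hn)
    · have h := (hone.mul (tendsto_crossEnergy hβ hc0 hc)).add hRlim
      rw [one_mul, add_zero] at h
      filter_upwards [h.eventually_lt_const hU, eventually_ge_atTop 2] with n hn hn2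
      exact (ha n hn2).2.1.trans_lt hn
  refine (continuous_coe_real_ereal.tendsto _ |>.comp hlim).congr' ?_
  filter_upwards [eventually_ge_atTop 2] with n hn
  rw [(ha n hn).1, ← EReal.coe_mul]
  rfl

end PartitionFunction

/-! ### Weak convergence of the minimizers -/

section WeakConvergence

lemma norm_charFun_sub_le {ρ : Measure ℝ} [IsProbabilityMeasure ρ]
    (hρ : Integrable (fun t : ℝ => |t|) ρ) (ξ ζ : ℝ) :
    ‖charFun ρ ξ - charFun ρ ζ‖ ≤ |ξ - ζ| * ∫ t, |t| ∂ρ := by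
  have hi : ∀ ξ : ℝ, Integrable (fun t : ℝ => Complex.exp (ξ * t * Complex.I)) ρ := fun ξ => by
    refine (integrable_const (1 : ℝ)).mono' (by fun_prop) (Eventually.of_forall fun t => ?_)
    rw [← Complex.ofReal_mul, Complex.norm_exp_ofReal_mul_I]
  rw [charFun_apply_real, charFun_apply_real, ← integral_sub (hi ξ) (hi ζ), ← integral_const_mul]
  refine norm_integral_le_of_norm_le (hρ.const_mul _) (Eventually.of_forall fun t => ?_)
  have h1 : Complex.exp (ξ * t * Complex.I) - Complex.exp (ζ * t * Complex.I) =
      Complex.exp ((ζ * t : ℝ) * Complex.I) *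
        (Complex.exp (Complex.I * ((ξ - ζ) * t : ℝ)) - 1) := by
    rw [mul_sub, ← Complex.exp_add, mul_one]
    push_cast
    ring_nf
  rw [h1, norm_mul, Complex.norm_exp_ofReal_mul_I, one_mul, ← abs_mul, ← Real.norm_eq_abs]
  exact Real.norm_exp_I_mul_ofReal_sub_one_le

/-- Characteristic functions with a common Lipschitz constant are close at a point if they are close
in the weighted `L²` sense. -/
lemma le_charDist_of_le_norm_charFun_sub {ν : Measure ℝ} [IsProbabilityMeasure ν] {n : ℕ}
    (hn : n ≠ 0) {x : Fin n → ℝ} {S ε ξ : ℝ} (hξ : 0 ≤ ξ) (hε : 0 < ε) (hS : 0 < S)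
    (hν : Integrable (fun t : ℝ => |t|) ν) (hνS : ∫ t, |t| ∂ν ≤ S)
    (hx : ∫ t, |t| ∂(empirical n x) ≤ S)
    (h : ε ≤ ‖charFun (empirical n x) ξ - charFun ν ξ‖) :
    ε / (4 * S) * (Real.exp (-2 * (ξ + ε / (4 * S))) * (ε / 2) ^ 2) ≤ charDist ν n x := by
  have := isProbabilityMeasure_empirical hn x
  set r := ε / (4 * S) with hr
  have hr0 : 0 < r := by positivity
  have hrS : r * (2 * S) = ε / 2 := by rw [hr]; field_simp; norm_num
  set F : ℝ → ℝ := fun ζ =>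
    Real.exp (-2 * ζ) * ‖charFun (empirical n x) ζ - charFun ν ζ‖ ^ 2 with hF
  have hFi : IntegrableOn F (Set.Ioi 0) := by
    have h1 : IntegrableOn (fun ζ : ℝ => Real.exp (-2 * ζ) * 4) (Set.Ioi 0) :=
      (integrableOn_exp_mul_Ioi (by norm_num : (-2 : ℝ) < 0) 0).mul_const 4
    refine h1.mono' ?_ (Eventually.of_forall fun ζ => ?_)
    · exact (Measurable.mul (by fun_prop)
        ((measurable_charFun.sub measurable_charFun).norm.pow_const 2)).aestronglyMeasurable
    · rw [Real.norm_of_nonneg (by positivity)]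
      refine mul_le_mul_of_nonneg_left ?_ (Real.exp_pos _).le
      have h2 : ‖charFun (empirical n x) ζ - charFun ν ζ‖ ≤ 1 + 1 :=
        (norm_sub_le _ _).trans (add_le_add (norm_charFun_le_one _) (norm_charFun_le_one _))
      nlinarith [norm_nonneg (charFun (empirical n x) ζ - charFun ν ζ)]
  have hlow : ∀ ζ ∈ Set.Ioc ξ (ξ + r), Real.exp (-2 * (ξ + r)) * (ε / 2) ^ 2 ≤ F ζ := by
    intro ζ hζ
    have hd : |ξ - ζ| ≤ r := by rw [abs_le]; constructor <;> linarith [hζ.1, hζ.2]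
    have h1 : ‖charFun (empirical n x) ξ - charFun (empirical n x) ζ‖ ≤ r * S :=
      (norm_charFun_sub_le (integrable_empirical x _) ξ ζ).trans
        (mul_le_mul hd hx (integral_nonneg fun t => abs_nonneg t) hr0.le)
    have h2 : ‖charFun ν ξ - charFun ν ζ‖ ≤ r * S :=
      (norm_charFun_sub_le hν ξ ζ).trans
        (mul_le_mul hd hνS (integral_nonneg fun t => abs_nonneg t) hr0.le)
    have h3 : ‖charFun (empirical n x) ξ - charFun ν ξ‖ ≤
        ‖charFun (empirical n x) ζ - charFun ν ζ‖ + r * S + r * S := by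
      have e : charFun (empirical n x) ξ - charFun ν ξ =
          (charFun (empirical n x) ζ - charFun ν ζ)
            + (charFun (empirical n x) ξ - charFun (empirical n x) ζ)
            - (charFun ν ξ - charFun ν ζ) := by ring
      rw [e]
      refine (norm_sub_le _ _).trans (add_le_add ((norm_add_le _ _).trans ?_) h2)
      exact add_le_add le_rfl h1
    have h4 : ε / 2 ≤ ‖charFun (empirical n x) ζ - charFun ν ζ‖ := by linarith
    exact mul_le_mul (Real.exp_le_exp.2 (by linarith [hζ.2]))
      (pow_le_pow_left₀ (by positivity) h4 2) (by positivity) (Real.exp_pos _).le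
  have hsub : Set.Ioc ξ (ξ + r) ⊆ Set.Ioi 0 := fun ζ hζ => hξ.trans_lt hζ.1
  calc r * (Real.exp (-2 * (ξ + r)) * (ε / 2) ^ 2)
      = ∫ _ in Set.Ioc ξ (ξ + r), Real.exp (-2 * (ξ + r)) * (ε / 2) ^ 2 := by
        rw [setIntegral_const, Real.volume_real_Ioc_of_le (by linarith), smul_eq_mul]
        ring
    _ ≤ ∫ ζ in Set.Ioc ξ (ξ + r), F ζ :=
        setIntegral_mono_on (integrable_const _) (hFi.mono_set hsub) measurableSet_Ioc hlow
    _ ≤ ∫ ζ in Set.Ioi 0, F ζ :=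
        setIntegral_mono_set hFi (Eventually.of_forall fun ζ => by
          simp only [hF, Pi.zero_apply]; positivity) hsub.eventuallyLE

variable {β c : ℝ} {μ : ℕ → ℝ}

/-- The energy of a minimizer is at most `n (n - 1)` times that of the equilibrium measure, so the
lower bound `eventually_le_realEnergy` forces `charDist` to `0` and bounds the second moments, which
gives the characteristic functions a common Lipschitz constant. -/
lemma tendsto_charFun_empirical (hβ : 0 < β) (hμ : ∀ n, 0 ≤ μ n)
    (hc : Tendsto (fun n : ℕ => μ n / (n : ℝ)) atTop (𝓝 c)) {x : (n : ℕ) → Fin n → ℝ}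
    (hx : ∀ n, 2 ≤ n → IsFekete β (μ n) n (x n)) (ξ : ℝ) :
    Tendsto (fun n => charFun (empirical n (x n)) ξ) atTop (𝓝 (charFun (eqMeasure β c) ξ)) := by
  have hc0 : 0 ≤ c := ge_of_tendsto' hc fun n => div_nonneg (hμ n) (Nat.cast_nonneg n)
  have := isProbabilityMeasure_eqMeasure hβ hc0
  have hB := hasBoundedDensity_eqMeasure hβ hc0
  wlog hξ : 0 ≤ ξ generalizing ξ
  · have h := this (-ξ) (by linarith [not_le.1 hξ])
    simp only [charFun_neg] at h
    simpa [Function.comp_def] using (Complex.continuous_conj.tendsto _).comp h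
  have hmin : ∀ n : ℕ, 2 ≤ n → IsRegular (μ n) n (x n) ∧
      realEnergy β (μ n) n (x n) ≤ n ^ 2 * ((1 - 1 / (n : ℝ)) * crossEnergy β c (μ n / n)) := by
    intro n hn
    obtain ⟨h1, h2⟩ := (isFekete_iff hβ (hμ n) hn).1 (hx n hn)
    refine ⟨h1, (realEnergy_le_crossEnergy hβ hc0 (hμ n) hn h2).trans (le_of_eq ?_)⟩
    have : (n : ℝ) ≠ 0 := by positivity
    field_simp
  have hlim : Tendsto (fun n : ℕ => (1 - 1 / (n : ℝ)) * crossEnergy β c (μ n / n)) atTop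
      (𝓝 (eqEnergy β c)) := by
    have hone : Tendsto (fun n : ℕ => 1 - 1 / (n : ℝ)) atTop (𝓝 1) := by
      simpa using (tendsto_one_div_atTop_nhds_zero_nat (𝕜 := ℝ)).const_sub 1
    simpa using hone.mul (tendsto_crossEnergy hβ hc0 hc)
  have hgap : ∀ η : ℝ, 0 < η → ∃ κ : ℝ, 0 < κ ∧ ∀ᶠ n : ℕ in atTop, 2 ≤ n ∧
      β / 2 * charDist (eqMeasure β c) n (x n) + κ * (1 / (n : ℝ) * ∑ i, x n i ^ 2) ≤ 2 * η := by
    intro η hη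
    obtain ⟨κ, hκ, h⟩ := eventually_le_realEnergy hβ hμ hc hη
    refine ⟨κ, hκ, ?_⟩
    filter_upwards [h, eventually_ge_atTop 2,
      hlim.eventually_lt_const (by linarith : eqEnergy β c < eqEnergy β c + η)] with n h1 h2 h3
    refine ⟨h2, ?_⟩
    have hn2 : (0 : ℝ) < (n : ℝ) ^ 2 := by positivity
    have h4 := (h1 (x n) (hmin n h2).1).trans (hmin n h2).2
    have h5 : κ * n * ∑ i, x n i ^ 2 = (n : ℝ) ^ 2 * (κ * (1 / (n : ℝ) * ∑ i, x n i ^ 2)) := by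
      have : (n : ℝ) ≠ 0 := by positivity
      field_simp
    rw [h5, ← mul_add] at h4
    linarith [le_of_mul_le_mul_left h4 hn2]
  -- a common bound `S` for the first absolute moments
  obtain ⟨κ, hκ, hmom⟩ := hgap 1 one_pos
  have hν := hB.integrable_of_continuous continuous_abs
  set S := 1 + 2 / κ + ∫ t, |t| ∂(eqMeasure β c) with hS
  have hI : 0 ≤ ∫ t, |t| ∂(eqMeasure β c) := integral_nonneg fun t => abs_nonneg t
  have hκ' : 0 < 2 / κ := by positivity
  rw [tendsto_iff_norm_sub_tendsto_zero]
  refine tendsto_order.2 ⟨fun a ha => Eventually.of_forall fun n => ha.trans_le (norm_nonneg _),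
    fun ε hε => ?_⟩
  set D := ε / (4 * S) * (Real.exp (-2 * (ξ + ε / (4 * S))) * (ε / 2) ^ 2) with hD
  have hS0 : 0 < S := by linarith
  have hD0 : 0 < D := by positivity
  obtain ⟨κ', hκ', hdist⟩ := hgap (β / 8 * D) (by positivity)
  filter_upwards [hmom, hdist] with n h1 h2
  by_contra hcon
  have hn0 : n ≠ 0 := by omega
  have hsum : 0 ≤ 1 / (n : ℝ) * ∑ i, x n i ^ 2 :=
    mul_nonneg (by positivity) (Finset.sum_nonneg fun i _ => sq_nonneg _)
  have hfirst : ∫ t, |t| ∂(empirical n (x n)) ≤ S := by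
    have hp := isProbabilityMeasure_empirical hn0 (x n)
    have h3 : ∫ t, |t| ∂(empirical n (x n)) ≤ ∫ t, (1 + t ^ 2) ∂(empirical n (x n)) := by
      refine integral_mono (integrable_empirical _ _) (integrable_empirical _ _) fun t => ?_
      simp only
      nlinarith [sq_nonneg (|t| - 1), sq_abs t]
    rw [integral_add (integrable_const _) (integrable_empirical _ _),
      integral_empirical _ (fun t => t ^ 2)] at h3
    simp only [integral_const, probReal_univ, smul_eq_mul, mul_one] at h3
    have h4 : 1 / (n : ℝ) * ∑ i, x n i ^ 2 ≤ 2 / κ := by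
      rw [le_div_iff₀' hκ]
      have := mul_nonneg hβ.le (charDist_nonneg (eqMeasure β c) n (x n))
      linarith [h1.2]
    linarith
  have h3 := le_charDist_of_le_norm_charFun_sub hn0 hξ hε hS0 hν (by linarith) hfirst
    (not_lt.1 hcon)
  rw [← hD] at h3
  have h4 := mul_le_mul_of_nonneg_left h3 (by positivity : 0 ≤ β / 2)
  have h5 := h2.2
  have h6 := mul_nonneg hκ'.le hsum
  have h7 : 0 < β * D := by positivity
  linarith

/-- The empirical measures of minimizers converge weakly to the equilibrium measure. -/
theorem tendsto_integral_empirical (hβ : 0 < β) (hμ : ∀ n, 0 ≤ μ n)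
    (hc : Tendsto (fun n : ℕ => μ n / (n : ℝ)) atTop (𝓝 c)) {x : (n : ℕ) → Fin n → ℝ}
    (hx : ∀ n, 2 ≤ n → IsFekete β (μ n) n (x n)) (f : ℝ →ᵇ ℝ) :
    Tendsto (fun n : ℕ => ∫ t, f t ∂(empirical n (x n))) atTop
      (𝓝 (∫ t, f t ∂(eqMeasure β c))) := by
  have hc0 : 0 ≤ c := ge_of_tendsto' hc fun n => div_nonneg (hμ n) (Nat.cast_nonneg n)
  have := isProbabilityMeasure_eqMeasure hβ hc0
  -- the empirical measure of no points at all is not a probability measure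
  let P : ℕ → ProbabilityMeasure ℝ := fun n =>
    ⟨empirical (n + 1) (x (n + 1)), isProbabilityMeasure_empirical n.succ_ne_zero _⟩
  have hP : Tendsto P atTop (𝓝 ⟨eqMeasure β c, this⟩) :=
    ProbabilityMeasure.tendsto_of_tendsto_charFun fun ξ =>
      (tendsto_add_atTop_iff_nat (f := fun n => charFun (empirical n (x n)) ξ) 1).2
        (tendsto_charFun_empirical hβ hμ hc hx ξ)
  rw [← tendsto_add_atTop_iff_nat 1]
  exact ProbabilityMeasure.tendsto_iff_forall_integral_tendsto.1 hP f

end WeakConvergence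

end LogGas

theorem proposition4p6 (β : ℝ) (hβ : 0 < β) (μ : ℕ → ℝ) (hμ : ∀ n, 0 ≤ μ n) (c : ℝ)
    (hc : Tendsto (fun n : ℕ => μ n / (n : ℝ)) atTop (𝓝 c)) :
    -- `E*` is a finite number, and it is the energy of the probability measure `ν_{β,c}`
    (IsProbabilityMeasure (LogGas.eqMeasure β c) ∧
      LogGas.energy β c (LogGas.eqMeasure β c) = LogGas.minEnergy β c ∧
      LogGas.minEnergy β c ≠ ⊥ ∧ LogGas.minEnergy β c ≠ ⊤) ∧
    -- (1)
    Tendsto (fun n : ℕ => LogGas.tau β (μ n) n) atTop (𝓝 (LogGas.minEnergy β c)) ∧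
    -- (2), for minimizers (they exist) chosen in any way
    (∀ n : ℕ, 2 ≤ n → ∃ x : Fin n → ℝ, LogGas.IsFekete β (μ n) n x) ∧
    (∀ x : (n : ℕ) → Fin n → ℝ, (∀ n, 2 ≤ n → LogGas.IsFekete β (μ n) n (x n)) →
      ∀ f : ℝ →ᵇ ℝ,
        Tendsto (fun n : ℕ => ∫ t, f t ∂(LogGas.empirical n (x n))) atTop
          (𝓝 (∫ t, f t ∂(LogGas.eqMeasure β c)))) ∧
    -- (3)
    Tendsto (fun n : ℕ => ((-(1 / (n : ℝ) ^ 2) : ℝ) : EReal) *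
        ENNReal.log (LogGas.partitionFn β (μ n) n)) atTop
      (𝓝 (LogGas.minEnergy β c)) := by
  have hc0 : 0 ≤ c := ge_of_tendsto' hc fun n => div_nonneg (hμ n) (Nat.cast_nonneg n)
  have hE := LogGas.minEnergy_eq hβ hc0
  rw [hE]
  refine ⟨⟨LogGas.isProbabilityMeasure_eqMeasure hβ hc0, LogGas.energy_eqMeasure hβ hc0,
    EReal.coe_ne_bot _, EReal.coe_ne_top _⟩, LogGas.tendsto_tau hβ hμ hc, fun n hn => ?_,
    fun x hx f => LogGas.tendsto_integral_empirical hβ hμ hc hx f,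
    LogGas.tendsto_log_partitionFn hβ hμ hc⟩
  obtain ⟨x, hx⟩ := LogGas.exists_minimizer hβ (hμ n) hn
  exact ⟨x, (LogGas.isFekete_iff hβ (hμ n) hn).2 hx⟩
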